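/- For $X\subseteq\mathbb R^2$ and $\rho>0$ let $D_\rho(x)$ be the closed disk of radius $\rho$ around $x$, let $\mathrm{offset}(X,\rho)=X\oplus D_\rho(0)$ (Minkowski sum) and $\mathrm{inset}(X,\rho)=\{x\mid D_\rho(x)\subseteq X\}$. Let $Q$ be a (filled, closed) convex polygon with vertices $q_1,\dots,q_n$, $n\ge 3$, given in counterclockwise order (no vertex lying on the segment between two others), let $r,\varepsilon>0$, and put $\Pi=\mathrm{inset}(\mathrm{offset}(Q,\varepsilon),r)$. The procedure Decide$(Q,r,\varepsilon)$ returns YES if $Q\subseteq\mathrm{offset}(\Pi,r+\varepsilon)$ and NO otherwise. The procedure ConvexDecide$(Q,r,\varepsilon)$ returns YES if $D_{r+\varepsilon}(q_i)\cap\Pi\neq\emptyset$ for all $i=1,\dots,n$, and NO otherwise. (1) For all such $Q,r,\varepsilon$, ConvexDecide$(Q,r,\varepsilon)$ and Decide$(Q,r,\varepsilon)$ return the same answer. (2) ConvexDecide can be implemented to run in $O(n)$ time on a real RAM (integer registers and arrays for addresses and counters; real registers and arrays with $+,-,\times,/,\sqrt{\phantom{x}}$ and comparisons of reals, integer constants only,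 no rounding and no conversion of reals to integers; unit cost per operation): there are a single program and a constant $C$ such that, for every input $(q_1,\dots,q_n,r,\varepsilon)$ as above, the program halts after at most $C\,n$ steps with the answer of ConvexDecide$(Q,r,\varepsilon)$. Moreover, whenever $\varepsilon<r$, it has then also computed $\Pi$, which is a (possibly empty or degenerate) convex polygon, as the list of its vertices in counterclockwise order. -/

import Mathlib

open scoped Pointwise

namespace OffsetDecon

/-! ### Plane geometry: offsets, insets, convex polygons -/

/-- The Euclidean plane. -/
abbrev Plane : Type := EuclideanSpace ℝ (Fin 2)

/-- The `ρ`-offset of `X`: the Minkowski sum of `X` with the closed disk of radius `ρ`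
centred at the origin. -/
def offset (X : Set Plane) (ρ : ℝ) : Set Plane := X + Metric.closedBall (0 : Plane) ρ

/-- The `ρ`-inset of `X`: all centres of closed `ρ`-disks contained in `X`. -/
def inset (X : Set Plane) (ρ : ℝ) : Set Plane := {x | Metric.closedBall x ρ ⊆ X}

/-- Twice the signed area of the triangle `a b c`; it is positive if and only if `a, b, c` is
a counterclockwise (left) turn. -/
def orient (a b c : Plane) : ℝ :=
  (b 0 - a 0) * (c 1 - a 1) - (b 1 - a 1) * (c 0 - a 0)

/-- The points `q 0, …, q (n - 1)` are pairwise distinct, and every `q j` other than the two end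
points of the directed edge from `q i` to its cyclic successor lies strictly to the left of that
edge.  For `n ≥ 3` this says that the points are the vertices of a convex polygon, listed in
counterclockwise order.  For `n = 0, 1, 2` it describes the vertices of the empty set, of a point
and of a nondegenerate segment. -/
def IsCCWConvex {n : ℕ} (q : Fin n → Plane) : Prop :=
  Function.Injective q ∧
    ∀ i j : Fin n, j ≠ i → j ≠ finRotate n i → 0 < orient (q i) (q (finRotate n i)) (q j)

/-- The (filled, closed) convex polygon with vertices `q 0, …, q (n - 1)`. -/
def polygon {n : ℕ} (q : Fin n → Plane) : Set Plane := convexHull ℝ (Set.range q)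

/-- The set `Π`: the `r`-inset of the `ε`-offset of `Q`. -/
def core (Q : Set Plane) (r ε : ℝ) : Set Plane := inset (offset Q ε) r

/-- The procedure `Decide` returns YES on `(Q, r, ε)`. -/
def Decide (Q : Set Plane) (r ε : ℝ) : Prop := Q ⊆ offset (core Q r ε) (r + ε)

/-- The procedure `ConvexDecide` returns YES on the convex polygon with vertex list `q` and
parameters `r, ε`: each disk of radius `r + ε` around a vertex meets `Π`. -/
def ConvexDecide {n : ℕ} (q : Fin n → Plane) (r ε : ℝ) : Prop :=
  ∀ i : Fin n, (Metric.closedBall (q i) (r + ε) ∩ core (polygon q) r ε).Nonempty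

/-! ### The real RAM

Programs are structured programs over integer registers, real registers, integer arrays and real
arrays.  Registers and arrays are named by natural numbers; a program mentions only finitely many
of them.  Natural numbers serve as addresses and counters.  On reals there are the four field
operations, square roots and comparisons; there is no rounding and no conversion from reals to
integers, and only integer constants may occur.  Each operation, operand, test and assignment
costs one unit. -/

/-- A memory state. -/
structure State where
  /-- integer registers -/
  ireg : ℕ → ℕ
  /-- real registers -/
  rreg : ℕ → ℝ
  /-- integer arrays: `iarr a k` is cell `k` of array `a` -/
  iarr : ℕ → ℕ → ℕ
  /-- real arrays: `rarr a k` is cell `k` of array `a` -/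
  rarr : ℕ → ℕ → ℝ

/-- Integer expressions. -/
inductive IExp where
  | const (k : ℕ)
  | reg (x : ℕ)
  | load (a : ℕ) (addr : IExp)
  | add (e f : IExp)
  | sub (e f : IExp)

/-- Value of an integer expression (subtraction is truncated at zero). -/
def IExp.eval (s : State) : IExp → ℕ
  | .const k => k
  | .reg x => s.ireg x
  | .load a addr => s.iarr a (addr.eval s)
  | .add e f => e.eval s + f.eval s
  | .sub e f => e.eval s - f.eval s

/-- Cost of evaluating an integer expression. -/
def IExp.cost : IExp → ℕ
  | .const _ => 1
  | .reg _ => 1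
  | .load _ addr => addr.cost + 1
  | .add e f => e.cost + f.cost + 1
  | .sub e f => e.cost + f.cost + 1

/-- Real expressions. -/
inductive RExp where
  | const (z : ℤ)
  | reg (x : ℕ)
  | load (a : ℕ) (addr : IExp)
  | add (e f : RExp)
  | sub (e f : RExp)
  | mul (e f : RExp)
  | div (e f : RExp)
  | sqrt (e : RExp)

/-- Value of a real expression.  Division by zero and square roots of negative numbers give zero;
a program can test for these cases, so nothing is gained from this convention. -/
noncomputable def RExp.eval (s : State) : RExp → ℝ
  | .const z => (z : ℝ)
  | .reg x => s.rreg x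
  | .load a addr => s.rarr a (addr.eval s)
  | .add e f => e.eval s + f.eval s
  | .sub e f => e.eval s - f.eval s
  | .mul e f => e.eval s * f.eval s
  | .div e f => e.eval s / f.eval s
  | .sqrt e => Real.sqrt (e.eval s)

/-- Cost of evaluating a real expression. -/
def RExp.cost : RExp → ℕ
  | .const _ => 1
  | .reg _ => 1
  | .load _ addr => addr.cost + 1
  | .add e f => e.cost + f.cost + 1
  | .sub e f => e.cost + f.cost + 1
  | .mul e f => e.cost + f.cost + 1
  | .div e f => e.cost + f.cost + 1
  | .sqrt e => e.cost + 1

/-- Tests. -/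
inductive Test where
  | ilt (e f : IExp)
  | ieq (e f : IExp)
  | rlt (e f : RExp)
  | req (e f : RExp)
  | not (b : Test)
  | and (b c : Test)

/-- Truth of a test in a state. -/
def Test.Holds (s : State) : Test → Prop
  | .ilt e f => e.eval s < f.eval s
  | .ieq e f => e.eval s = f.eval s
  | .rlt e f => e.eval s < f.eval s
  | .req e f => e.eval s = f.eval s
  | .not b => ¬ b.Holds s
  | .and b c => b.Holds s ∧ c.Holds s

/-- Cost of a test. -/
def Test.cost : Test → ℕ
  | .ilt e f => e.cost + f.cost + 1
  | .ieq e f => e.cost + f.cost + 1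
  | .rlt e f => e.cost + f.cost + 1
  | .req e f => e.cost + f.cost + 1
  | .not b => b.cost + 1
  | .and b c => b.cost + c.cost + 1

/-- Programs. -/
inductive Program where
  | skip
  /-- set integer register `x` to the value of `e` -/
  | iset (x : ℕ) (e : IExp)
  /-- set real register `x` to the value of `e` -/
  | rset (x : ℕ) (e : RExp)
  /-- write the value of `e` to cell `addr` of integer array `a` -/
  | istore (a : ℕ) (addr e : IExp)
  /-- write the value of `e` to cell `addr` of real array `a` -/
  | rstore (a : ℕ) (addr : IExp) (e : RExp)
  | seq (p p' : Program)
  /-- `if b then p else p'` -/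
  | branch (b : Test) (p p' : Program)
  /-- `while b do p` -/
  | loop (b : Test) (p : Program)

/-- `Exec p s s' t`: started in state `s`, the program `p` halts in state `s'` after exactly `t`
steps. -/
inductive Exec : Program → State → State → ℕ → Prop
  | skip (s : State) : Exec .skip s s 1
  | iset (s : State) (x : ℕ) (e : IExp) :
      Exec (.iset x e) s { s with ireg := Function.update s.ireg x (e.eval s) } (e.cost + 1)
  | rset (s : State) (x : ℕ) (e : RExp) :
      Exec (.rset x e) s { s with rreg := Function.update s.rreg x (e.eval s) } (e.cost + 1)
  | istore (s : State) (a : ℕ) (addr e : IExp) :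
      Exec (.istore a addr e) s
        { s with iarr := Function.update s.iarr a
                  (Function.update (s.iarr a) (addr.eval s) (e.eval s)) }
        (addr.cost + e.cost + 1)
  | rstore (s : State) (a : ℕ) (addr : IExp) (e : RExp) :
      Exec (.rstore a addr e) s
        { s with rarr := Function.update s.rarr a
                  (Function.update (s.rarr a) (addr.eval s) (e.eval s)) }
        (addr.cost + e.cost + 1)
  | seq {p p' : Program} {s s' s'' : State} {t t' : ℕ} :
      Exec p s s' t → Exec p' s' s'' t' → Exec (.seq p p') s s'' (t + t')
  | branch_true {b : Test} {p p' : Program} {s s' : State} {t : ℕ} :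
      b.Holds s → Exec p s s' t → Exec (.branch b p p') s s' (b.cost + 1 + t)
  | branch_false {b : Test} {p p' : Program} {s s' : State} {t : ℕ} :
      ¬ b.Holds s → Exec p' s s' t → Exec (.branch b p p') s s' (b.cost + 1 + t)
  | loop_done {b : Test} {p : Program} {s : State} :
      ¬ b.Holds s → Exec (.loop b p) s s (b.cost + 1)
  | loop_step {b : Test} {p : Program} {s s' s'' : State} {t t' : ℕ} :
      b.Holds s → Exec p s s' t → Exec (.loop b p) s' s'' t' →
      Exec (.loop b p) s s'' (b.cost + 1 + t + t')

/-- The initial state on input `(q, r, ε)`: integer register `0` holds the number of vertices,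
real registers `0` and `1` hold `r` and `ε`, real arrays `0` and `1` hold the first and second
coordinates of the vertices; everything else is zero. -/
noncomputable def inputState {n : ℕ} (q : Fin n → Plane) (r ε : ℝ) : State where
  ireg x := if x = 0 then n else 0
  rreg x := if x = 0 then r else if x = 1 then ε else 0
  iarr _ _ := 0
  rarr a k :=
    if h : k < n then
      if a = 0 then q ⟨k, h⟩ 0 else if a = 1 then q ⟨k, h⟩ 1 else 0
    else 0

/-- In state `s` the answer (integer register `0`) is `1` for YES if `A` holds, and `0` for NO
otherwise. -/
def AnswerIs (s : State) (A : Prop) : Prop :=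
  (A → s.ireg 0 = 1) ∧ (¬ A → s.ireg 0 = 0)

/-- State `s` holds the set `K` as an explicit convex polygon: integer register `1` holds the
number of vertices, and real arrays `2` and `3` hold the first and second coordinates of the
vertices in counterclockwise order.  (The empty set, a point and a segment are included, with
`0`, `1` and `2` vertices.) -/
def HoldsPolygon (s : State) (K : Set Plane) : Prop :=
  ∃ p : Fin (s.ireg 1) → Plane, IsCCWConvex p ∧ polygon p = K ∧
    ∀ i : Fin (s.ireg 1), s.rarr 2 i = p i 0 ∧ s.rarr 3 i = p i 1

end OffsetDecon

open scoped Pointwise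

namespace OffsetDecon

/-! Part (1) is convexity. Offsets and insets of convex sets are convex, so `offset Π (r + ε)` is
convex and contains `Q` as soon as it contains the vertices. A vertex lies in this offset exactly
when the disk of radius `r + ε` around it meets `Π` (`convexDecide_iff_decide`).

For part (2), if `r ≤ ε` every vertex lies in `Π` and the answer is YES. Otherwise put `δ = r - ε >
0`. Although the offset of `Q` has rounded corners, `Π` is the intersection of the half-planes
bounded by the edge lines of `Q` moved inwards by `δ` (`core_eq_cutRegion`). The program cuts `Q`
along these lines in cyclic order and keeps the current vertices in a double-ended queue. The
invariant `CutInv` says that the first vertex in the queue is one that is extreme for the next line.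
Hence a cut removes nothing, or a cyclic run of vertices containing the first one, which can be
popped from the two ends. The invariant survives because no edge direction lies strictly between
those of consecutive edges (`ConvexCycle.crs_succ_nonneg`). A cut adds at most two vertices and a
popped vertex never returns, so all cuts together take linear time.

For the test at the vertex `q` between edges `i` and `i + 1`, the point of `Π` nearest to `q`
minimises the distance to the lines of both edges (`nearest_minimises`). Such a common minimiser is
unique, the edges being independent, so if `p` is a vertex of `Π` with this property, the disk
around `q` meets `Π` exactly when it contains `p` (`meets_iff`). From one edge to the next, a
pointer to such a `p` moves by at most one vertex (`CutInv.advance`, `CutInv.stay`), so all tests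
together are linear as well. -/

/-! ### The cross product of the plane -/

/-- The cross product of two vectors of the plane. -/
def crs (u v : Plane) : ℝ := u 0 * v 1 - u 1 * v 0

theorem plane_ext {u v : Plane} (h0 : u 0 = v 0) (h1 : u 1 = v 1) : u = v := by
  ext i; fin_cases i <;> assumption

theorem orient_eq_crs (a b c : Plane) : orient a b c = crs (b - a) (c - a) := by
  simp only [orient, crs, PiLp.sub_apply]

theorem crs_add_right (u v w : Plane) : crs u (v + w) = crs u v + crs u w := by
  simp only [crs, PiLp.add_apply]; ring

theorem crs_sub_right (u v w : Plane) : crs u (v - w) = crs u v - crs u w := by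
  simp only [crs, PiLp.sub_apply]; ring

theorem crs_smul_left (c : ℝ) (u v : Plane) : crs (c • u) v = c * crs u v := by
  simp only [crs, PiLp.smul_apply, smul_eq_mul]; ring

theorem crs_smul_right (c : ℝ) (u v : Plane) : crs u (c • v) = c * crs u v := by
  simp only [crs, PiLp.smul_apply, smul_eq_mul]; ring

theorem crs_self (u : Plane) : crs u u = 0 := by simp only [crs]; ring

theorem crs_neg_right (u v : Plane) : crs u (-v) = -crs u v := by
  simp only [crs, PiLp.neg_apply]; ring

theorem crs_zero_right (u : Plane) : crs u 0 = 0 := by simp [crs]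

theorem crs_anticomm (u v : Plane) : crs u v = -crs v u := by simp only [crs]; ring

theorem orient_rotate (a b c : Plane) : orient a b c = orient b c a := by
  simp only [orient]; ring

theorem orient_self_left (a b : Plane) : orient a a b = 0 := by simp only [orient]; ring

theorem orient_self_right (a b : Plane) : orient a b b = 0 := by simp only [orient]; ring

theorem orient_self_outer (a b : Plane) : orient a b a = 0 := by simp only [orient]; ring

/-- The Grassmann–Plücker relation. -/
theorem crs_mul_crs (a b c d : Plane) :
    crs a b * crs c d = crs a c * crs b d - crs a d * crs b c := by
  simp only [crs]; ring

theorem exists_smul_of_crs_eq_zero {u v : Plane} (hu : u ≠ 0) (h : crs u v = 0) :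
    ∃ c : ℝ, v = c • u := by
  by_cases h0 : u 0 = 0
  · have h1 : u 1 ≠ 0 := fun h1 => hu (plane_ext (by simpa using h0) (by simpa using h1))
    refine ⟨v 1 / u 1, plane_ext ?_ ?_⟩
    · simp only [crs, h0, zero_mul, zero_sub, neg_eq_zero, mul_eq_zero, h1, false_or] at h
      simp [h, h0]
    · simp [h1]
  · refine ⟨v 0 / u 0, plane_ext ?_ ?_⟩
    · simp [h0]
    · simp only [crs] at h
      simp only [PiLp.smul_apply, smul_eq_mul]
      field_simp
      linarith

theorem eq_zero_of_crs_eq_zero {u v w : Plane} (huv : crs u v ≠ 0) (hu : crs u w = 0)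
    (hv : crs v w = 0) : w = 0 := by
  simp only [crs] at *
  refine plane_ext ?_ ?_
  · have : (u 0 * v 1 - u 1 * v 0) * w 0 = 0 := by linear_combination v 0 * hu - u 0 * hv
    simpa [huv] using this
  · have : (u 0 * v 1 - u 1 * v 0) * w 1 = 0 := by linear_combination v 1 * hu - u 1 * hv
    simpa [huv] using this

theorem norm_sq_plane (u : Plane) : ‖u‖ ^ 2 = u 0 ^ 2 + u 1 ^ 2 := by
  rw [EuclideanSpace.norm_sq_eq]; simp [Fin.sum_univ_two]

theorem norm_plane (u : Plane) : ‖u‖ = Real.sqrt (u 0 * u 0 + u 1 * u 1) := by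
  rw [EuclideanSpace.norm_eq]; simp [Fin.sum_univ_two, sq]

theorem abs_crs_le (u v : Plane) : |crs u v| ≤ ‖u‖ * ‖v‖ := by
  apply abs_le_of_sq_le_sq _ (by positivity)
  rw [mul_pow, norm_sq_plane, norm_sq_plane, crs]
  nlinarith [sq_nonneg (u 0 * v 0 + u 1 * v 1)]

theorem convex_left_halfplane (e w : Plane) (c : ℝ) : Convex ℝ {x : Plane | c ≤ crs e (x - w)} := by
  intro x hx y hy a b ha hb hab
  simp only [Set.mem_ofPred_eq] at *
  have : a • x + b • y - w = a • (x - w) + b • (y - w) := by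
    have : w = (a + b) • w := by rw [hab, one_smul]
    nth_rewrite 1 [this]
    module
  rw [this, crs_add_right, crs_smul_right, crs_smul_right]
  have hc : c = a * c + b * c := by rw [← add_mul, hab, one_mul]
  rw [hc]
  gcongr

theorem isClosed_left_halfplane (e w : Plane) (c : ℝ) :
    IsClosed {x : Plane | c ≤ crs e (x - w)} := by
  refine isClosed_le continuous_const ?_
  simp only [crs, PiLp.sub_apply]
  fun_prop

/-! ### Strictly convex sequences of points -/

/-- The points `V h, …, V (t - 1)` are the vertices, in counterclockwise order, of a convex
polygon, which may degenerate to a segment, a point or the empty set. -/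
structure StrictConvexOn (V : ℕ → Plane) (h t : ℕ) : Prop where
  pos : ∀ i j k, h ≤ i → i < j → j < k → k < t → 0 < orient (V i) (V j) (V k)
  ne : t = h + 2 → V h ≠ V (h + 1)

/-- The cyclic successor of `k` in the interval `[h, t)`. -/
def nxt (h t k : ℕ) : ℕ := if k + 1 < t then k + 1 else h

theorem nxt_of_lt {h t k : ℕ} (hk : k + 1 < t) : nxt h t k = k + 1 := if_pos hk

theorem nxt_last {h t k : ℕ} (hk : t ≤ k + 1) : nxt h t k = h := if_neg (by omega)

theorem nxt_mem {h t k : ℕ} (h1 : h ≤ k) (h2 : k < t) : h ≤ nxt h t k ∧ nxt h t k < t := by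
  unfold nxt; split_ifs <;> omega

namespace StrictConvexOn

variable {V : ℕ → Plane} {h t : ℕ}

/-- `orient` is invariant under cyclic rotation, and each triple here is a rotation of an increasing
one. -/
theorem edge_pos (hV : StrictConvexOn V h t) {k j : ℕ} (hk : h ≤ k) (hkt : k < t) (hj : h ≤ j)
    (hjt : j < t) (hjk : j ≠ k) (hjn : j ≠ nxt h t k) :
    0 < orient (V k) (V (nxt h t k)) (V j) := by
  by_cases hl : k + 1 < t
  · rw [nxt_of_lt hl] at *
    rcases lt_or_gt_of_ne hjk with hlt | hlt
    · rw [← orient_rotate]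
      exact hV.pos j k (k + 1) hj hlt (by omega) hl
    · exact hV.pos k (k + 1) j hk (by omega) (by omega) hjt
  · rw [nxt_last (by omega)] at *
    rw [orient_rotate]
    exact hV.pos h j k le_rfl (by omega) (by omega) hkt

theorem edge_nonneg (hV : StrictConvexOn V h t) {k j : ℕ} (hk : h ≤ k) (hkt : k < t) (hj : h ≤ j)
    (hjt : j < t) : 0 ≤ orient (V k) (V (nxt h t k)) (V j) := by
  by_cases h1 : j = k
  · rw [h1, orient_self_outer]
  by_cases h2 : j = nxt h t k
  · rw [h2, orient_self_right]
  exact (hV.edge_pos hk hkt hj hjt h1 h2).le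

/-- If there is a third point, equal points would give a degenerate triple, contrary to `pos`. With
only two points `pos` is vacuous, which is why the structure has the field `ne`. -/
theorem ne_of_lt (hV : StrictConvexOn V h t) {i j : ℕ} (hi : h ≤ i) (hij : i < j) (hj : j < t) :
    V i ≠ V j := by
  intro he
  by_cases h2 : t = h + 2
  · have : i = h := by omega
    have : j = h + 1 := by omega
    subst i j
    exact hV.ne h2 he
  have : ∃ k, h ≤ k ∧ k < t ∧ k ≠ i ∧ k ≠ j := by
    by_cases h0 : i = h
    · by_cases h1 : j = h + 1
      · exact ⟨h + 2, by omega⟩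
      · exact ⟨h + 1, by omega⟩
    · exact ⟨h, by omega⟩
  obtain ⟨k, hk, hkt, hki, hkj⟩ := this
  rcases lt_or_gt_of_ne hki with h1 | h1
  · have := hV.pos k i j hk h1 hij hj
    rw [he, orient_self_right] at this
    exact lt_irrefl _ this
  rcases lt_or_gt_of_ne hkj with h3 | h3
  · have := hV.pos i k j hi h1 h3 hj
    rw [he, orient_self_outer] at this
    exact lt_irrefl _ this
  · have := hV.pos i j k hi hij h3 hkt
    rw [he, orient_self_left] at this
    exact lt_irrefl _ this

theorem hull_left (hV : StrictConvexOn V h t) {k : ℕ} (hk : h ≤ k) (hkt : k < t) {x : Plane}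
    (hx : x ∈ convexHull ℝ (V '' Set.Ico h t)) : 0 ≤ crs (V (nxt h t k) - V k) (x - V k) := by
  refine convexHull_min ?_ (convex_left_halfplane (V (nxt h t k) - V k) (V k) 0) hx
  rintro _ ⟨j, hj, rfl⟩
  have := hV.edge_nonneg hk hkt hj.1 hj.2
  rwa [orient_eq_crs] at this

/-- A triangle contains the points to the left of its three sides. -/
theorem mem_convexHull_triangle {a b c x : Plane} (h0 : 0 < orient a b c)
    (h1 : 0 ≤ orient a b x) (h2 : 0 ≤ orient b c x) (h3 : 0 ≤ orient c a x) :
    x ∈ convexHull ℝ ({a, b, c} : Set Plane) := by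
  -- The barycentric coordinates of `x` are ratios of signed areas.
  have key : x = (orient b c x / orient a b c) • a + (orient c a x / orient a b c) • b
      + (orient a b x / orient a b c) • c := by
    have hne := h0.ne'
    apply plane_ext <;>
    · simp only [PiLp.add_apply, PiLp.smul_apply, smul_eq_mul]
      field_simp
      simp only [orient]; ring
  have hs : orient b c x / orient a b c + orient c a x / orient a b c
      + orient a b x / orient a b c = 1 := by
    rw [← add_div, ← add_div, div_eq_one_iff_eq h0.ne']
    simp only [orient]; ring
  have := (convex_convexHull ℝ ({a, b, c} : Set Plane)).sum_mem (t := Finset.univ)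
    (w := ![orient b c x / orient a b c, orient c a x / orient a b c, orient a b x / orient a b c])
    (z := ![a, b, c]) ?_ ?_ ?_
  · rw [key]
    simpa [Fin.sum_univ_three] using this
  · intro i _
    fin_cases i <;> simp <;> positivity
  · simpa [Fin.sum_univ_three] using hs
  · intro i _
    fin_cases i <;> exact subset_convexHull ℝ _ (by simp)

/-- Fan triangulation from `V h`: as `k` runs from `h + 1` to `t - 1`, the sign of `orient (V h) (V
k) x` starts nonnegative and ends nonpositive. Where it changes, `x` lies in the triangle `V h`, `V
k`, `V (k + 1)`. -/
theorem mem_hull_of_left (hV : StrictConvexOn V h t) (ht : h + 3 ≤ t) {x : Plane}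
    (hx : ∀ k, h ≤ k → k < t → 0 ≤ crs (V (nxt h t k) - V k) (x - V k)) :
    x ∈ convexHull ℝ (V '' Set.Ico h t) := by
  have hx' : ∀ k, h ≤ k → k < t → 0 ≤ orient (V k) (V (nxt h t k)) x := fun k h1 h2 => by
    rw [orient_eq_crs]; exact hx k h1 h2
  have hex : ∃ k, h + 1 ≤ k ∧ k + 1 < t ∧ 0 ≤ orient (V h) (V k) x ∧
      orient (V h) (V (k + 1)) x ≤ 0 := by
    by_contra! hno
    have : ∀ k, h + 1 ≤ k → k < t → 0 ≤ orient (V h) (V k) x ∧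
        (h + 2 ≤ k → 0 < orient (V h) (V k) x) := by
      intro k hk
      induction k, hk using Nat.le_induction with
      | base =>
        intro h1
        have := hx' h le_rfl (by omega)
        rw [nxt_of_lt (by omega)] at this
        exact ⟨this, fun h => by omega⟩
      | succ k hk ih =>
        intro h1
        have := hno k hk h1 (ih (by omega)).1
        exact ⟨this.le, fun _ => this⟩
    have h1 := (this (t - 1) (by omega) (by omega)).2 (by omega)
    have h2 := hx' (t - 1) (by omega) (by omega)
    rw [nxt_last (by omega)] at h2
    have : orient (V (t - 1)) (V h) x = -orient (V h) (V (t - 1)) x := by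
      simp only [orient]; ring
    linarith
  obtain ⟨k, hk, hkt, h1, h2⟩ := hex
  have h3 := hx' k (by omega) (by omega)
  rw [nxt_of_lt hkt] at h3
  have h4 : 0 ≤ orient (V (k + 1)) (V h) x := by
    have : orient (V (k + 1)) (V h) x = -orient (V h) (V (k + 1)) x := by
      simp only [orient]; ring
    linarith
  refine convexHull_mono ?_ (mem_convexHull_triangle
    (hV.pos h k (k + 1) le_rfl (by omega) (by omega) hkt) h1 h3 h4)
  rintro y (rfl | rfl | rfl) <;> exact Set.mem_image_of_mem V ⟨by omega, by omega⟩

/-- The vertex list of a strictly convex sequence. -/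
theorem isCCWConvex (hV : StrictConvexOn V h t) {m : ℕ} (hm : h + m = t) :
    IsCCWConvex (fun i : Fin m => V (h + i)) := by
  refine ⟨fun i j hij => ?_, fun i j hji hjn => ?_⟩
  · by_contra hne
    rcases lt_or_gt_of_ne hne with h1 | h1
    · exact hV.ne_of_lt (i := h + i) (j := h + j) (by omega)
        (by have : (i : ℕ) < j := h1; omega) (by omega) hij
    · exact hV.ne_of_lt (i := h + j) (j := h + i) (by omega)
        (by have : (j : ℕ) < i := h1; omega) (by omega) hij.symm
  · obtain ⟨m, rfl⟩ : ∃ m', m = m' + 1 := ⟨m - 1, by have := i.2; omega⟩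
    have hn : h + (finRotate (m + 1) i : ℕ) = nxt h t (h + i) := by
      by_cases hl : i = Fin.last m
      · rw [hl, finRotate_last, nxt_last (by simp; omega)]; simp
      · have hlt : (i : ℕ) < m := Fin.val_lt_last hl
        rw [coe_finRotate_of_ne_last hl, nxt_of_lt (by omega)]; rfl
    show 0 < orient (V (h + i)) (V (h + (finRotate (m + 1) i : ℕ))) (V (h + j))
    rw [hn]
    refine hV.edge_pos (by omega) (by omega) (by omega) (by omega) (fun he => hji ?_)
      (fun he => hjn ?_)
    · exact Fin.ext (by omega)
    · exact Fin.ext (by omega)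

theorem polygon_eq {m : ℕ} (hm : h + m = t) :
    polygon (fun i : Fin m => V (h + i)) = convexHull ℝ (V '' Set.Ico h t) := by
  unfold polygon
  congr 1
  ext x
  constructor
  · rintro ⟨i, rfl⟩
    exact ⟨h + i, ⟨by omega, by omega⟩, rfl⟩
  · rintro ⟨k, ⟨h1, h2⟩, rfl⟩
    exact ⟨⟨k - h, by omega⟩, by simp only; congr 1; omega⟩

end StrictConvexOn

/-! ### The periodic vertex sequence of a convex polygon -/

/-- The periodic extension of a finite sequence of points. -/
def wrap {n : ℕ} (hn : 0 < n) (q : Fin n → Plane) (k : ℕ) : Plane := q ⟨k % n, Nat.mod_lt k hn⟩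

/-- The edge vector from `W k` to `W (k + 1)`. -/
def edge (W : ℕ → Plane) (k : ℕ) : Plane := W (k + 1) - W k

/-- `W` is the periodic extension of the counterclockwise vertex list of a convex polygon with
`n ≥ 3` vertices. -/
structure ConvexCycle (n : ℕ) (W : ℕ → Plane) : Prop where
  three_le : 3 ≤ n
  periodic : ∀ k, W (k + n) = W k
  pos : ∀ i j : ℕ, j % n ≠ i % n → j % n ≠ (i + 1) % n → 0 < orient (W i) (W (i + 1)) (W j)

theorem convexCycle_wrap {n : ℕ} (hn : 3 ≤ n) {q : Fin n → Plane} (hq : IsCCWConvex q)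
    (h0 : 0 < n) : ConvexCycle n (wrap h0 q) where
  three_le := hn
  periodic k := by simp [wrap]
  pos i j h1 h2 := by
    obtain ⟨m, rfl⟩ : ∃ m', n = m' + 1 := ⟨n - 1, by omega⟩
    have hr : ((finRotate (m + 1) ⟨i % (m + 1), Nat.mod_lt i h0⟩ : Fin (m + 1)) : ℕ)
        = (i + 1) % (m + 1) := by
      rw [finRotate_apply, Fin.val_add]
      simp
    have := hq.2 ⟨i % (m + 1), Nat.mod_lt i h0⟩ ⟨j % (m + 1), Nat.mod_lt j h0⟩
      (fun h => h1 (Fin.ext_iff.1 h)) (fun h => h2 ((Fin.ext_iff.1 h).trans hr))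
    rw [show finRotate (m + 1) ⟨i % (m + 1), Nat.mod_lt i h0⟩ =
      ⟨(i + 1) % (m + 1), Nat.mod_lt _ h0⟩ from Fin.ext hr] at this
    exact this

namespace ConvexCycle

variable {n : ℕ} {W : ℕ → Plane}

theorem edge_left (hW : ConvexCycle n W) (i j : ℕ) : 0 ≤ crs (edge W i) (W j - W i) := by
  rw [edge, ← orient_eq_crs]
  have hmod : ∀ a, W (a % n) = W a := fun a => by
    have hper : Function.Periodic W n := hW.periodic
    exact hper.map_mod_nat a
  by_cases h1 : j % n = i % n
  · rw [← hmod j, h1, hmod i, orient_self_outer]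
  by_cases h2 : j % n = (i + 1) % n
  · rw [← hmod j, h2, hmod (i + 1), orient_self_right]
  exact (hW.pos i j h1 h2).le

theorem edge_periodic (hW : ConvexCycle n W) (k : ℕ) : edge W (k + n) = edge W k := by
  unfold edge
  rw [show k + n + 1 = k + 1 + n by ring, hW.periodic, hW.periodic]

/-- Since `n ≥ 3`, the vertex `W (i + 2)` is neither end of edge `i`, so it lies strictly to its
left. -/
theorem crs_edge_succ (hW : ConvexCycle n W) (i : ℕ) : 0 < crs (edge W i) (edge W (i + 1)) := by
  have hn := hW.three_le
  have h1 : (i + 2) % n ≠ i % n := fun h => by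
    have : n ∣ 2 := by
      have := (Nat.modEq_iff_dvd' (show i ≤ i + 2 by omega)).1 h.symm
      simpa using this
    exact absurd (Nat.le_of_dvd (by omega) this) (by omega)
  have h2 : (i + 2) % n ≠ (i + 1) % n := fun h => by
    have : n ∣ 1 := by
      have := (Nat.modEq_iff_dvd' (show i + 1 ≤ i + 2 by omega)).1 h.symm
      rwa [show i + 2 - (i + 1) = 1 by omega] at this
    exact absurd (Nat.le_of_dvd (by omega) this) (by omega)
  have := hW.pos i (i + 2) h1 h2
  simp only [orient] at this
  simp only [crs, edge, PiLp.sub_apply]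
  linarith

theorem edge_ne_zero (hW : ConvexCycle n W) (i : ℕ) : edge W i ≠ 0 := by
  intro h
  have := hW.crs_edge_succ i
  rw [h] at this
  simp [crs] at this

/-- A vertex between a descending and an ascending edge is the strict minimum. -/
theorem local_min (hW : ConvexCycle n W) {i k : ℕ} {d : Plane} (h1 : crs d (edge W i) < 0)
    (h2 : 0 < crs d (edge W (i + 1))) (hk : k % n ≠ (i + 1) % n) :
    0 < crs d (W k - W (i + 1)) := by
  have hn := hW.three_le
  -- This expands `W k - W (i + 1)` in the two edges at `W (i + 1)`. The coefficients are
  -- nonnegative because `W k` lies to the left of both.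
  have key : crs (edge W i) (edge W (i + 1)) * crs d (W k - W (i + 1)) =
      crs (edge W (i + 1)) (W k - W (i + 1)) * (-crs d (edge W i)) +
      crs (edge W i) (W k - W i) * crs d (edge W (i + 1)) := by
    simp only [crs, edge, PiLp.sub_apply]; ring
  have ha := hW.edge_left (i + 1) k
  have hb := hW.edge_left i k
  have hc := hW.crs_edge_succ i
  have : 0 < crs (edge W i) (edge W (i + 1)) * crs d (W k - W (i + 1)) := by
    rw [key]
    -- One summand is strictly positive: `W k` is strictly left of edge `i` unless it is `W i`, and
    -- then it is strictly left of edge `i + 1`.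
    by_cases hki : k % n = i % n
    · have h3 : k % n ≠ (i + 1 + 1) % n := fun h => by
        have h4 : i % n = (i + 2) % n := hki.symm.trans h
        have : n ∣ 2 := by
          have := (Nat.modEq_iff_dvd' (show i ≤ i + 2 by omega)).1 h4
          simpa using this
        exact absurd (Nat.le_of_dvd (by omega) this) (by omega)
      have := hW.pos (i + 1) k hk h3
      rw [orient_eq_crs] at this
      have := mul_pos this (neg_pos.2 h1)
      have := mul_nonneg hb h2.le
      unfold edge at *
      linarith
    · have := hW.pos i k hki hk
      rw [orient_eq_crs] at this
      have := mul_pos this h2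
      have := mul_nonneg ha (neg_pos.2 h1).le
      unfold edge at *
      linarith
  exact pos_of_mul_pos_right this hc.le

/-- No edge direction lies strictly between those of two consecutive edges. -/
theorem crs_succ_nonneg_of_pos (hW : ConvexCycle n W) {i j : ℕ}
    (h : 0 < crs (edge W i) (edge W j)) : 0 ≤ crs (edge W (i + 1)) (edge W j) := by
  have hn := hW.three_le
  by_contra! hlt
  rw [crs_anticomm] at h hlt
  -- In direction `edge W j` the vertex `W (i + 1)` would be the only minimum. But both ends of edge
  -- `j` are minima, so both would have to be `W (i + 1)`.
  have hm := fun k => hW.local_min (i := i) (k := k) (d := edge W j) (by linarith) (by linarith)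
  have hj := hW.edge_left j (i + 1)
  have hself : crs (edge W j) (W (j + 1) - W j) = 0 := crs_self _
  have e1 : j % n = (i + 1) % n := by
    by_contra hne
    have := hm j hne
    rw [crs_sub_right] at this hj
    linarith
  have e2 : (j + 1) % n = (i + 1) % n := by
    by_contra hne
    have := hm (j + 1) hne
    rw [crs_sub_right] at this hj hself
    linarith
  have : n ∣ 1 := by
    have := (Nat.modEq_iff_dvd' (show j ≤ j + 1 by omega)).1 (e1.trans e2.symm)
    rwa [show j + 1 - j = 1 by omega] at this
  exact absurd (Nat.le_of_dvd (by omega) this) (by omega)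

/-- Distinct edges have distinct directions. -/
theorem eq_of_edge_eq_smul (hW : ConvexCycle n W) {i j : ℕ} (hi : i < n) (hj : j < n) {c : ℝ}
    (hc : 0 < c) (h : edge W j = c • edge W i) : j = i := by
  have hn := hW.three_le
  have h1 := hW.edge_left i j
  have h2 := hW.edge_left j i
  rw [h, crs_smul_left] at h2
  have h2' : 0 ≤ crs (edge W i) (W i - W j) := nonneg_of_mul_nonneg_right h2 hc
  rw [crs_sub_right] at h1 h2'
  -- Each of the two parallel edges starts on the left of the other, so both lie on one line, and
  -- this line contains no vertices except `W i` and `W (i + 1)`.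
  have h3 : crs (edge W i) (W j - W i) = 0 := by rw [crs_sub_right]; linarith
  have h4 : crs (edge W i) (W (j + 1) - W i) = 0 := by
    have : W (j + 1) - W i = c • edge W i + (W j - W i) := by rw [← h, edge]; abel
    rw [this, crs_add_right, crs_smul_right, crs_self, h3]; ring
  have hor : ∀ k, crs (edge W i) (W k - W i) = 0 → k % n = i % n ∨ k % n = (i + 1) % n := by
    intro k hk
    by_contra! hne
    have := hW.pos i k hne.1 hne.2
    rw [orient_eq_crs] at this
    unfold edge at hk
    linarith
  rcases hor j h3 with h5 | h5
  · rwa [Nat.mod_eq_of_lt hi, Nat.mod_eq_of_lt hj] at h5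
  exfalso
  have h7 : (j + 1) % n = (i + 2) % n := (Nat.ModEq.add_right 1 h5 :)
  rcases hor (j + 1) h4 with h6 | h6
  · have : n ∣ 2 := by
      have := (Nat.modEq_iff_dvd' (show i ≤ i + 2 by omega)).1 (h6.symm.trans h7)
      simpa using this
    exact absurd (Nat.le_of_dvd (by omega) this) (by omega)
  · have : n ∣ 1 := by
      have := (Nat.modEq_iff_dvd' (show i + 1 ≤ i + 2 by omega)).1 (h6.symm.trans h7)
      rwa [show i + 2 - (i + 1) = 1 by omega] at this
    exact absurd (Nat.le_of_dvd (by omega) this) (by omega)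

/-- The weak form adds the parallel case: another edge parallel to edge `i` runs in the opposite
direction, and edge `i + 1` turns left from edge `i`. This rotation step maintains both the head of
the queue and the pointer. -/
theorem crs_succ_nonneg (hW : ConvexCycle n W) {i j : ℕ} (hi : i < n) (hj : j < n) (hji : j ≠ i)
    (h : 0 ≤ crs (edge W i) (edge W j)) : 0 ≤ crs (edge W (i + 1)) (edge W j) := by
  rcases h.lt_or_eq with h | h
  · exact hW.crs_succ_nonneg_of_pos h
  obtain ⟨c, hc⟩ := exists_smul_of_crs_eq_zero (hW.edge_ne_zero i) h.symm
  have hc0 : c ≤ 0 := by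
    by_contra! hpos
    exact hji (hW.eq_of_edge_eq_smul hi hj hpos hc)
  rw [hc, crs_smul_right, crs_anticomm]
  have := hW.crs_edge_succ i
  nlinarith

/-- Passes from edges to arbitrary triples by induction on `k`: seen from `W i`, the later vertices
appear in counterclockwise order within a half-plane. -/
theorem strictConvexOn (hW : ConvexCycle n W) : StrictConvexOn W 0 n where
  pos i j k _ hij hjk hk := by
    induction k, hjk using Nat.le_induction with
    | base =>
      rw [orient_rotate]
      refine hW.pos j i ?_ ?_ <;>
      · rw [Nat.mod_eq_of_lt (by omega), Nat.mod_eq_of_lt (by omega)]; omega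
    | succ k hjk ih =>
      have ih := ih (by omega)
      have h1 : 0 < orient (W k) (W (k + 1)) (W i) := by
        refine hW.pos k i ?_ ?_ <;>
        · rw [Nat.mod_eq_of_lt (by omega), Nat.mod_eq_of_lt (by omega)]; omega
      have h2 : ∀ l, i + 1 < l → l < n → 0 < orient (W i) (W (i + 1)) (W l) := by
        intro l h1 h2
        refine hW.pos i l ?_ ?_ <;>
        · rw [Nat.mod_eq_of_lt (by omega), Nat.mod_eq_of_lt (by omega)]; omega
      have hj : 0 ≤ orient (W i) (W (i + 1)) (W j) := by
        by_cases h : j = i + 1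
        · rw [h, orient_self_right]
        · exact (h2 j (by omega) (by omega)).le
      have hk1 := h2 k (by omega) (by omega)
      have hk2 := h2 (k + 1) (by omega) hk
      -- The Grassmann–Plücker relation for `W (i + 1)`, `W j`, `W k`, `W (k + 1)` as seen from `W
      -- i`.
      have key : orient (W i) (W (i + 1)) (W k) * orient (W i) (W j) (W (k + 1)) =
          orient (W i) (W (i + 1)) (W j) * orient (W k) (W (k + 1)) (W i) +
          orient (W i) (W (i + 1)) (W (k + 1)) * orient (W i) (W j) (W k) := by
        simp only [orient]; ring
      have : 0 < orient (W i) (W (i + 1)) (W k) * orient (W i) (W j) (W (k + 1)) := by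
        rw [key]
        have := mul_nonneg hj h1.le
        have := mul_pos hk2 ih
        linarith
      exact pos_of_mul_pos_right this hk1.le
  ne h := by have := hW.three_le; omega

theorem nxt_eq (hW : ConvexCycle n W) {k : ℕ} (hk : k < n) : W (nxt 0 n k) = W (k + 1) := by
  unfold nxt
  split_ifs with h
  · rfl
  · have : k + 1 = 0 + n := by omega
    rw [this, hW.periodic]

/-- A convex polygon is the intersection of the half-planes to the left of its edges. -/
theorem mem_hull_iff (hW : ConvexCycle n W) {x : Plane} :
    x ∈ convexHull ℝ (W '' Set.Ico 0 n) ↔ ∀ k < n, 0 ≤ crs (edge W k) (x - W k) := by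
  constructor
  · intro hx k hk
    have := hW.strictConvexOn.hull_left (Nat.zero_le k) hk hx
    rwa [hW.nxt_eq hk] at this
  · intro hx
    refine hW.strictConvexOn.mem_hull_of_left (by have := hW.three_le; omega) fun k _ hk => ?_
    rw [hW.nxt_eq hk]
    exact hx k hk

end ConvexCycle

theorem polygon_eq_wrap {n : ℕ} (hn : 0 < n) (q : Fin n → Plane) :
    polygon q = convexHull ℝ (wrap hn q '' Set.Ico 0 n) := by
  rw [← StrictConvexOn.polygon_eq (m := n) (by omega)]
  congr 1
  ext1 i
  simp [wrap, Nat.mod_eq_of_lt i.2]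

/-! ### Cutting a convex polygon with a half-plane -/

/-- The signed position of `x` relative to the directed line `{y | crs e y = c}`. -/
def side (e : Plane) (c : ℝ) (x : Plane) : ℝ := crs e x - c

theorem side_combo {e : Plane} {c a b : ℝ} (hab : a + b = 1) (x y : Plane) :
    side e c (a • x + b • y) = a * side e c x + b * side e c y := by
  simp only [side, crs_add_right, crs_smul_right]
  linear_combination c * hab

theorem side_sub (e : Plane) (c : ℝ) (x y : Plane) :
    side e c x - side e c y = crs e (x - y) := by
  simp only [side, crs_sub_right]; ring

/-- The point where the segment from `p` to `x` meets the line `{y | crs e y = c}`. -/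
noncomputable def crossing (e : Plane) (c : ℝ) (p x : Plane) : Plane :=
  p + (side e c p / (side e c p - side e c x)) • (x - p)

theorem crossing_spec {e : Plane} {c : ℝ} {p x : Plane} (hp : side e c p < 0)
    (hx : 0 < side e c x) : side e c (crossing e c p x) = 0 ∧
      ∃ s : ℝ, 0 < s ∧ s < 1 ∧ crossing e c p x = (1 - s) • p + s • x := by
  have hne : side e c p - side e c x < 0 := by linarith
  set s := side e c p / (side e c p - side e c x) with hs
  have h1 : crossing e c p x = (1 - s) • p + s • x := by
    rw [crossing, ← hs]; module
  refine ⟨?_, s, div_pos_of_neg_of_neg hp hne, ?_, h1⟩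
  · have h2 : s * (side e c p - side e c x) = side e c p := div_mul_cancel₀ _ hne.ne
    rw [h1, side_combo (by ring)]
    linear_combination -h2
  · rw [hs, div_lt_one_of_neg hne]; linarith

theorem orient_combo_left {a b y z : Plane} (s : ℝ) :
    orient ((1 - s) • a + s • b) y z = (1 - s) * orient a y z + s * orient b y z := by
  simp only [orient, PiLp.add_apply, PiLp.smul_apply, smul_eq_mul]; ring

theorem orient_combo_right {a b y z : Plane} (s : ℝ) :
    orient y z ((1 - s) • a + s • b) = (1 - s) * orient y z a + s * orient y z b := by
  simp only [orient, PiLp.add_apply, PiLp.smul_apply, smul_eq_mul]; ring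

namespace StrictConvexOn

variable {V : ℕ → Plane} {h t : ℕ}

/-- If the vertex `V a` minimises `crs e` and the next vertex does not improve `crs e'`, where `e'`
is a left turn from `e`, then `V a` minimises `crs e'`. -/
theorem min_succ (hV : StrictConvexOn V h t) {a : ℕ} (ha : h ≤ a) (hat : a < t) {e e' : Plane}
    (he : 0 < crs e e') (hm : ∀ k, h ≤ k → k < t → 0 ≤ crs e (V k - V a))
    (hd : 0 ≤ crs e' (V (nxt h t a) - V a)) :
    ∀ k, h ≤ k → k < t → 0 ≤ crs e' (V k - V a) := by
  intro k hk hkt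
  by_cases h1 : k = a
  · rw [h1, sub_self, crs_zero_right]
  by_cases h2 : k = nxt h t a
  · rwa [h2]
  have hpos := hV.edge_pos ha hat hk hkt h1 h2
  rw [orient_eq_crs] at hpos
  have hd0 := hm _ (nxt_mem ha hat).1 (nxt_mem ha hat).2
  have hk0 := hm k hk hkt
  have key := crs_mul_crs e e' (V (nxt h t a) - V a) (V k - V a)
  -- By `key` this product is `crs e e'` times the positive orientation of the triple at `V a`, plus
  -- a nonnegative term.
  have h3 : 0 < crs e (V (nxt h t a) - V a) * crs e' (V k - V a) := by
    have := mul_pos he hpos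
    have := mul_nonneg hk0 hd
    linarith
  exact (pos_of_mul_pos_right h3 hd0).le

variable {e : Plane} {c : ℝ} {f l : ℕ}

/-- Between two vertices that are not cut off, no vertex is cut off. -/
theorem kept_nonneg (hV : StrictConvexOn V h t) (hh : side e c (V h) < 0)
    (hf : 0 ≤ side e c (V f)) (hl : 0 ≤ side e c (V l)) (hhf : h < f) (hlt : l < t) {k : ℕ}
    (hfk : f ≤ k) (hkl : k ≤ l) : 0 ≤ side e c (V k) := by
  rcases hfk.eq_or_lt with rfl | hfk
  · exact hf
  rcases hkl.eq_or_lt with rfl | hkl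
  · exact hl
  -- The affine function `side` evaluated on the affine dependence of four points in convex
  -- position, whose diagonals join `V h` to `V k` and `V f` to `V l`.
  have key : orient (V f) (V k) (V l) * side e c (V h) + orient (V h) (V f) (V l) * side e c (V k) =
      orient (V h) (V k) (V l) * side e c (V f) + orient (V h) (V f) (V k) * side e c (V l) := by
    simp only [orient, side, crs]; ring
  have h1 := hV.pos f k l hhf.le hfk hkl hlt
  have h2 := hV.pos h f l le_rfl hhf (by omega) hlt
  have h3 := hV.pos h k l le_rfl (by omega) hkl hlt
  have h4 := hV.pos h f k le_rfl hhf hfk (by omega)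
  by_contra! hneg
  have := mul_neg_of_pos_of_neg h1 hh
  have := mul_neg_of_pos_of_neg h2 hneg
  have := mul_nonneg h3.le hf
  have := mul_nonneg h4.le hl
  linarith

/-- The points of a convex polygon on a cutting line lie between the two points where the line
crosses the boundary. -/
theorem mem_segment_of_side_eq_zero (hV : StrictConvexOn V h t) (he : e ≠ 0) (hhf : h < f)
    (hft : f < t) (hhl : h ≤ l) (hlt : l < t)
    {F Z : Plane} {s u : ℝ} (hs : 0 < s) (hu : 0 < u)
    (hF : F = (1 - s) • V (f - 1) + s • V f) (hZ : Z = (1 - u) • V (nxt h t l) + u • V l)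
    (hF0 : side e c F = 0) (hZ0 : side e c Z = 0)
    (hf1 : side e c (V (f - 1)) < 0) (hl1 : side e c (V (nxt h t l)) < 0) {x : Plane}
    (hx : x ∈ convexHull ℝ (V '' Set.Ico h t)) (hx0 : side e c x = 0) :
    ∃ a b : ℝ, 0 ≤ a ∧ 0 ≤ b ∧ x = Z + a • e ∧ F = x + b • e := by
  have e1 := hV.hull_left (k := f - 1) (by omega) (by omega) hx
  rw [nxt_of_lt (by omega), show f - 1 + 1 = f by omega] at e1
  have e2 := hV.hull_left (k := l) hhl hlt hx
  have hxF : crs e (F - x) = 0 := by rw [← side_sub e c, hF0, hx0, sub_zero]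
  have hxZ : crs e (x - Z) = 0 := by rw [← side_sub e c, hZ0, hx0, sub_zero]
  obtain ⟨b, hb⟩ := exists_smul_of_crs_eq_zero he hxF
  obtain ⟨a, ha⟩ := exists_smul_of_crs_eq_zero he hxZ
  refine ⟨a, b, ?_, ?_, by rw [← ha]; abel, by rw [← hb]; abel⟩
  -- At `Z` the boundary leaves the half-plane along the edge from `V l`. Lying to the left of this
  -- edge forces `a ≥ 0`; the edge into `V f`, where the boundary enters, gives `b ≥ 0` in the same
  -- way.
  · have h2 : crs (V (nxt h t l) - V l) (x - V l) = a * crs (V (nxt h t l) - V l) e := by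
      have : x - V l = a • e + (1 - u) • (V (nxt h t l) - V l) := by rw [← ha, hZ]; module
      rw [this, crs_add_right, crs_smul_right, crs_smul_right, crs_self]; ring
    have h3 : 0 < crs (V (nxt h t l) - V l) e := by
      have h4 : side e c Z = (1 - u) * side e c (V (nxt h t l)) + u * side e c (V l) := by
        rw [hZ, side_combo (by ring)]
      rw [crs_anticomm, ← side_sub e c]
      nlinarith
    rw [h2] at e2
    exact nonneg_of_mul_nonneg_left e2 h3
  · have h2 : crs (V f - V (f - 1)) (x - V (f - 1)) = b * crs e (V f - V (f - 1)) := by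
      have : x - V (f - 1) = (-b) • e + s • (V f - V (f - 1)) := by
        rw [neg_smul, ← hb, hF]; module
      rw [this, crs_add_right, crs_smul_right, crs_smul_right, crs_self,
        crs_anticomm (V f - V (f - 1)) e]; ring
    have h3 : 0 < crs e (V f - V (f - 1)) := by
      have h4 : side e c F = (1 - s) * side e c (V (f - 1)) + s * side e c (V f) := by
        rw [hF, side_combo (by ring)]
      rw [← side_sub e c]
      nlinarith
    rw [h2] at e1
    exact nonneg_of_mul_nonneg_left e1 h3

/-- Cutting a convex hull: the part on the nonnegative side of the line is spanned by the kept
vertices and the two crossing points. -/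
theorem hull_inter_halfplane (hV : StrictConvexOn V h t) (he : e ≠ 0) (hhf : h < f)
    (hfl : f ≤ l) (hlt : l < t) {F Z : Plane} {s u : ℝ}
    (hs : 0 < s) (hs1 : s ≤ 1) (hu : 0 < u) (hu1 : u ≤ 1)
    (hF : F = (1 - s) • V (f - 1) + s • V f) (hZ : Z = (1 - u) • V (nxt h t l) + u • V l)
    (hF0 : side e c F = 0) (hZ0 : side e c Z = 0)
    (hf : 0 ≤ side e c (V f)) (hl : 0 ≤ side e c (V l))
    (hout : ∀ k, h ≤ k → k < t → (k < f ∨ l < k) → side e c (V k) < 0) {S : Set Plane}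
    (hSF : F ∈ S) (hSZ : Z ∈ S) (hSV : ∀ k, f ≤ k → k ≤ l → V k ∈ S)
    (hS : ∀ x ∈ S, x = F ∨ x = Z ∨ ∃ k, f ≤ k ∧ k ≤ l ∧ x = V k) :
    convexHull ℝ S = convexHull ℝ (V '' Set.Ico h t) ∩ {x | 0 ≤ side e c x} := by
  have hmem : ∀ k, h ≤ k → k < t → V k ∈ convexHull ℝ (V '' Set.Ico h t) := fun k h1 h2 =>
    subset_convexHull ℝ _ (Set.mem_image_of_mem V ⟨h1, h2⟩)
  have hnm := nxt_mem (h := h) (t := t) (k := l) (by omega) hlt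
  have hl1 : side e c (V (nxt h t l)) < 0 := by
    refine hout _ hnm.1 hnm.2 ?_
    unfold nxt; split_ifs <;> omega
  have hhull : Convex ℝ (convexHull ℝ (V '' Set.Ico h t)) := convex_convexHull ℝ _
  have hconv : Convex ℝ {x | 0 ≤ side e c x} := by
    intro x hx y hy a b ha hb hab
    simp only [Set.mem_ofPred_eq] at *
    rw [side_combo hab]; positivity
  have hFh : F ∈ convexHull ℝ (V '' Set.Ico h t) := by
    rw [hF]
    exact hhull (hmem _ (by omega) (by omega)) (hmem _ (by omega) (by omega))
      (by linarith) hs.le (by ring)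
  have hZh : Z ∈ convexHull ℝ (V '' Set.Ico h t) := by
    rw [hZ]
    exact hhull (hmem _ hnm.1 hnm.2) (hmem _ (by omega) (by omega))
      (by linarith) hu.le (by ring)
  have hhead := hout h le_rfl (by omega) (Or.inl hhf)
  apply Set.Subset.antisymm
  · refine convexHull_min ?_ (hhull.inter hconv)
    intro x hx
    rcases hS x hx with rfl | rfl | ⟨k, h1, h2, rfl⟩
    · exact ⟨hFh, hF0.ge⟩
    · exact ⟨hZh, hZ0.ge⟩
    · exact ⟨hmem k (by omega) (by omega), hV.kept_nonneg hhead hf hl hhf hlt h1 h2⟩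
  · rintro x ⟨hx, hx0⟩
    -- The part of the hull on the cutting line is the segment from `Z` to `F`.
    have hline : ∀ y ∈ convexHull ℝ (V '' Set.Ico h t), side e c y = 0 → y ∈ convexHull ℝ S := by
      intro y hy hy0
      obtain ⟨a, b, ha, hb, h1, h2⟩ := hV.mem_segment_of_side_eq_zero he hhf (by omega)
        (by omega) hlt hs hu hF hZ hF0 hZ0 (hout _ (by omega) (by omega) (Or.inl (by omega))) hl1 hy hy0
      have hZS := subset_convexHull ℝ S hSZ
      have hFS := subset_convexHull ℝ S hSF
      rcases ha.eq_or_lt with rfl | ha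
      · rw [h1, zero_smul, add_zero]; exact hZS
      have hab : 0 < a + b := by linarith
      have : y = (b / (a + b)) • Z + (a / (a + b)) • F := by
        have h3 : (b / (a + b)) + (a / (a + b)) = 1 := by field_simp; ring
        have h4 : F = Z + (a + b) • e := by rw [h2, h1]; module
        have h5 : (a / (a + b)) * (a + b) = a := by field_simp
        rw [h4, h1, smul_add, smul_smul, h5, ← add_assoc, ← add_smul, h3, one_smul]
      rw [this]
      exact convex_convexHull ℝ S hZS hFS (by positivity) (by positivity) (by field_simp; ring)
    -- A point of the hull is a combination of `y` in the hull of the kept vertices and `z` in the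
    -- hull of the removed ones. If it is on the nonnegative side, it lies between `y` and the point
    -- where the segment from `y` to `z` meets the line.
    set K := V '' Set.Icc f l with hK
    set R := V '' {k | h ≤ k ∧ k < t ∧ (k < f ∨ l < k)} with hR
    have hunion : V '' Set.Ico h t = K ∪ R := by
      rw [hK, hR, ← Set.image_union]
      congr 1
      ext k
      simp only [Set.mem_Ico, Set.mem_union, Set.mem_Icc, Set.mem_ofPred_eq]
      omega
    have hKne : K.Nonempty := ⟨V f, Set.mem_image_of_mem V ⟨le_rfl, hfl⟩⟩
    have hRne : R.Nonempty := ⟨V h, Set.mem_image_of_mem V ⟨le_rfl, by omega, Or.inl hhf⟩⟩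
    have hx' := hx
    rw [hunion, convexHull_union hKne hRne, mem_convexJoin] at hx'
    obtain ⟨y, hy, z, hz, a, b, ha, hb, hab, rfl⟩ := hx'
    have hKS : convexHull ℝ K ⊆ convexHull ℝ S := convexHull_mono (by
      rintro _ ⟨k, hk, rfl⟩; exact hSV k hk.1 hk.2)
    have hyh : y ∈ convexHull ℝ (V '' Set.Ico h t) :=
      convexHull_mono (hunion ▸ Set.subset_union_left) hy
    have hzh : z ∈ convexHull ℝ (V '' Set.Ico h t) :=
      convexHull_mono (hunion ▸ Set.subset_union_right) hz
    have hz0 : side e c z < 0 := by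
      have hc : Convex ℝ {x | side e c x < 0} := by
        intro x hx y hy a b ha hb hab
        simp only [Set.mem_ofPred_eq] at *
        rw [side_combo hab]
        rcases ha.eq_or_lt with rfl | ha
        · have : b = 1 := by linarith
          subst this; linarith
        · have := mul_neg_of_pos_of_neg ha hx
          have := mul_nonpos_of_nonneg_of_nonpos hb hy.le
          linarith
      refine convexHull_min ?_ hc hz
      rintro _ ⟨k, hk, rfl⟩
      exact hout k hk.1 hk.2.1 hk.2.2
    have hx1 : 0 ≤ a * side e c y + b * side e c z := by rwa [← side_combo hab]
    rcases hb.eq_or_lt with rfl | hb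
    · have : a = 1 := by linarith
      subst this
      rw [one_smul, zero_smul, add_zero]
      exact hKS hy
    have hbz : b * side e c z < 0 := mul_neg_of_pos_of_neg hb hz0
    have hy0 : 0 < side e c y := by
      by_contra! hn
      have := mul_nonpos_of_nonneg_of_nonpos ha hn
      linarith
    have hd : 0 < side e c y - side e c z := by linarith
    -- The parameter at which the segment from `y` to `z` meets the line.
    set τ := side e c y / (side e c y - side e c z) with hτ
    have hτd : τ * (side e c y - side e c z) = side e c y := div_mul_cancel₀ _ hd.ne'
    have hτ0 : 0 < τ := div_pos hy0 hd
    have hτ1 : τ ≤ 1 := by rw [hτ, div_le_one hd]; linarith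
    have hbτ : b ≤ τ := by
      rw [hτ, le_div_iff₀ hd]
      have : a = 1 - b := by linarith
      subst this
      linarith
    have hcS : (1 - τ) • y + τ • z ∈ convexHull ℝ S := by
      refine hline _ (hhull hyh hzh (by linarith) hτ0.le (by ring)) ?_
      rw [side_combo (by ring)]
      linear_combination -hτd
    have : a • y + b • z = (1 - b / τ) • y + (b / τ) • ((1 - τ) • y + τ • z) := by
      have h1 : b / τ * τ = b := div_mul_cancel₀ _ hτ0.ne'
      have h2 : a = 1 - b := by linarith
      rw [smul_add, smul_smul, smul_smul, h1, ← add_assoc, ← add_smul, h2]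
      congr 2
      linear_combination h1
    rw [this]
    exact convex_convexHull ℝ S (hKS hy) hcS
      (by rw [sub_nonneg, div_le_one hτ0]; exact hbτ) (by positivity) (by ring)

end StrictConvexOn

/-- `V'` on `[h', t')` arises from the convex sequence `V` on `[h, t)` by keeping the vertices
`V f, …, V l`, and by adding at either end the crossing point with the line `{y | crs e y = c}`
unless the outermost kept vertex lies on that line. -/
structure IsCut (e : Plane) (c : ℝ) (V : ℕ → Plane) (h t f l : ℕ) (V' : ℕ → Plane)
    (h' t' : ℕ) : Prop where
  hf : h < f
  fl : f ≤ l
  lt : l < t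
  out : ∀ k, h ≤ k → k < t → (k < f ∨ l < k) → side e c (V k) < 0
  nonneg_first : 0 ≤ side e c (V f)
  nonneg_last : 0 ≤ side e c (V l)
  keep : ∀ k, f ≤ k → k ≤ l → V' k = V k
  front : (h' = f ∧ side e c (V f) = 0) ∨
    (h' + 1 = f ∧ 0 < side e c (V f) ∧ V' h' = crossing e c (V (f - 1)) (V f))
  back : (t' = l + 1 ∧ side e c (V l) = 0) ∨
    (t' = l + 2 ∧ 0 < side e c (V l) ∧ V' (l + 1) = crossing e c (V (nxt h t l)) (V l))

namespace IsCut

variable {e : Plane} {c : ℝ} {V V' : ℕ → Plane} {h t f l h' t' : ℕ}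

theorem side_nxt (hC : IsCut e c V h t f l V' h' t') : side e c (V (nxt h t l)) < 0 := by
  have hnm := nxt_mem (h := h) (t := t) (k := l) (by have := hC.hf; have := hC.fl; omega) hC.lt
  refine hC.out _ hnm.1 hnm.2 ?_
  have := hC.hf
  unfold nxt; split_ifs <;> omega

/-- Unifies the two cases of `front`: if `V f` is itself on the line, it counts as a crossing with
`s = 1`. Strictness `s < 1` is needed only when a new point has been added. -/
theorem first_spec (hC : IsCut e c V h t f l V' h' t') : side e c (V' h') = 0 ∧
    ∃ s : ℝ, 0 < s ∧ s ≤ 1 ∧ V' h' = (1 - s) • V (f - 1) + s • V f ∧ (h' + 1 = f → s < 1) := by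
  have h1 := hC.hf
  have h2 := hC.fl
  have h3 := hC.lt
  rcases hC.front with ⟨rfl, h4⟩ | ⟨h4, h5, h6⟩
  · rw [hC.keep _ le_rfl h2]
    exact ⟨h4, 1, one_pos, le_rfl, by simp, by omega⟩
  · obtain ⟨h7, s, hs, hs1, h8⟩ := crossing_spec
      (hC.out (f - 1) (by omega) (by omega) (Or.inl (by omega))) h5
    rw [h6]
    exact ⟨h7, s, hs, hs1.le, h8, fun _ => hs1⟩

theorem last_spec (hC : IsCut e c V h t f l V' h' t') : side e c (V' (t' - 1)) = 0 ∧
    ∃ u : ℝ, 0 < u ∧ u ≤ 1 ∧ V' (t' - 1) = (1 - u) • V (nxt h t l) + u • V l ∧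
      (t' = l + 2 → u < 1) := by
  have h1 := hC.hf
  have h2 := hC.fl
  have h3 := hC.lt
  rcases hC.back with ⟨rfl, h4⟩ | ⟨h4, h5, h6⟩
  · rw [Nat.add_sub_cancel, hC.keep _ h2 le_rfl]
    exact ⟨h4, 1, one_pos, le_rfl, by simp, by omega⟩
  · obtain ⟨h7, s, hs, hs1, h8⟩ := crossing_spec hC.side_nxt h5
    rw [show t' - 1 = l + 1 by omega, h6]
    exact ⟨h7, s, hs, hs1.le, h8, fun _ => hs1⟩

theorem bounds (hC : IsCut e c V h t f l V' h' t') :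
    (h' = f ∨ h' + 1 = f) ∧ (t' = l + 1 ∨ t' = l + 2) := by
  rcases hC.front with ⟨h1, -⟩ | ⟨h1, -, -⟩ <;> rcases hC.back with ⟨h2, -⟩ | ⟨h2, -, -⟩ <;> omega

/-- Only the two outermost new points can fail to be old vertices, and they are combinations of
adjacent old vertices. Since `orient` is affine in each argument, each new triple is a nonnegative
combination of old ones, and at least one term is positive. -/
theorem strictConvexOn (hC : IsCut e c V h t f l V' h' t') (hV : StrictConvexOn V h t)
    (ht : h + 3 ≤ t) : StrictConvexOn V' h' t' := by
  obtain ⟨-, s, hs0, hs1, hF, hs⟩ := hC.first_spec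
  obtain ⟨-, u, hu0, hu1, hZ, hu⟩ := hC.last_spec
  have h1 := hC.hf
  have h2 := hC.fl
  have h3 := hC.lt
  have hb := hC.bounds
  -- The successor of `V l` may be `V h` itself, so strictness requires `h < i`.
  have posU : ∀ i j, h < i → i < j → j ≤ l → 0 < orient (V i) (V j) (V (nxt h t l)) := by
    intro i j hi hij hj
    by_cases hl : l + 1 < t
    · rw [nxt_of_lt hl]; exact hV.pos i j (l + 1) hi.le hij (by omega) hl
    · rw [nxt_last (by omega), ← orient_rotate]; exact hV.pos h i j le_rfl hi hij (by omega)
  have posU' : ∀ i j, h ≤ i → i < j → j ≤ l → 0 ≤ orient (V i) (V j) (V (nxt h t l)) := by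
    intro i j hi hij hj
    rcases hi.eq_or_lt with rfl | hi
    · by_cases hl : l + 1 < t
      · rw [nxt_of_lt hl]; exact (hV.pos h j (l + 1) le_rfl hij (by omega) hl).le
      · rw [nxt_last (by omega), orient_self_outer]
    · exact (posU i j hi hij hj).le
  have pos' : ∀ i j k, h ≤ i → i ≤ j → j ≤ k → k < t → 0 ≤ orient (V i) (V j) (V k) := by
    intro i j k hi hij hjk hk
    rcases hij.eq_or_lt with rfl | hij
    · rw [orient_self_left]
    rcases hjk.eq_or_lt with rfl | hjk
    · rw [orient_self_right]
    exact (hV.pos i j k hi hij hjk hk).le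
  constructor
  · intro i j k hi hij hjk hk
    rw [hC.keep j (by omega) (by omega)]
    by_cases hif : f ≤ i <;> by_cases hkl : k ≤ l
    · rw [hC.keep i hif (by omega), hC.keep k (by omega) hkl]
      exact hV.pos i j k (by omega) hij hjk (by omega)
    · have hk' : k = t' - 1 := by omega
      rw [hC.keep i hif (by omega), hk', hZ, orient_combo_right]
      have a1 := hu (by omega)
      have a2 := posU i j (by omega) hij (by omega)
      have a3 := pos' i j l (by omega) (by omega) (by omega) h3
      have := mul_pos (sub_pos.2 a1) a2
      have := mul_nonneg hu0.le a3
      linarith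
    · have hi' : i = h' := by omega
      rw [hC.keep k (by omega) hkl, hi', hF, orient_combo_left]
      have a1 := hs (by omega)
      have a2 := hV.pos (f - 1) j k (by omega) (by omega) (by omega) (by omega)
      have a3 := pos' f j k (by omega) (by omega) (by omega) (by omega)
      have := mul_pos (sub_pos.2 a1) a2
      have := mul_nonneg hs0.le a3
      linarith
    · have hk' : k = t' - 1 := by omega
      have hi' : i = h' := by omega
      have a1 := sub_pos.2 (hs (by omega))
      have a2 := sub_pos.2 (hu (by omega))
      rw [hk', hZ, orient_combo_right, hi', hF, orient_combo_left, orient_combo_left]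
      have b1 : 0 ≤ orient (V (f - 1)) (V j) (V (nxt h t l)) :=
        posU' _ _ (by omega) (by omega) (by omega)
      have b2 : 0 ≤ orient (V (f - 1)) (V j) (V l) :=
        pos' _ _ _ (by omega) (by omega) (by omega) h3
      have b3 : 0 ≤ orient (V f) (V j) (V (nxt h t l)) := by
        rcases (show f ≤ j by omega).eq_or_lt with rfl | hj
        · rw [orient_self_left]
        · exact (posU _ _ (by omega) hj (by omega)).le
      have b4 : 0 ≤ orient (V f) (V j) (V l) :=
        pos' _ _ _ (by omega) (by omega) (by omega) h3
      have c1 := mul_nonneg a2.le (mul_nonneg a1.le b1)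
      have c2 := mul_nonneg hu0.le (mul_nonneg a1.le b2)
      have c3 := mul_nonneg a2.le (mul_nonneg hs0.le b3)
      have c4 := mul_nonneg hu0.le (mul_nonneg hs0.le b4)
      by_cases hfl : f = l
      · have hj : j = f := by omega
        have : 0 < orient (V (f - 1)) (V j) (V (nxt h t l)) := by
          rw [hj]
          by_cases hl : l + 1 < t
          · rw [nxt_of_lt hl]
            exact hV.pos _ _ _ (by omega) (by omega) (by omega) hl
          · exact posU _ _ (by omega) (by omega) (by omega)
        have c1 := mul_pos a2 (mul_pos a1 this)
        linarith
      · by_cases hj : j = f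
        · have : 0 < orient (V (f - 1)) (V j) (V l) :=
            hV.pos _ _ _ (by omega) (by omega) (by omega) h3
          have c2 := mul_pos hu0 (mul_pos a1 this)
          linarith
        · have : 0 < orient (V f) (V j) (V (nxt h t l)) :=
            posU _ _ (by omega) (by omega) (by omega)
          have c3 := mul_pos a2 (mul_pos hs0 this)
          linarith
  · intro ht'
    -- With one kept vertex, two points in all would mean exactly one added crossing, so the kept
    -- vertex would be both on the line and strictly off it.
    have hkl : h' = f ∧ l = f + 1 := by
      by_cases hfl : f = l
      · subst hfl
        exfalso
        rcases hC.front with ⟨r1, r2⟩ | ⟨r1, r2, -⟩ <;> rcases hC.back with ⟨r3, r4⟩ | ⟨r3, r4, -⟩ <;>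
          first | omega | linarith
      · omega
    rw [hkl.1, hC.keep f (by omega) (by omega), hC.keep (f + 1) (by omega) (by omega)]
    exact hV.ne_of_lt (by omega) (by omega) (by omega)

theorem hull_eq (hC : IsCut e c V h t f l V' h' t') (hV : StrictConvexOn V h t) (he : e ≠ 0) :
    convexHull ℝ (V' '' Set.Ico h' t') =
      convexHull ℝ (V '' Set.Ico h t) ∩ {x | 0 ≤ side e c x} := by
  obtain ⟨hF0, s, hs0, hs1, hF, -⟩ := hC.first_spec
  obtain ⟨hZ0, u, hu0, hu1, hZ, -⟩ := hC.last_spec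
  have h1 := hC.hf
  have h2 := hC.fl
  have hb := hC.bounds
  refine hV.hull_inter_halfplane he hC.hf hC.fl hC.lt hs0 hs1 hu0 hu1 hF hZ hF0 hZ0
    hC.nonneg_first hC.nonneg_last hC.out ?_ ?_ ?_ ?_
  · exact Set.mem_image_of_mem V' ⟨le_rfl, by omega⟩
  · exact Set.mem_image_of_mem V' ⟨by omega, by omega⟩
  · intro k hk hk'
    rw [← hC.keep k hk hk']
    exact Set.mem_image_of_mem V' ⟨by omega, by omega⟩
  · rintro _ ⟨k, ⟨k1, k2⟩, rfl⟩
    by_cases hk : k = h'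
    · exact Or.inl (by rw [hk])
    by_cases hk' : k = t' - 1
    · exact Or.inr (Or.inl (by rw [hk']))
    · exact Or.inr (Or.inr ⟨k, by omega, by omega, hC.keep k (by omega) (by omega)⟩)

theorem side_nonneg (hC : IsCut e c V h t f l V' h' t') (hV : StrictConvexOn V h t) {k : ℕ}
    (hk : h' ≤ k) (hk' : k < t') : 0 ≤ side e c (V' k) := by
  have hb := hC.bounds
  have h1 := hC.hf
  have h2 := hC.fl
  have h3 := hC.lt
  by_cases k1 : k = h'
  · rw [k1, hC.first_spec.1]
  by_cases k2 : k = t' - 1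
  · rw [k2, hC.last_spec.1]
  rw [hC.keep k (by omega) (by omega)]
  exact hV.kept_nonneg (hC.out h le_rfl (by omega) (Or.inl h1)) hC.nonneg_first hC.nonneg_last
    h1 h3 (by omega) (by omega)

/-- The new edge runs in the direction of the cutting line. -/
theorem closing_edge (hC : IsCut e c V h t f l V' h' t') (hV : StrictConvexOn V h t) (he : e ≠ 0)
    (hne : V' h' ≠ V' (t' - 1)) : ∃ a : ℝ, 0 < a ∧ V' h' - V' (t' - 1) = a • e := by
  obtain ⟨hF0, s, hs0, hs1, hF, -⟩ := hC.first_spec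
  obtain ⟨hZ0, u, hu0, hu1, hZ, -⟩ := hC.last_spec
  have h1 := hC.hf
  have h2 := hC.fl
  have h3 := hC.lt
  have hb := hC.bounds
  have hFh : V' h' ∈ convexHull ℝ (V '' Set.Ico h t) := by
    have : V' h' ∈ convexHull ℝ (V' '' Set.Ico h' t') :=
      subset_convexHull ℝ _ (Set.mem_image_of_mem V' ⟨le_rfl, by omega⟩)
    rw [hC.hull_eq hV he] at this
    exact this.1
  obtain ⟨a, b, ha, hb, h4, h5⟩ := hV.mem_segment_of_side_eq_zero he h1 (by omega)
    (by omega) h3 hs0 hu0 hF hZ hF0 hZ0 (hC.out _ (by omega) (by omega) (Or.inl (by omega)))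
    hC.side_nxt hFh hF0
  have ha' : a ≠ 0 := by
    rintro rfl
    exact hne (by rw [h4, zero_smul, add_zero])
  exact ⟨a, lt_of_le_of_ne ha ha'.symm, by nth_rewrite 1 [h4]; abel⟩

end IsCut

/-! ### Successive cuts of a convex polygon along its shifted edges -/

/-- The constant of the line parallel to edge `i` at distance `δ` to its left. -/
noncomputable def shiftConst (W : ℕ → Plane) (δ : ℝ) (i : ℕ) : ℝ :=
  crs (edge W i) (W i) + δ * ‖edge W i‖

theorem side_shiftConst (W : ℕ → Plane) (δ : ℝ) (i : ℕ) (x : Plane) :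
    side (edge W i) (shiftConst W δ i) x = crs (edge W i) (x - W i) - δ * ‖edge W i‖ := by
  rw [side, shiftConst, crs_sub_right]; ring

/-- The polygon with vertices `W 0, …, W (n - 1)`, cut along the first `i` shifted edges. -/
def cutRegion (n : ℕ) (W : ℕ → Plane) (δ : ℝ) (i : ℕ) : Set Plane :=
  convexHull ℝ (W '' Set.Ico 0 n) ∩ {x | ∀ k < i, 0 ≤ side (edge W k) (shiftConst W δ k) x}

theorem cutRegion_succ (n : ℕ) (W : ℕ → Plane) (δ : ℝ) (i : ℕ) :
    cutRegion n W δ (i + 1) =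
      cutRegion n W δ i ∩ {x | 0 ≤ side (edge W i) (shiftConst W δ i) x} := by
  ext x
  simp only [cutRegion, Set.mem_inter_iff, Set.mem_ofPred_eq, Nat.lt_succ_iff_lt_or_eq]
  constructor
  · rintro ⟨h1, h2⟩
    exact ⟨⟨h1, fun k hk => h2 k (Or.inl hk)⟩, h2 i (Or.inr rfl)⟩
  · rintro ⟨⟨h1, h2⟩, h3⟩
    refine ⟨h1, fun k hk => ?_⟩
    rcases hk with hk | rfl
    · exact h2 k hk
    · exact h3

/-- `V h, …, V (t - 1)` are the vertices of the polygon cut along the first `i` shifted edges.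
Every edge is parallel to an edge of the original polygon, and even contained in its line as long
as no cut has been made along this edge. The first vertex minimises `crs (edge W i)`. -/
structure CutInv (n : ℕ) (W : ℕ → Plane) (δ : ℝ) (i : ℕ) (V : ℕ → Plane) (h t : ℕ) : Prop where
  conv : StrictConvexOn V h t
  hull : convexHull ℝ (V '' Set.Ico h t) = cutRegion n W δ i
  edges : ∀ k, h ≤ k → k < t → h + 1 < t → ∃ j < n, ∃ a : ℝ, 0 < a ∧
    V (nxt h t k) - V k = a • edge W j ∧ (i ≤ j → crs (edge W j) (V k - W j) = 0)
  head : ∀ k, h ≤ k → k < t → 0 ≤ crs (edge W i) (V k - V h)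

namespace CutInv

variable {n : ℕ} {W V V' : ℕ → Plane} {δ : ℝ} {i h t f l h' t' : ℕ}

theorem init (hW : ConvexCycle n W) (hV : ∀ k < n, V k = W k) : CutInv n W δ 0 V 0 n where
  conv := ⟨fun i j k _ hij hjk hk => by
      rw [hV i (by omega), hV j (by omega), hV k hk]
      exact hW.strictConvexOn.pos i j k (Nat.zero_le _) hij hjk hk,
    fun h => by have := hW.three_le; omega⟩
  hull := by
    have : V '' Set.Ico 0 n = W '' Set.Ico 0 n := Set.image_congr fun k hk => hV k hk.2
    rw [this]
    simp [cutRegion]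
  edges k _ hk _ := by
    refine ⟨k, hk, 1, one_pos, ?_, fun _ => ?_⟩
    · rw [hV _ (nxt_mem (Nat.zero_le k) hk).2, hW.nxt_eq hk, hV k hk, one_smul, edge]
    · rw [hV k hk, sub_self, crs_zero_right]
  head k _ hk := by
    rw [hV k hk, hV 0 (by omega)]
    exact hW.edge_left 0 k

/-- Also serves when nothing was left before the cut; `hout` is then vacuous. -/
theorem empty (hI : CutInv n W δ i V h t)
    (hout : ∀ k, h ≤ k → k < t → side (edge W i) (shiftConst W δ i) (V k) < 0) (ht : t' ≤ h') :
    CutInv n W δ (i + 1) V' h' t' where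
  conv := ⟨fun i j k h1 h2 h3 h4 => by omega, fun h => by omega⟩
  hull := by
    rw [Set.Ico_eq_empty (by omega), Set.image_empty, convexHull_empty, cutRegion_succ, ← hI.hull]
    symm
    rw [Set.eq_empty_iff_forall_notMem]
    rintro x ⟨hx, hx0⟩
    have hc : Convex ℝ {x | side (edge W i) (shiftConst W δ i) x < 0} := by
      intro x hx y hy a b ha hb hab
      simp only [Set.mem_ofPred_eq] at *
      rw [side_combo hab]
      rcases ha.eq_or_lt with rfl | ha
      · have : b = 1 := by linarith
        subst this; linarith
      · have := mul_neg_of_pos_of_neg ha hx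
        have := mul_nonpos_of_nonneg_of_nonpos hb hy.le
        linarith
    have : x ∈ {x | side (edge W i) (shiftConst W δ i) x < 0} := by
      refine convexHull_min ?_ hc hx
      rintro _ ⟨k, hk, rfl⟩
      exact hout k hk.1 hk.2
    simp only [Set.mem_ofPred_eq] at this hx0
    linarith
  edges k h1 h2 := by omega
  head k h1 h2 := by omega

/-- The head minimises the position relative to the line, so testing it alone shows that nothing is
cut off. -/
theorem keep (hW : ConvexCycle n W) (hδ : 0 < δ) (hi : i < n) (hI : CutInv n W δ i V h t)
    (hh : h < t) (h0 : 0 ≤ side (edge W i) (shiftConst W δ i) (V h)) :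
    CutInv n W δ (i + 1) V h t where
  conv := hI.conv
  hull := by
    rw [cutRegion_succ, ← hI.hull]
    symm
    refine Set.inter_eq_left.2 (convexHull_min ?_ ?_)
    · rintro _ ⟨k, hk, rfl⟩
      have := hI.head k hk.1 hk.2
      rw [← side_sub _ (shiftConst W δ i)] at this
      simp only [Set.mem_ofPred_eq]
      linarith
    · intro x hx y hy a b ha hb hab
      simp only [Set.mem_ofPred_eq] at *
      rw [side_combo hab]; positivity
  edges k h1 h2 h3 := by
    obtain ⟨j, hj, a, ha, h4, h5⟩ := hI.edges k h1 h2 h3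
    exact ⟨j, hj, a, ha, h4, fun h => h5 (by omega)⟩
  head := by
    refine hI.conv.min_succ le_rfl hh (hW.crs_edge_succ i) hI.head ?_
    by_cases h1 : h + 1 < t
    · obtain ⟨j, hj, a, ha, h4, h5⟩ := hI.edges h le_rfl hh h1
      have h6 := hI.head _ (nxt_mem le_rfl hh).1 (nxt_mem le_rfl hh).2
      rw [h4, crs_smul_right] at h6 ⊢
      refine mul_nonneg ha.le (hW.crs_succ_nonneg hi hj ?_ (nonneg_of_mul_nonneg_right h6 ha))
      -- If the edge leaving the head had direction `i`, it would still lie on the original line of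
      -- edge `i`, where the position relative to the shifted line is negative because `δ > 0`.
      rintro rfl
      have h7 := h5 le_rfl
      rw [side_shiftConst, h7] at h0
      have := mul_pos hδ (norm_pos_iff.2 (hW.edge_ne_zero j))
      linarith
    · rw [nxt_last (by omega), sub_self, crs_zero_right]

/-- Surviving edges are parts of old edges, and the only new edge closes the cycle in direction `i`.
It ends at the new head, so the head minimises direction `i`, and it minimises direction `i + 1`
once the edge leaving it is known not to have direction `i`. -/
theorem cut (hW : ConvexCycle n W) (hi : i < n) (hI : CutInv n W δ i V h t) (ht : h + 3 ≤ t)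
    (hC : IsCut (edge W i) (shiftConst W δ i) V h t f l V' h' t') :
    CutInv n W δ (i + 1) V' h' t' := by
  obtain ⟨hF0, s, hs0, hs1, hF, hs⟩ := hC.first_spec
  obtain ⟨hZ0, u, hu0, hu1, hZ, hu⟩ := hC.last_spec
  have he := hW.edge_ne_zero i
  have h1 := hC.hf
  have h2 := hC.fl
  have h3 := hC.lt
  have hb := hC.bounds
  have hconv := hC.strictConvexOn hI.conv ht
  have hedges : ∀ k, h' ≤ k → k + 1 < t' → ∃ j < n, ∃ a : ℝ, 0 < a ∧
      V' (k + 1) - V' k = a • edge W j ∧ (i ≤ j → crs (edge W j) (V' k - W j) = 0) := by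
    intro k hk hkt
    by_cases hkf : f ≤ k
    · by_cases hkl : k + 1 ≤ l
      · obtain ⟨j, hj, a, ha, h4, h5⟩ := hI.edges k (by omega) (by omega) (by omega)
        rw [nxt_of_lt (by omega)] at h4
        rw [hC.keep k hkf (by omega), hC.keep (k + 1) (by omega) hkl]
        exact ⟨j, hj, a, ha, h4, h5⟩
      · have hk' : k = l := by omega
        have hkt' : k + 1 = t' - 1 := by omega
        obtain ⟨j, hj, a, ha, h4, h5⟩ := hI.edges l (by omega) (by omega) (by omega)
        refine ⟨j, hj, (1 - u) * a, mul_pos (sub_pos.2 (hu (by omega))) ha, ?_, ?_⟩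
        · rw [hkt', hZ, hC.keep k hkf (by omega), hk', mul_smul, ← h4]; module
        · rw [hC.keep k hkf (by omega), hk']; exact h5
    · have hk' : k = h' := by omega
      have hkf' : k + 1 = f := by omega
      obtain ⟨j, hj, a, ha, h4, h5⟩ := hI.edges (f - 1) (by omega) (by omega) (by omega)
      rw [nxt_of_lt (by omega), show f - 1 + 1 = f by omega] at h4
      refine ⟨j, hj, (1 - s) * a, mul_pos (sub_pos.2 (hs (by omega))) ha, ?_, fun hij => ?_⟩
      · rw [hkf', hk', hF, hC.keep f le_rfl h2, mul_smul, ← h4]; module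
      · have : V' k - W j = (V (f - 1) - W j) + (s * a) • edge W j := by
          rw [hk', hF, mul_smul, ← h4]; module
        rw [this, crs_add_right, crs_smul_right, crs_self, h5 hij]; ring
  refine ⟨hconv, ?_, ?_, ?_⟩
  · rw [hC.hull_eq hI.conv he, cutRegion_succ, hI.hull]
  · intro k hk hkt hht
    by_cases hkl : k + 1 < t'
    · rw [nxt_of_lt hkl]
      obtain ⟨j, hj, a, ha, h4, h5⟩ := hedges k hk hkl
      exact ⟨j, hj, a, ha, h4, fun h => h5 (by omega)⟩
    · rw [nxt_last (by omega), show k = t' - 1 by omega]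
      obtain ⟨a, ha, h4⟩ := hC.closing_edge hI.conv he
        (hconv.ne_of_lt le_rfl (by omega) (by omega))
      -- The closing edge lies on the shifted line, but the clause on original lines now concerns
      -- only `j ≥ i + 1`.
      exact ⟨i, hi, a, ha, h4, fun h => by omega⟩
  · have hmin : ∀ k, h' ≤ k → k < t' → 0 ≤ crs (edge W i) (V' k - V' h') := by
      intro k hk hkt
      rw [← side_sub _ (shiftConst W δ i), hF0, sub_zero]
      exact hC.side_nonneg hI.conv hk hkt
    refine hconv.min_succ le_rfl (by omega) (hW.crs_edge_succ i) hmin ?_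
    by_cases hlt : h' + 1 < t'
    · rw [nxt_of_lt hlt]
      obtain ⟨j, hj, a, ha, h4, -⟩ := hedges h' le_rfl hlt
      have h6 := hmin (h' + 1) (by omega) hlt
      rw [h4, crs_smul_right] at h6 ⊢
      refine mul_nonneg ha.le (hW.crs_succ_nonneg hi hj ?_ (nonneg_of_mul_nonneg_right h6 ha))
      rintro rfl
      -- An edge of direction `i` leaving the head would stay on the cutting line. If the head is `V
      -- f`, the cut-off vertex `V h` would make `V h`, `V f`, `V (f + 1)` a right turn; if it is a
      -- crossing, the edge ends at `V f`, which is strictly off the line.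
      rcases hC.front with ⟨g1, g2⟩ | ⟨g1, g2, -⟩
      · have hl : f + 1 ≤ l := by
          rcases hC.back with ⟨g3, g4⟩ | ⟨g3, g4, -⟩
          · omega
          · by_contra hfl
            have : l = f := by omega
            rw [this, g2] at g4
            exact lt_irrefl _ g4
        rw [g1, hC.keep f le_rfl h2, hC.keep (f + 1) (by omega) hl] at h4
        have hpos := hI.conv.pos h f (f + 1) le_rfl h1 (by omega) (by omega)
        have : orient (V h) (V f) (V (f + 1)) = crs (V f - V h) (V (f + 1) - V f) := by
          simp only [orient, crs, PiLp.sub_apply]; ring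
        rw [this, h4, crs_smul_right, crs_anticomm, ← side_sub _ (shiftConst W δ j), g2] at hpos
        have hh0 := hC.out h le_rfl (by omega) (Or.inl h1)
        nlinarith
      · have : crs (edge W j) (V' (h' + 1) - V' h') = 0 := by
          rw [h4, crs_smul_right, crs_self, mul_zero]
        rw [← side_sub _ (shiftConst W δ j), hF0, g1, hC.keep f le_rfl h2, sub_zero] at this
        linarith
    · rw [nxt_last (by omega), sub_self, crs_zero_right]

/-- Cutting a segment. -/
theorem cut_segment (hW : ConvexCycle n W) (hi : i < n) (hI : CutInv n W δ i V h (h + 2))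
    (hh : side (edge W i) (shiftConst W δ i) (V h) < 0)
    (hl : 0 ≤ side (edge W i) (shiftConst W δ i) (V (h + 1)))
    (hkeep : V' (h + 1) = V (h + 1))
    (hfront : (h' = h + 1 ∧ side (edge W i) (shiftConst W δ i) (V (h + 1)) = 0) ∨
      (h' = h ∧ 0 < side (edge W i) (shiftConst W δ i) (V (h + 1)) ∧
        V' h = crossing (edge W i) (shiftConst W δ i) (V h) (V (h + 1)))) :
    CutInv n W δ (i + 1) V' h' (h + 2) := by
  have he := hW.edge_ne_zero i
  have n1 : nxt h (h + 2) h = h + 1 := nxt_of_lt (by omega)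
  have n2 : nxt h (h + 2) (h + 1) = h := nxt_last (by omega)
  have hF : side (edge W i) (shiftConst W δ i) (V' h') = 0 ∧ ∃ s : ℝ, 0 < s ∧ s ≤ 1 ∧
      V' h' = (1 - s) • V h + s • V (h + 1) ∧ (h' = h → s < 1) := by
    rcases hfront with ⟨rfl, h1⟩ | ⟨rfl, h1, h2⟩
    · rw [hkeep]
      exact ⟨h1, 1, one_pos, le_rfl, by simp, by omega⟩
    · obtain ⟨g1, s, g2, g3, g4⟩ := crossing_spec hh h1
      rw [h2]
      exact ⟨g1, s, g2, g3.le, g4, fun _ => g3⟩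
  obtain ⟨hF0, s, hs0, hs1, hF, hs⟩ := hF
  have hb : h' = h ∨ h' = h + 1 := by omega
  have hside : ∀ k, h' ≤ k → k < h + 2 → 0 ≤ side (edge W i) (shiftConst W δ i) (V' k) := by
    intro k hk hkt
    by_cases k1 : k = h'
    · rw [k1, hF0]
    · rw [show k = h + 1 by omega, hkeep]; exact hl
  have hmin : ∀ k, h' ≤ k → k < h + 2 → 0 ≤ crs (edge W i) (V' k - V' h') := by
    intro k hk hkt
    rw [← side_sub _ (shiftConst W δ i), hF0, sub_zero]
    exact hside k hk hkt
  have hhull : convexHull ℝ (V' '' Set.Ico h' (h + 2)) = cutRegion n W δ (i + 1) := by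
    rw [cutRegion_succ, ← hI.hull]
    have hF' : V' h' = (1 - s) • V (h + 1 - 1) + s • V (h + 1) := by
      rw [Nat.add_sub_cancel]; exact hF
    -- A segment is a polygon with two opposite edges; the line meets both in the same point, so `F
    -- = Z`.
    refine hI.conv.hull_inter_halfplane (f := h + 1) (l := h + 1) he (by omega)
      le_rfl (by omega) hs0 hs1 hs0 hs1 hF' (by rw [n2]; exact hF) hF0 hF0 hl hl ?_ ?_ ?_ ?_ ?_
    · intro k h1 h2 h3
      rw [show k = h by omega]; exact hh
    · exact Set.mem_image_of_mem V' ⟨le_rfl, by omega⟩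
    · exact Set.mem_image_of_mem V' ⟨le_rfl, by omega⟩
    · intro k h1 h2
      rw [show k = h + 1 by omega, ← hkeep]
      exact Set.mem_image_of_mem V' ⟨by omega, by omega⟩
    · rintro _ ⟨k, ⟨k1, k2⟩, rfl⟩
      by_cases hk : k = h'
      · exact Or.inl (by rw [hk])
      · exact Or.inr (Or.inr ⟨h + 1, le_rfl, le_rfl, by rw [← hkeep]; congr 1; omega⟩)
  rcases hb with rfl | rfl
  · have hs1 := hs rfl
    have e1 : V' (h' + 1) - V' h' = (1 - s) • (V (h' + 1) - V h') := by
      rw [hF, hkeep]; module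
    have e2 : V' h' - V' (h' + 1) = (1 - s) • (V h' - V (h' + 1)) := by
      rw [hF, hkeep]; module
    have hedges : ∀ k, h' ≤ k → k < h' + 2 → h' + 1 < h' + 2 → ∃ j < n, ∃ a : ℝ, 0 < a ∧
        V' (nxt h' (h' + 2) k) - V' k = a • edge W j ∧
        (i ≤ j → crs (edge W j) (V' k - W j) = 0) := by
      intro k k1 k2 _
      rcases (show k = h' ∨ k = h' + 1 by omega) with rfl | rfl
      · obtain ⟨j, hj, a, ha, h4, h5⟩ := hI.edges k k1 k2 (by omega)
        rw [n1] at h4 ⊢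
        refine ⟨j, hj, (1 - s) * a, mul_pos (sub_pos.2 hs1) ha, ?_, fun hij => ?_⟩
        · rw [e1, h4, mul_smul]
        · have : V' k - W j = (V k - W j) + (s * a) • edge W j := by
            rw [hF, mul_smul, ← h4]; module
          rw [this, crs_add_right, crs_smul_right, crs_self, h5 hij]; ring
      · obtain ⟨j, hj, a, ha, h4, h5⟩ := hI.edges (h' + 1) k1 k2 (by omega)
        rw [n2] at h4 ⊢
        refine ⟨j, hj, (1 - s) * a, mul_pos (sub_pos.2 hs1) ha, ?_, fun hij => ?_⟩
        · rw [e2, h4, mul_smul]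
        · rw [hkeep]; exact h5 hij
    have hconv : StrictConvexOn V' h' (h' + 2) := by
      refine ⟨fun i j k h1 h2 h3 h4 => by omega, fun _ heq => ?_⟩
      rw [← sub_eq_zero, e2, smul_eq_zero] at heq
      rcases heq with heq | heq
      · linarith
      · exact hI.conv.ne rfl (sub_eq_zero.1 heq)
    refine ⟨hconv, hhull, fun k k1 k2 k3 => ?_, ?_⟩
    · obtain ⟨j, hj, a, ha, h4, h5⟩ := hedges k k1 k2 k3
      exact ⟨j, hj, a, ha, h4, fun h => h5 (by omega)⟩
    · refine hconv.min_succ le_rfl (by omega) (hW.crs_edge_succ i) hmin ?_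
      obtain ⟨j, hj, a, ha, h4, -⟩ := hedges h' le_rfl (by omega) (by omega)
      rw [n1] at h4 ⊢
      have h6 := hmin (h' + 1) (by omega) (by omega)
      rw [h4, crs_smul_right] at h6 ⊢
      refine mul_nonneg ha.le (hW.crs_succ_nonneg hi hj ?_ (nonneg_of_mul_nonneg_right h6 ha))
      rintro rfl
      have h7 : crs (edge W j) (V' (h' + 1) - V' h') = 0 := by
        rw [h4, crs_smul_right, crs_self, mul_zero]
      rw [← side_sub _ (shiftConst W δ j), hF0, hkeep, sub_zero] at h7
      rcases hfront with ⟨h8, -⟩ | ⟨-, h8, -⟩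
      · omega
      · linarith
  · refine ⟨⟨fun i j k h1 h2 h3 h4 => by omega, fun h => by omega⟩, hhull,
      fun k k1 k2 k3 => by omega, fun k k1 k2 => ?_⟩
    rw [show k = h + 1 by omega, sub_self, crs_zero_right]

/-- Walking from a minimising vertex for one edge direction to a minimising vertex for this and
the next edge direction. -/
theorem advance (hW : ConvexCycle n W) {m : ℕ} (hi : i < n) (hI : CutInv n W δ m V h t) {a : ℕ}
    (ha : h ≤ a) (hat : a < t) (hm : ∀ k, h ≤ k → k < t → 0 ≤ crs (edge W i) (V k - V a))
    (hneg : crs (edge W (i + 1)) (V (nxt h t a) - V a) < 0) :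
    ∀ k, h ≤ k → k < t → 0 ≤ crs (edge W i) (V k - V (nxt h t a)) ∧
      0 ≤ crs (edge W (i + 1)) (V k - V (nxt h t a)) := by
  have hb := nxt_mem ha hat
  set b := nxt h t a with hbdef
  have hht : h + 1 < t := by
    by_contra hlt
    rw [show b = a by omega, sub_self, crs_zero_right] at hneg
    exact lt_irrefl _ hneg
  obtain ⟨j, hj, x, hx, h1, -⟩ := hI.edges a ha hat hht
  rw [← hbdef] at h1
  have h2 := hm b hb.1 hb.2
  -- By `crs_succ_nonneg`, only an edge of direction `i` can descend in direction `i + 1`. So `V b`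
  -- is a minimum for direction `i` too, and the edge after it has another direction.
  have hji : j = i := by
    by_contra hne
    have h2' := h2
    rw [h1, crs_smul_right] at hneg h2'
    have := mul_nonneg hx.le
      (hW.crs_succ_nonneg hi hj hne (nonneg_of_mul_nonneg_right h2' hx))
    linarith
  subst hji
  have h3 : crs (edge W j) (V b - V a) = 0 := by rw [h1, crs_smul_right, crs_self, mul_zero]
  have hm' : ∀ k, h ≤ k → k < t → 0 ≤ crs (edge W j) (V k - V b) := by
    intro k hk hkt
    have := hm k hk hkt
    have h4 : V k - V b = (V k - V a) - (V b - V a) := by abel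
    rw [h4, crs_sub_right, h3, sub_zero]
    exact this
  have hnext : 0 ≤ crs (edge W (j + 1)) (V (nxt h t b) - V b) := by
    obtain ⟨j', hj', y, hy, h5, -⟩ := hI.edges b hb.1 hb.2 hht
    have h6 := hm' _ (nxt_mem hb.1 hb.2).1 (nxt_mem hb.1 hb.2).2
    rw [h5, crs_smul_right] at h6 ⊢
    refine mul_nonneg hy.le (hW.crs_succ_nonneg hi hj' ?_ (nonneg_of_mul_nonneg_right h6 hy))
    rintro rfl
    -- Two successive edges of direction `i` are impossible: in a segment they are opposite,
    -- otherwise they form a strict left turn.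
    by_cases hc : nxt h t b = a
    · rw [hc] at h5
      have h7 : (x + y) • edge W j' = 0 := by
        rw [add_smul, ← h1, ← h5]; abel
      rw [smul_eq_zero] at h7
      rcases h7 with h7 | h7
      · linarith
      · exact hW.edge_ne_zero _ h7
    · have hnb : nxt h t b ≠ b := by unfold nxt; split_ifs <;> omega
      have hba := nxt_mem hb.1 hb.2
      have hpos := hI.conv.edge_pos ha hat hba.1 hba.2 hc (by rw [← hbdef]; exact hnb)
      rw [← hbdef] at hpos
      have : orient (V a) (V b) (V (nxt h t b)) = crs (V b - V a) (V (nxt h t b) - V b) := by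
        simp only [orient, crs, PiLp.sub_apply]; ring
      rw [this, h1, h5, crs_smul_right, crs_smul_left, crs_self] at hpos
      linarith
  exact fun k hk hkt => ⟨hm' k hk hkt,
    hI.conv.min_succ hb.1 hb.2 (hW.crs_edge_succ j) hm' hnext k hk hkt⟩

theorem stay (hW : ConvexCycle n W) {m : ℕ} (hI : CutInv n W δ m V h t) {a : ℕ}
    (ha : h ≤ a) (hat : a < t) (hm : ∀ k, h ≤ k → k < t → 0 ≤ crs (edge W i) (V k - V a))
    (hneg : ¬ crs (edge W (i + 1)) (V (nxt h t a) - V a) < 0) :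
    ∀ k, h ≤ k → k < t → 0 ≤ crs (edge W i) (V k - V a) ∧
      0 ≤ crs (edge W (i + 1)) (V k - V a) :=
  fun k hk hkt => ⟨hm k hk hkt,
    hI.conv.min_succ ha hat (hW.crs_edge_succ i) hm (not_lt.1 hneg) k hk hkt⟩

end CutInv

/-! ### The core of a convex polygon -/

theorem mem_offset {X : Set Plane} {ρ : ℝ} {x : Plane} :
    x ∈ offset X ρ ↔ ∃ z ∈ X, ‖x - z‖ ≤ ρ := by
  unfold offset
  rw [Set.mem_add]
  constructor
  · rintro ⟨z, hz, w, hw, rfl⟩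
    exact ⟨z, hz, by simpa using hw⟩
  · rintro ⟨z, hz, h⟩
    exact ⟨z, hz, x - z, by simpa using h, by abel⟩

/-- A point of the disk around `a • x + b • y` is the same combination of its translates in the
disks around `x` and `y`. -/
theorem convex_core {Q : Set Plane} (hQ : Convex ℝ Q) (r ε : ℝ) : Convex ℝ (core Q r ε) := by
  have ho : Convex ℝ (offset Q ε) := hQ.add (convex_closedBall 0 ε)
  intro x hx y hy a b ha hb hab z hz
  have h1 : z = a • (x + (z - (a • x + b • y))) + b • (y + (z - (a • x + b • y))) := by
    have : z - (a • x + b • y) = (a + b) • (z - (a • x + b • y)) := by rw [hab, one_smul]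
    nth_rewrite 1 [show z = (a • x + b • y) + (z - (a • x + b • y)) by abel]
    nth_rewrite 1 [this]
    module
  rw [Metric.mem_closedBall, dist_eq_norm] at hz
  rw [h1]
  refine ho (hx ?_) (hy ?_) ha hb hab <;>
  · rw [Metric.mem_closedBall, dist_eq_norm, add_sub_cancel_left]; exact hz

theorem convexDecide_iff_decide {n : ℕ} (q : Fin n → Plane) (r ε : ℝ) :
    ConvexDecide q r ε ↔ Decide (polygon q) r ε := by
  constructor
  · intro hc
    have hcv : Convex ℝ (offset (core (polygon q) r ε) (r + ε)) :=
      (convex_core (convex_convexHull ℝ _) r ε).add (convex_closedBall 0 _)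
    refine convexHull_min ?_ hcv
    rintro _ ⟨i, rfl⟩
    obtain ⟨x, hx, hx'⟩ := hc i
    rw [Metric.mem_closedBall, dist_eq_norm, norm_sub_rev] at hx
    exact mem_offset.2 ⟨x, hx', hx⟩
  · intro hd i
    obtain ⟨x, hx, hx'⟩ := mem_offset.1 (hd (subset_convexHull ℝ _ ⟨i, rfl⟩))
    exact ⟨x, by rwa [Metric.mem_closedBall, dist_eq_norm, norm_sub_rev], hx⟩

theorem convexDecide_of_le {n : ℕ} (q : Fin n → Plane) {r ε : ℝ} (hr : 0 < r) (h : r ≤ ε) :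
    ConvexDecide q r ε := by
  intro i
  refine ⟨q i, Metric.mem_closedBall_self (by linarith), fun y hy => ?_⟩
  rw [Metric.mem_closedBall, dist_eq_norm] at hy
  exact mem_offset.2 ⟨q i, subset_convexHull ℝ _ ⟨i, rfl⟩, hy.trans h⟩

/-- A unit step to the right of the direction `e`. -/
theorem exists_right_step {e : Plane} (he : e ≠ 0) : ∃ u : Plane, ‖u‖ = 1 ∧ crs e u = -‖e‖ := by
  have hn : ‖e‖ ≠ 0 := norm_ne_zero_iff.2 he
  have hsq := norm_sq_plane e
  refine ⟨‖e‖⁻¹ • !₂[e 1, -e 0], ?_, ?_⟩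
  · rw [norm_smul, norm_inv, norm_norm]
    have : ‖(!₂[e 1, -e 0] : Plane)‖ = ‖e‖ := by
      rw [norm_plane, norm_plane]; congr 1; simp; ring
    rw [this, inv_mul_cancel₀ hn]
  · rw [crs_smul_right]
    have : crs e !₂[e 1, -e 0] = -‖e‖ ^ 2 := by rw [hsq]; simp [crs]; ring
    rw [this]; field_simp

/-- For `δ ≥ 0` the shifted half-planes lie inside the original ones, so the original polygon drops
out of the description. -/
theorem mem_cutRegion_iff {n : ℕ} {W : ℕ → Plane} (hW : ConvexCycle n W) {δ : ℝ} (hδ : 0 ≤ δ)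
    {x : Plane} : x ∈ cutRegion n W δ n ↔
      ∀ k < n, δ * ‖edge W k‖ ≤ crs (edge W k) (x - W k) := by
  simp only [cutRegion, Set.mem_inter_iff, hW.mem_hull_iff, Set.mem_ofPred_eq, side_shiftConst,
    sub_nonneg]
  constructor
  · exact fun h => h.2
  · exact fun h => ⟨fun k hk => (by positivity : (0 : ℝ) ≤ δ * ‖edge W k‖).trans (h k hk), h⟩

/-- If the disk around `x` fits, its point farthest out across edge `k` is within `ε` of `Q`, so `x`
has distance at least `r - ε` from that line. Conversely, the disk of radius `r - ε` around such an
`x` lies in `Q`, and any `y` in the disk of radius `r` is within `ε` of it, by shrinking `y` towards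
`x`. -/
theorem core_eq_cutRegion {n : ℕ} {W : ℕ → Plane} (hW : ConvexCycle n W) {r ε : ℝ} (hε : 0 < ε)
    (h : ε < r) :
    core (convexHull ℝ (W '' Set.Ico 0 n)) r ε = cutRegion n W (r - ε) n := by
  have hr : 0 < r := hε.trans h
  ext x
  rw [mem_cutRegion_iff hW (by linarith)]
  constructor
  · intro hx k hk
    obtain ⟨u, hu, hu'⟩ := exists_right_step (hW.edge_ne_zero k)
    have hy : x + r • u ∈ Metric.closedBall x r := by
      rw [Metric.mem_closedBall, dist_eq_norm, add_sub_cancel_left, norm_smul, hu, mul_one,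
        Real.norm_of_nonneg hr.le]
    obtain ⟨z, hz, hz'⟩ := mem_offset.1 (hx hy)
    have h1 := hW.mem_hull_iff.1 hz k hk
    have h2 := (abs_le.1 (abs_crs_le (edge W k) (x + r • u - z))).1
    have h3 : crs (edge W k) (x + r • u - z) =
        crs (edge W k) (x - W k) + r * crs (edge W k) u - crs (edge W k) (z - W k) := by
      simp only [crs_sub_right, crs_add_right, crs_smul_right]; ring
    rw [h3, hu'] at h2
    have h4 := mul_le_mul_of_nonneg_left hz' (norm_nonneg (edge W k))
    linarith
  · intro hx y hy
    rw [Metric.mem_closedBall, dist_eq_norm] at hy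
    refine mem_offset.2 ⟨x + ((r - ε) / r) • (y - x), ?_, ?_⟩
    · rw [hW.mem_hull_iff]
      intro k hk
      have h1 := hx k hk
      have h2 := (abs_le.1 (abs_crs_le (edge W k) (y - x))).1
      have h3 : crs (edge W k) (x + ((r - ε) / r) • (y - x) - W k) =
          crs (edge W k) (x - W k) + (r - ε) / r * crs (edge W k) (y - x) := by
        simp only [crs_sub_right, crs_add_right, crs_smul_right]; ring
      have h4 : -(r * ‖edge W k‖) ≤ crs (edge W k) (y - x) := by
        have := mul_le_mul_of_nonneg_left hy (norm_nonneg (edge W k))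
        linarith
      have h5 : 0 ≤ (r - ε) / r := div_nonneg (by linarith) hr.le
      have h6 := mul_le_mul_of_nonneg_left h4 h5
      have h7 : (r - ε) / r * -(r * ‖edge W k‖) = -((r - ε) * ‖edge W k‖) := by
        field_simp
      rw [h3]; linarith
    · have : y - (x + ((r - ε) / r) • (y - x)) = (ε / r) • (y - x) := by
        have h1 : ε / r = 1 - (r - ε) / r := by field_simp; ring
        rw [h1]; module
      rw [this, norm_smul, Real.norm_of_nonneg (by positivity)]
      calc ε / r * ‖y - x‖ ≤ ε / r * r := by gcongr
        _ = ε := by field_simp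

/-! ### The point of the core next to a vertex -/

/-- In a plane frame, `a' ≤ a` puts `(a', b')` at least as far in angle from the first axis as the
equally long `(a, b)`. The vector `(s, t)` separates the two and has `s ≥ 0`, which forces `(a',
b')` onto the other side of the axis, at or beyond the mirror image `(a, -b)`. The conclusion is the
sign of its inner product with `(b, a)`, a normal of this mirror image. -/
theorem reflected_direction_nonpos {a b a' b' s t : ℝ} (ha : 0 < a) (haa : a' ≤ a) (hb : 0 < b)
    (hn : a ^ 2 + b ^ 2 = a' ^ 2 + b' ^ 2) (hs : 0 ≤ s) (h1 : a * s + b * t < 0)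
    (h2 : 0 ≤ a' * s + b' * t) : a' * b + b' * a ≤ 0 := by
  have ht : t < 0 := by
    by_contra! ht
    have := mul_nonneg ha.le hs
    have := mul_nonneg hb.le ht
    linarith
  by_cases ha' : a' ≤ 0
  · by_cases hb' : b' ≤ 0
    · nlinarith
    · exfalso
      have := mul_nonpos_of_nonpos_of_nonneg ha' hs
      nlinarith
  · rw [not_le] at ha'
    have hbb : b ^ 2 ≤ b' ^ 2 := by nlinarith
    by_cases hb' : b' ≤ 0
    · have : b ≤ -b' := abs_le_of_sq_le_sq' (by nlinarith) (by linarith) |>.2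
      nlinarith
    · rw [not_le] at hb'
      exfalso
      have h3 : b ≤ b' := abs_le_of_sq_le_sq' hbb hb'.le |>.2
      have h4 : a' * (a * s + b * t) < 0 := mul_neg_of_pos_of_neg ha' h1
      have h5 : 0 ≤ a * (a' * s + b' * t) := mul_nonneg ha.le h2
      have h6 : a' * b ≤ a * b' := mul_le_mul haa h3 hb.le ha.le
      nlinarith

/-- The inner product of the plane. -/
def dotp (u v : Plane) : ℝ := u 0 * v 0 + u 1 * v 1

/-- The point of a nonempty core next to a point `q` on the line of edge `i` minimises the distance
to this line. -/
theorem nearest_minimises {n : ℕ} {W : ℕ → Plane} (hW : ConvexCycle n W) {δ : ℝ} (hδ : 0 < δ)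
    {q p : Plane} (hq : ∀ k < n, 0 ≤ crs (edge W k) (q - W k))
    (hp : ∀ k < n, δ * ‖edge W k‖ ≤ crs (edge W k) (p - W k))
    (hmin : ∀ x, (∀ k < n, δ * ‖edge W k‖ ≤ crs (edge W k) (x - W k)) → ‖p - q‖ ≤ ‖x - q‖)
    {i : ℕ} (hi : i < n) (hqi : crs (edge W i) (q - W i) = 0) {x : Plane}
    (hx : ∀ k < n, δ * ‖edge W k‖ ≤ crs (edge W k) (x - W k)) :
    0 ≤ crs (edge W i) (x - p) := by
  by_contra! hneg
  set u := p - q with hu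
  set v := x - p with hv
  have hnorm : ∀ k, 0 < ‖edge W k‖ := fun k => norm_pos_iff.2 (hW.edge_ne_zero k)
  -- no admissible direction leads from `p` towards `q`
  have hdir : ∀ w : Plane, dotp u w < 0 → (∀ k < n, crs (edge W k) (p - W k) = δ * ‖edge W k‖ →
      0 ≤ crs (edge W k) w) → False := by
    intro w hw hk
    have h1 : ∀ᶠ τ : ℝ in nhdsWithin 0 (Set.Ioi 0), ∀ k : Fin n,
        δ * ‖edge W k‖ ≤ crs (edge W k) (p + τ • w - W k) := by
      rw [Filter.eventually_all]
      intro k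
      have hexp : ∀ τ : ℝ, crs (edge W k) (p + τ • w - W k) =
          crs (edge W k) (p - W k) + τ * crs (edge W k) w := fun τ => by
        simp only [crs_sub_right, crs_add_right, crs_smul_right]; ring
      simp only [hexp]
      rcases (hp k k.2).eq_or_lt with h2 | h2
      · filter_upwards [self_mem_nhdsWithin] with τ hτ
        have h3 := hk k k.2 h2.symm
        have := mul_nonneg (le_of_lt (show (0 : ℝ) < τ from hτ)) h3
        linarith
      · have hc : Continuous fun τ : ℝ => crs (edge W k) (p - W k) + τ * crs (edge W k) w := by
          fun_prop
        have h3 : ∀ᶠ τ : ℝ in nhds 0,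
            δ * ‖edge W k‖ < crs (edge W k) (p - W k) + τ * crs (edge W k) w :=
          hc.continuousAt.eventually (lt_mem_nhds (by simpa using h2))
        exact (h3.filter_mono nhdsWithin_le_nhds).mono fun τ hτ => hτ.le
    have h2 : ∀ᶠ τ : ℝ in nhdsWithin 0 (Set.Ioi 0), 2 * dotp u w + τ * ‖w‖ ^ 2 < 0 := by
      have hc : Continuous fun τ : ℝ => 2 * dotp u w + τ * ‖w‖ ^ 2 := by fun_prop
      have h3 : ∀ᶠ τ : ℝ in nhds 0, 2 * dotp u w + τ * ‖w‖ ^ 2 < 0 :=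
        hc.continuousAt.eventually (gt_mem_nhds (by simp only [zero_mul, add_zero]; linarith))
      exact h3.filter_mono nhdsWithin_le_nhds
    obtain ⟨τ, h3, h4, h5⟩ := (h1.and (h2.and self_mem_nhdsWithin)).exists
    have hτ : (0 : ℝ) < τ := h5
    have h6 := hmin (p + τ • w) fun k hk => h3 ⟨k, hk⟩
    have h7 : ‖p + τ • w - q‖ ^ 2 = ‖u‖ ^ 2 + τ * (2 * dotp u w + τ * ‖w‖ ^ 2) := by
      rw [show p + τ • w - q = u + τ • w by rw [hu]; abel]
      simp only [norm_sq_plane, dotp, PiLp.add_apply, PiLp.smul_apply, smul_eq_mul]; ring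
    have h8 : ‖u‖ ^ 2 ≤ ‖p + τ • w - q‖ ^ 2 := by gcongr
    have h9 := mul_neg_of_pos_of_neg hτ h4
    linarith
  -- the vector from `p` to `x` does not lead towards `q`
  have hsv : 0 ≤ dotp u v := by
    by_contra! hlt
    refine hdir v hlt fun k hk hb => ?_
    have := hx k hk
    rw [← hb] at this
    rw [hv, show x - p = (x - W k) - (p - W k) by abel, crs_sub_right]
    linarith
  have hai : δ * ‖edge W i‖ ≤ crs (edge W i) u := by
    have : crs (edge W i) u = crs (edge W i) (p - W i) := by
      rw [hu, show p - q = (p - W i) - (q - W i) by abel, crs_sub_right, hqi, sub_zero]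
    rw [this]; exact hp i hi
  have hak : ∀ k < n, crs (edge W k) (p - W k) = δ * ‖edge W k‖ →
      crs (edge W k) u ≤ δ * ‖edge W k‖ := by
    intro k hk hb
    rw [hu, show p - q = (p - W k) - (q - W k) by abel, crs_sub_right, hb]
    linarith [hq k hk]
  -- Coordinates along `u` and its perpendicular. Below, `(a, b)` represents the inward normal of
  -- edge `i`; as `q` is on the line of this edge and on the inner side of all others, `δ ≤ a`,
  -- whereas active constraints have first coordinate at most `δ`.
  have hid : ∀ f g : Plane, crs f g * ‖u‖ ^ 2 = crs f u * dotp u g + dotp f u * crs u g := by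
    intro f g
    simp only [crs, dotp, norm_sq_plane]; ring
  have hlag : ∀ f : Plane, crs f u ^ 2 + dotp f u ^ 2 = ‖f‖ ^ 2 * ‖u‖ ^ 2 := by
    intro f
    simp only [crs, dotp, norm_sq_plane]; ring
  have hu0 : 0 < ‖u‖ := by
    rw [norm_pos_iff]
    intro h0
    rw [h0, crs_zero_right] at hai
    have := mul_pos hδ (hnorm i)
    linarith
  set a := crs (edge W i) u / ‖edge W i‖ with ha
  set b := dotp (edge W i) u / ‖edge W i‖ with hb
  have haδ : δ ≤ a := by rw [ha, le_div_iff₀ (hnorm i)]; exact hai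
  have hunit : ∀ k, (crs (edge W k) u / ‖edge W k‖) ^ 2 + (dotp (edge W k) u / ‖edge W k‖) ^ 2
      = ‖u‖ ^ 2 := by
    intro k
    rw [div_pow, div_pow, ← add_div, hlag, mul_div_assoc, mul_comm, div_mul_cancel₀]
    exact (pow_pos (hnorm k) 2).ne'
  have hv1 : a * dotp u v + b * crs u v < 0 := by
    have h1 : crs (edge W i) v * ‖u‖ ^ 2 < 0 := mul_neg_of_neg_of_pos hneg (by positivity)
    rw [hid] at h1
    have : a * dotp u v + b * crs u v =
        (crs (edge W i) u * dotp u v + dotp (edge W i) u * crs u v) / ‖edge W i‖ := by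
      rw [ha, hb]; ring
    rw [this]
    exact div_neg_of_neg_of_pos h1 (hnorm i)
  have hvk : ∀ k < n, crs (edge W k) (p - W k) = δ * ‖edge W k‖ →
      0 ≤ crs (edge W k) u / ‖edge W k‖ * dotp u v + dotp (edge W k) u / ‖edge W k‖ * crs u v := by
    intro k hk hbk
    have h1 : 0 ≤ crs (edge W k) v := by
      rw [hv, show x - p = (x - W k) - (p - W k) by abel, crs_sub_right, hbk]
      linarith [hx k hk]
    have h2 : 0 ≤ crs (edge W k) v * ‖u‖ ^ 2 := by positivity
    rw [hid] at h2
    have : crs (edge W k) u / ‖edge W k‖ * dotp u v + dotp (edge W k) u / ‖edge W k‖ * crs u v =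
        (crs (edge W k) u * dotp u v + dotp (edge W k) u * crs u v) / ‖edge W k‖ := by ring
    rw [this]
    exact div_nonneg h2 (hnorm k).le
  -- the direction perpendicular to the mirror image of the normal of edge `i`
  set w : Plane := !₂[b * u 0 - a * u 1, b * u 1 + a * u 0] with hw
  have hw0 : dotp u w = b * ‖u‖ ^ 2 := by
    rw [hw, norm_sq_plane]; simp [dotp]; ring
  have hwk : ∀ f : Plane, crs f w = b * crs f u + a * dotp f u := by
    intro f; rw [hw]; simp [crs, dotp]; ring
  have hak' : ∀ k < n, crs (edge W k) (p - W k) = δ * ‖edge W k‖ →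
      crs (edge W k) u / ‖edge W k‖ ≤ a := fun k hk hbk =>
    ((div_le_iff₀ (hnorm k)).2 (hak k hk hbk)).trans haδ
  -- The case `b < 0` is the reflection of `b > 0` in the line of `u`. If `b = 0`, edge `i` is
  -- perpendicular to `u`, and `x` would lead towards `q` after all.
  rcases lt_trichotomy b 0 with hb0 | hb0 | hb0
  · refine hdir w (by rw [hw0]; exact mul_neg_of_neg_of_pos hb0 (by positivity)) ?_
    intro k hk hbk
    have h1 := reflected_direction_nonpos (a := a) (b := -b) (s := dotp u v) (t := -crs u v)
      (a' := crs (edge W k) u / ‖edge W k‖) (b' := -(dotp (edge W k) u / ‖edge W k‖))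
      (hδ.trans_le haδ) (hak' k hk hbk) (by linarith)
      (by rw [neg_sq, neg_sq, ha, hb, hunit, hunit]) hsv (by linarith)
      (by have := hvk k hk hbk; linarith)
    rw [hwk]
    have h2 : b * crs (edge W k) u + a * dotp (edge W k) u =
        (b * (crs (edge W k) u / ‖edge W k‖) + a * (dotp (edge W k) u / ‖edge W k‖))
          * ‖edge W k‖ := by
      have := (hnorm k).ne'
      field_simp
    rw [h2]
    exact mul_nonneg (by linarith) (hnorm k).le
  · rw [hb0, zero_mul, add_zero] at hv1
    have := mul_nonneg (hδ.trans_le haδ).le hsv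
    linarith
  · refine hdir (-w) (by
      have : dotp u (-w) = -dotp u w := by simp [dotp]; ring
      rw [this, hw0, neg_lt_zero]; positivity) ?_
    intro k hk hbk
    have h1 := reflected_direction_nonpos (a := a) (b := b) (s := dotp u v) (t := crs u v)
      (a' := crs (edge W k) u / ‖edge W k‖) (b' := dotp (edge W k) u / ‖edge W k‖)
      (hδ.trans_le haδ) (hak' k hk hbk) hb0
      (by rw [ha, hb, hunit, hunit]) hsv hv1 (hvk k hk hbk)
    rw [crs_neg_right, hwk]
    have h2 : b * crs (edge W k) u + a * dotp (edge W k) u =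
        (b * (crs (edge W k) u / ‖edge W k‖) + a * (dotp (edge W k) u / ‖edge W k‖))
          * ‖edge W k‖ := by
      have := (hnorm k).ne'
      field_simp
    rw [h2]
    have : (b * (crs (edge W k) u / ‖edge W k‖) + a * (dotp (edge W k) u / ‖edge W k‖))
        * ‖edge W k‖ ≤ 0 := mul_nonpos_of_nonpos_of_nonneg (by linarith) (hnorm k).le
    linarith

/-- A disk around the vertex `W (i + 1)` meets the core if and only if it contains the vertex of
the core that minimises the distances to the two adjacent edges. -/
theorem meets_iff {n : ℕ} {W : ℕ → Plane} (hW : ConvexCycle n W) {δ : ℝ} (hδ : 0 < δ)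
    {i : ℕ} (hi : i < n) {p : Plane} (hp : p ∈ cutRegion n W δ n)
    (h1 : ∀ x ∈ cutRegion n W δ n, 0 ≤ crs (edge W i) (x - p))
    (h2 : ∀ x ∈ cutRegion n W δ n, 0 ≤ crs (edge W (i + 1)) (x - p)) (R : ℝ) :
    (Metric.closedBall (W (i + 1)) R ∩ cutRegion n W δ n).Nonempty ↔ ‖p - W (i + 1)‖ ≤ R := by
  constructor
  · rintro ⟨x, hx, hx'⟩
    have hcl : IsClosed (cutRegion n W δ n) := by
      have : cutRegion n W δ n =
          ⋂ k : Fin n, {x | δ * ‖edge W k‖ ≤ crs (edge W k) (x - W k)} := by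
        ext x
        rw [mem_cutRegion_iff hW hδ.le, Set.mem_iInter]
        exact ⟨fun h k => h k k.2, fun h k hk => h ⟨k, hk⟩⟩
      rw [this]
      exact isClosed_iInter fun k => isClosed_left_halfplane _ _ _
    -- The nearest point `y` minimises the distance to both adjacent edges, as does `p`. So `y - p`
    -- is parallel to two independent edges, hence zero.
    obtain ⟨y, hy, hyd⟩ := hcl.exists_infDist_eq_dist ⟨x, hx'⟩ (W (i + 1))
    have hmin : ∀ z ∈ cutRegion n W δ n, ‖y - W (i + 1)‖ ≤ ‖z - W (i + 1)‖ := by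
      intro z hz
      have := Metric.infDist_le_dist_of_mem (x := W (i + 1)) hz
      rwa [hyd, dist_comm, dist_eq_norm, dist_comm, dist_eq_norm] at this
    have hq : ∀ k < n, 0 ≤ crs (edge W k) (W (i + 1) - W k) := fun k _ => hW.edge_left k (i + 1)
    have hnear : ∀ j < n, crs (edge W j) (W (i + 1) - W j) = 0 → 0 ≤ crs (edge W j) (p - y) := by
      intro j hj hj0
      exact nearest_minimises hW hδ hq ((mem_cutRegion_iff hW hδ.le).1 hy)
        (fun z hz => hmin z ((mem_cutRegion_iff hW hδ.le).2 hz)) hj hj0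
        ((mem_cutRegion_iff hW hδ.le).1 hp)
    have e1 := hnear i hi (crs_self _)
    have e2 : 0 ≤ crs (edge W (i + 1)) (p - y) := by
      by_cases hin : i + 1 < n
      · exact hnear (i + 1) hin (by rw [sub_self, crs_zero_right])
      · have hn : i + 1 = 0 + n := by omega
        rw [hn, hW.edge_periodic]
        refine hnear 0 (by omega) ?_
        rw [hn, hW.periodic, sub_self, crs_zero_right]
    have e3 := h1 y hy
    have e4 := h2 y hy
    have hyp : y - p = 0 := by
      refine eq_zero_of_crs_eq_zero (hW.crs_edge_succ i).ne' ?_ ?_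
      · rw [← neg_sub y p, crs_neg_right] at e1; linarith
      · rw [← neg_sub y p, crs_neg_right] at e2; linarith
    rw [← sub_eq_zero.1 hyp]
    rw [Metric.mem_closedBall, dist_eq_norm] at hx
    exact (hmin x hx').trans hx
  · intro h
    exact ⟨p, by rwa [Metric.mem_closedBall, dist_eq_norm], hp⟩

/-! ### Reasoning about programs -/

/-- Started in `s`, the program `p` halts in some state after some number of steps that together
satisfy `Q`. -/
def Runs (p : Program) (s : State) (Q : State → ℕ → Prop) : Prop := ∃ s' t, Exec p s s' t ∧ Q s' t

namespace Runs

variable {p p' : Program} {s : State} {Q Q' : State → ℕ → Prop}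

theorem mono (h : Runs p s Q) (hQ : ∀ s' t, Q s' t → Q' s' t) : Runs p s Q' := by
  obtain ⟨s', t, h1, h2⟩ := h
  exact ⟨s', t, h1, hQ _ _ h2⟩

theorem skip (h : Q s 1) : Runs .skip s Q := ⟨_, _, Exec.skip s, h⟩

theorem iset {x : ℕ} {e : IExp}
    (h : Q { s with ireg := Function.update s.ireg x (e.eval s) } (e.cost + 1)) :
    Runs (.iset x e) s Q := ⟨_, _, Exec.iset s x e, h⟩

theorem rset {x : ℕ} {e : RExp}
    (h : Q { s with rreg := Function.update s.rreg x (e.eval s) } (e.cost + 1)) :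
    Runs (.rset x e) s Q := ⟨_, _, Exec.rset s x e, h⟩

theorem rstore {a : ℕ} {addr : IExp} {e : RExp}
    (h : Q
      { s with
        rarr :=
          Function.update s.rarr a (Function.update (s.rarr a) (addr.eval s) (e.eval s)) }
      (addr.cost + e.cost + 1)) : Runs (.rstore a addr e) s Q := ⟨_, _, Exec.rstore s a addr e, h⟩

theorem seq (h : Runs p s fun s' t => Runs p' s' fun s'' t' => Q s'' (t + t')) :
    Runs (.seq p p') s Q := by
  obtain ⟨s', t, h1, s'', t', h2, h3⟩ := h
  exact ⟨s'', t + t', Exec.seq h1 h2, h3⟩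

theorem branch {b : Test} (h1 : b.Holds s → Runs p s fun s' t => Q s' (b.cost + 1 + t))
    (h2 : ¬ b.Holds s → Runs p' s fun s' t => Q s' (b.cost + 1 + t)) :
    Runs (.branch b p p') s Q := by
  by_cases hb : b.Holds s
  · obtain ⟨s', t, h3, h4⟩ := h1 hb
    exact ⟨s', _, Exec.branch_true hb h3, h4⟩
  · obtain ⟨s', t, h3, h4⟩ := h2 hb
    exact ⟨s', _, Exec.branch_false hb h3, h4⟩

/-- A loop with invariant `I` whose running time is paid for by the potential `Φ`. -/
theorem loop {b : Test} (I : State → Prop) (Φ : State → ℕ) (hs : I s)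
    (hstep : ∀ s, I s → b.Holds s → Runs p s fun s' t => I s' ∧ b.cost + 1 + t + Φ s' ≤ Φ s) :
    Runs (.loop b p) s fun s' t => I s' ∧ ¬ b.Holds s' ∧ t + Φ s' ≤ Φ s + (b.cost + 1) := by
  induction hN : Φ s using Nat.strong_induction_on generalizing s with
  | _ N ih =>
    by_cases hb : b.Holds s
    · obtain ⟨s', t, h1, h2, h3⟩ := hstep s hs hb
      obtain ⟨s'', t', h4, h5, h6, h7⟩ := ih (Φ s') (by omega) h2 rfl
      exact ⟨s'', _, Exec.loop_step hb h1 h4, h5, h6, by omega⟩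
    · exact ⟨s, _, Exec.loop_done hb, hs, hb, by omega⟩

end Runs

/-! ### The program -/

/-- The point stored in cell `k` of the real arrays `a` and `a + 1`. -/
noncomputable def State.pt (s : State) (a k : ℕ) : Plane := !₂[s.rarr a k, s.rarr (a + 1) k]

/-- The point stored in the real registers `x` and `x + 1`. -/
noncomputable def State.rpt (s : State) (x : ℕ) : Plane := !₂[s.rreg x, s.rreg (x + 1)]

/-- The position of the point `(x, y)` relative to the line held in registers `3`, `4`, `5`. -/
def sideExp (x y : RExp) : RExp :=
  .sub (.sub (.mul (.reg 3) y) (.mul (.reg 4) x)) (.reg 5)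

/-- The position of the point in cell `k` of arrays `4` and `5`. -/
def sideCell (k : IExp) : RExp := sideExp (.load 4 k) (.load 5 k)

theorem sideExp_eval (s : State) (x y : RExp) :
    (sideExp x y).eval s = side (s.rpt 3) (s.rreg 5) !₂[x.eval s, y.eval s] := by
  simp [sideExp, RExp.eval, side, crs, State.rpt]

theorem sideCell_eval (s : State) (k : IExp) :
    (sideCell k).eval s = side (s.rpt 3) (s.rreg 5) (s.pt 4 (k.eval s)) := by
  simp [sideCell, sideExp_eval, RExp.eval, State.pt]

/-- Set the real registers `x` and `x + 1` to the point in cell `k` of arrays `4` and `5`. -/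
def loadPoint (x : ℕ) (k : IExp) : Program := .seq (.rset x (.load 4 k)) (.rset (x + 1) (.load 5 k))

/-- Remove vertices from the front as long as they are cut off. -/
def popFront : Program :=
  .loop (.and (.ilt (.reg 3) (.reg 4)) (.rlt (sideCell (.reg 3)) (.const 0)))
    (.seq (loadPoint 6 (.reg 3)) (.iset 3 (.add (.reg 3) (.const 1))))

/-- Remove vertices from the back as long as they are cut off. -/
def popBack : Program :=
  .loop (.and (.ilt (.reg 3) (.reg 4)) (.rlt (sideCell (.sub (.reg 4) (.const 1))) (.const 0)))
    (.seq (loadPoint 8 (.sub (.reg 4) (.const 1))) (.iset 4 (.sub (.reg 4) (.const 1))))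

/-- Store in cell `dst` the point where the segment from the point in registers `x`, `x + 1` to the
point in cell `k` meets the line. -/
def storeCrossing (x : ℕ) (k dst : IExp) : Program :=
  .seq (.rset 10 (sideExp (.reg x) (.reg (x + 1))))
  (.seq (.rset 11 (.div (.reg 10) (.sub (.reg 10) (sideCell k))))
  (.seq (.rset 12 (.add (.reg x) (.mul (.reg 11) (.sub (.load 4 k) (.reg x)))))
  (.seq (.rset 13 (.add (.reg (x + 1)) (.mul (.reg 11) (.sub (.load 5 k) (.reg (x + 1))))))
  (.seq (.rstore 4 dst (.reg 12)) (.rstore 5 dst (.reg 13))))))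

/-- Integer register `5` holds the size before the cut. For a segment both crossings coincide, and
`pushFront` alone stores the point. -/
def pushBack : Program :=
  .branch (.and (.ilt (.const 2) (.reg 5))
      (.rlt (.const 0) (sideCell (.sub (.reg 4) (.const 1)))))
    (.seq (storeCrossing 8 (.sub (.reg 4) (.const 1)) (.reg 4))
      (.iset 4 (.add (.reg 4) (.const 1)))) .skip

/-- There is always room in front, since `cutBody` removes at least one vertex there first; the
truncated subtraction is therefore exact. -/
def pushFront : Program :=
  .branch (.rlt (.const 0) (sideCell (.reg 3)))
    (.seq (storeCrossing 6 (.reg 3) (.sub (.reg 3) (.const 1)))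
      (.iset 3 (.sub (.reg 3) (.const 1)))) .skip

/-- Cut off the first vertex and all others beyond the line. -/
def cutBody : Program :=
  .seq (.iset 5 (.sub (.reg 4) (.reg 3)))
  (.seq (loadPoint 6 (.reg 3))
  -- If nothing is popped at the back, the successor of the last vertex is the removed first vertex;
  -- registers `8`, `9` are preset for this case.
  (.seq (loadPoint 8 (.reg 3))
  (.seq (.iset 3 (.add (.reg 3) (.const 1)))
  (.seq popFront
  (.seq popBack
  (.branch (.ilt (.reg 3) (.reg 4)) (.seq pushBack pushFront) .skip))))))

/-! ### Correctness and amortised cost of a single cut -/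

/-- `s'` differs from `s` only in the integer registers in `I`, the real registers in `R` and the
real arrays in `A`. -/
structure Frame (I R A : Set ℕ) (s s' : State) : Prop where
  ireg : ∀ x ∉ I, s'.ireg x = s.ireg x
  rreg : ∀ x ∉ R, s'.rreg x = s.rreg x
  rarr : ∀ a ∉ A, s'.rarr a = s.rarr a

theorem Frame.refl {I R A : Set ℕ} (s : State) : Frame I R A s s :=
  ⟨fun _ _ => rfl, fun _ _ => rfl, fun _ _ => rfl⟩

theorem Frame.trans {I R A I' R' A' : Set ℕ} {s s' s'' : State} (h : Frame I R A s s')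
    (h' : Frame I' R' A' s' s'') : Frame (I ∪ I') (R ∪ R') (A ∪ A') s s'' where
  ireg x hx := by
    rw [Set.mem_union, not_or] at hx; rw [h'.ireg x hx.2, h.ireg x hx.1]
  rreg x hx := by
    rw [Set.mem_union, not_or] at hx; rw [h'.rreg x hx.2, h.rreg x hx.1]
  rarr x hx := by
    rw [Set.mem_union, not_or] at hx; rw [h'.rarr x hx.2, h.rarr x hx.1]

theorem Frame.mono {I R A I' R' A' : Set ℕ} {s s' : State} (h : Frame I R A s s') (hI : I ⊆ I')
    (hR : R ⊆ R') (hA : A ⊆ A') : Frame I' R' A' s s' :=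
  ⟨fun x hx => h.ireg x fun h => hx (hI h), fun x hx => h.rreg x fun h => hx (hR h),
    fun x hx => h.rarr x fun h => hx (hA h)⟩

theorem Frame.pt {I R A : Set ℕ} {s s' : State} (h : Frame I R A s s') {a : ℕ} (ha : a ∉ A)
    (ha' : a + 1 ∉ A) : s'.pt a = s.pt a := by
  funext k; simp only [State.pt, h.rarr a ha, h.rarr _ ha']

theorem Frame.rpt {I R A : Set ℕ} {s s' : State} (h : Frame I R A s s') {x : ℕ} (hx : x ∉ R)
    (hx' : x + 1 ∉ R) : s'.rpt x = s.rpt x := by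
  simp only [State.rpt, h.rreg x hx, h.rreg _ hx']

theorem runs_loadPoint (s : State) (x : ℕ) (k : IExp) : Runs (loadPoint x k) s fun s' T =>
    T = 2 * k.cost + 4 ∧ Frame ∅ {x, x + 1} ∅ s s' ∧ s'.rpt x = s.pt 4 (k.eval s) := by
  refine Runs.seq (Runs.rset (Runs.rset ⟨?_, ⟨fun _ _ => rfl, fun y hy => ?_, fun _ _ => rfl⟩, ?_⟩))
  · simp only [RExp.cost]; ring
  · simp only [Set.mem_insert_iff, Set.mem_singleton_iff, not_or] at hy
    simp [Function.update_of_ne hy.1, Function.update_of_ne hy.2]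
  · have hk : ∀ (s : State) (g : ℕ → ℝ), k.eval { s with rreg := g } = k.eval s := by
      intro s g
      induction k with
      | const => rfl
      | reg => rfl
      | load a b ih => simp only [IExp.eval, ih]
      | add a b iha ihb => simp only [IExp.eval, iha, ihb]
      | sub a b iha ihb => simp only [IExp.eval, iha, ihb]
    simp only [State.rpt, State.pt, RExp.eval, hk]
    simp

/-- The position of the point in cell `k` of arrays `4`, `5` relative to the current line. -/
noncomputable def State.side (s : State) (k : ℕ) : ℝ :=
  OffsetDecon.side (s.rpt 3) (s.rreg 5) (s.pt 4 k)

theorem Frame.side {I R A : Set ℕ} {s s' : State} (h : Frame I R A s s') (h3 : 3 ∉ R)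
    (h4 : 4 ∉ R) (h5 : 5 ∉ R) (ha : 4 ∉ A) (ha' : 5 ∉ A) (k : ℕ) : s'.side k = s.side k := by
  simp only [State.side, h.rpt h3 h4, h.rreg 5 h5, h.pt ha ha']

theorem frame_iset (s : State) (x v : ℕ) :
    Frame {x} ∅ ∅ s { s with ireg := Function.update s.ireg x v } :=
  ⟨fun y hy => by simp only [Set.mem_singleton_iff] at hy; simp [hy], fun _ _ => rfl,
    fun _ _ => rfl⟩

/-- Each vertex in the queue carries a credit of `40` steps, which pays for the iteration that pops
it. Registers `6`, `7` end with the vertex just before the first kept one, as needed for the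
crossing. -/
theorem runs_popFront (s : State) (hle : s.ireg 3 ≤ s.ireg 4)
    (hp : s.rpt 6 = s.pt 4 (s.ireg 3 - 1)) : Runs popFront s fun s' T =>
      Frame {3} {6, 7} ∅ s s' ∧ s.ireg 3 ≤ s'.ireg 3 ∧ s'.ireg 3 ≤ s.ireg 4 ∧
      (∀ k, s.ireg 3 ≤ k → k < s'.ireg 3 → s.side k < 0) ∧
      (s'.ireg 3 < s.ireg 4 → 0 ≤ s.side (s'.ireg 3)) ∧
      s'.rpt 6 = s.pt 4 (s'.ireg 3 - 1) ∧
      T + 40 * (s.ireg 4 - s'.ireg 3) ≤ 40 * (s.ireg 4 - s.ireg 3) + 40 := by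
  refine (Runs.loop (fun s' => Frame {3} {6, 7} ∅ s s' ∧ s.ireg 3 ≤ s'.ireg 3 ∧
    s'.ireg 3 ≤ s.ireg 4 ∧ (∀ k, s.ireg 3 ≤ k → k < s'.ireg 3 → s.side k < 0) ∧
    s'.rpt 6 = s.pt 4 (s'.ireg 3 - 1)) (fun s' => 40 * (s'.ireg 4 - s'.ireg 3))
    ⟨Frame.refl s, le_rfl, hle, fun k h1 h2 => by omega, hp⟩ ?_).mono ?_
  · rintro s1 ⟨hF, h2, h3, h4, h5⟩ ⟨hb1, hb2⟩
    have e4 : s1.ireg 4 = s.ireg 4 := hF.ireg 4 (by simp)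
    simp only [Test.Holds, IExp.eval] at hb1
    simp only [Test.Holds, sideCell_eval, IExp.eval, RExp.eval, Int.cast_zero] at hb2
    have hb2' : s.side (s1.ireg 3) < 0 := by
      rw [← hF.side (by simp) (by simp) (by simp) (by simp) (by simp)]; exact hb2
    refine Runs.seq ((runs_loadPoint s1 6 (.reg 3)).mono ?_)
    rintro s2 T2 ⟨hT2, hF2, hp2⟩
    have e3 : s2.ireg 3 = s1.ireg 3 := hF2.ireg 3 (by simp)
    have e4' : s2.ireg 4 = s1.ireg 4 := hF2.ireg 4 (by simp)
    refine Runs.iset ⟨⟨?_, ?_, ?_, ?_, ?_⟩, ?_⟩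
    · refine ((hF.trans hF2).trans (frame_iset s2 3 _)).mono ?_ ?_ ?_ <;>
        intro x <;> simp
    · simp [IExp.eval]; omega
    · simp [IExp.eval]; omega
    · simp only [IExp.eval, Function.update_self]
      intro k k1 k2
      by_cases hk : k < s1.ireg 3
      · exact h4 k k1 hk
      · rw [show k = s1.ireg 3 by omega]; exact hb2'
    · have h6 : State.rpt { s2 with ireg := Function.update s2.ireg 3 (IExp.eval s2 (.add (.reg 3) (.const 1))) } 6
          = s2.rpt 6 := rfl
      rw [h6, hp2]
      simp only [IExp.eval, Function.update_self, e3, Nat.add_sub_cancel]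
      rw [hF.pt (by simp) (by simp)]
    · simp [IExp.eval, Test.cost, IExp.cost, RExp.cost, sideCell, sideExp] at hT2 ⊢
      omega
  · rintro s' T ⟨⟨hF, h2, h3, h4, h5⟩, hb, hT⟩
    have e4 : s'.ireg 4 = s.ireg 4 := hF.ireg 4 (by simp)
    refine ⟨hF, h2, h3, h4, fun hlt => ?_, h5, ?_⟩
    · by_contra! hneg
      refine hb ⟨by simp only [Test.Holds, IExp.eval]; omega, ?_⟩
      simp only [Test.Holds, sideCell_eval, IExp.eval, RExp.eval, Int.cast_zero]
      rw [← hF.side (by simp) (by simp) (by simp) (by simp) (by simp)] at hneg; exact hneg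
    · simp [Test.cost, IExp.cost, RExp.cost, sideCell, sideExp] at hT
      omega

theorem runs_popBack (s : State) (hf : s.ireg 3 < s.ireg 4 → 0 ≤ s.side (s.ireg 3)) {b : Plane}
    (hp : s.rpt 8 = b) : Runs popBack s fun s' T =>
      Frame {4} {8, 9} ∅ s s' ∧ s'.ireg 4 ≤ s.ireg 4 ∧
      min (s.ireg 3 + 1) (s.ireg 4) ≤ s'.ireg 4 ∧
      (∀ k, s'.ireg 4 ≤ k → k < s.ireg 4 → s.side k < 0) ∧
      (s.ireg 3 < s'.ireg 4 → 0 ≤ s.side (s'.ireg 4 - 1)) ∧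
      s'.rpt 8 = (if s'.ireg 4 < s.ireg 4 then s.pt 4 (s'.ireg 4) else b) ∧
      T + 40 * (s'.ireg 4 - s.ireg 3) ≤ 40 * (s.ireg 4 - s.ireg 3) + 40 := by
  refine (Runs.loop (fun s' => Frame {4} {8, 9} ∅ s s' ∧ s'.ireg 4 ≤ s.ireg 4 ∧
    min (s.ireg 3 + 1) (s.ireg 4) ≤ s'.ireg 4 ∧
    (∀ k, s'.ireg 4 ≤ k → k < s.ireg 4 → s.side k < 0) ∧
    s'.rpt 8 = (if s'.ireg 4 < s.ireg 4 then s.pt 4 (s'.ireg 4) else b))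
    (fun s' => 40 * (s'.ireg 4 - s'.ireg 3))
    ⟨Frame.refl s, le_rfl, min_le_right _ _, fun k h1 h2 => by omega, by rw [if_neg (lt_irrefl _), hp]⟩ ?_).mono ?_
  · rintro s1 ⟨hF, h2, h3, h4, h5⟩ ⟨hb1, hb2⟩
    have e3 : s1.ireg 3 = s.ireg 3 := hF.ireg 3 (by simp)
    simp only [Test.Holds, IExp.eval] at hb1
    simp only [Test.Holds, sideCell_eval, IExp.eval, RExp.eval, Int.cast_zero] at hb2
    have hb2' : s.side (s1.ireg 4 - 1) < 0 := by
      rw [← hF.side (by simp) (by simp) (by simp) (by simp) (by simp)]; exact hb2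
    -- After `popFront` the first vertex is not cut off, so a nonempty queue is never emptied from
    -- the back.
    have hne : s1.ireg 4 - 1 ≠ s.ireg 3 := by
      intro he
      rw [he] at hb2'
      have := hf (by omega)
      linarith
    refine Runs.seq ((runs_loadPoint s1 8 (.sub (.reg 4) (.const 1))).mono ?_)
    rintro s2 T2 ⟨hT2, hF2, hp2⟩
    have e3' : s2.ireg 3 = s1.ireg 3 := hF2.ireg 3 (by simp)
    have e4' : s2.ireg 4 = s1.ireg 4 := hF2.ireg 4 (by simp)
    refine Runs.iset ⟨⟨?_, ?_, ?_, ?_, ?_⟩, ?_⟩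
    · refine ((hF.trans hF2).trans (frame_iset s2 4 _)).mono ?_ ?_ ?_ <;>
        intro x <;> simp
    · simp [IExp.eval]; omega
    · simp [IExp.eval]; omega
    · simp only [IExp.eval, Function.update_self]
      intro k k1 k2
      by_cases hk : s1.ireg 4 ≤ k
      · exact h4 k hk k2
      · rw [show k = s1.ireg 4 - 1 by omega]; exact hb2'
    · have h6 : State.rpt { s2 with ireg := Function.update s2.ireg 4 (IExp.eval s2 (.sub (.reg 4) (.const 1))) } 8
          = s2.rpt 8 := rfl
      rw [h6, hp2]
      simp only [IExp.eval, Function.update_self, e4']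
      rw [hF.pt (by simp) (by simp), if_pos (by omega)]
    · simp [IExp.eval, Test.cost, IExp.cost, RExp.cost, sideCell, sideExp] at hT2 ⊢
      omega
  · rintro s' T ⟨⟨hF, h2, h3, h4, h5⟩, hb, hT⟩
    have e3 : s'.ireg 3 = s.ireg 3 := hF.ireg 3 (by simp)
    refine ⟨hF, h2, h3, h4, fun hlt => ?_, h5, ?_⟩
    · by_contra! hneg
      refine hb ⟨by simp only [Test.Holds, IExp.eval]; omega, ?_⟩
      simp only [Test.Holds, sideCell_eval, IExp.eval, RExp.eval, Int.cast_zero]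
      rw [← hF.side (by simp) (by simp) (by simp) (by simp) (by simp)] at hneg; exact hneg
    · simp [Test.cost, IExp.cost, RExp.cost, sideCell, sideExp] at hT
      omega

/-- Integer expressions do not depend on the real registers and arrays. -/
theorem IExp.eval_congr {s s' : State} (h1 : s.ireg = s'.ireg) (h2 : s.iarr = s'.iarr) (k : IExp) :
    k.eval s = k.eval s' := by
  induction k with
  | const => rfl
  | reg x => simp only [IExp.eval, h1]
  | load a b ih => simp only [IExp.eval, ih, h2]
  | add a b iha ihb => simp only [IExp.eval, iha, ihb]
  | sub a b iha ihb => simp only [IExp.eval, iha, ihb]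

theorem runs_storeCrossing (s : State) {x : ℕ} (hx : x + 1 < 10) (k dst : IExp) :
    Runs (storeCrossing x k dst) s fun s' T =>
      Frame ∅ {10, 11, 12, 13} {4, 5} s s' ∧
      s'.pt 4 = Function.update (s.pt 4) (dst.eval s)
        (crossing (s.rpt 3) (s.rreg 5) (s.rpt x) (s.pt 4 (k.eval s))) ∧
      T = 4 * k.cost + 2 * dst.cost + 44 := by
  have n1 : x ≠ 10 := by omega
  have n2 : x ≠ 11 := by omega
  have n4 : x ≠ 9 := by omega
  have n5 : x + 1 ≠ 11 := by omega
  have n6 : x + 1 ≠ 12 := by omega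
  refine Runs.seq (Runs.rset (Runs.seq (Runs.rset (Runs.seq (Runs.rset (Runs.seq (Runs.rset
    (Runs.seq (Runs.rstore (Runs.rstore ⟨⟨fun _ _ => rfl, fun y hy => ?_, fun a ha => ?_⟩,
      ?_, ?_⟩))))))))))
  · simp only [Set.mem_insert_iff, Set.mem_singleton_iff, not_or] at hy
    simp [hy.1, hy.2.1, hy.2.2.1, hy.2.2.2]
  · simp only [Set.mem_insert_iff, Set.mem_singleton_iff, not_or] at ha
    simp [ha.1, ha.2]
  · have hk : ∀ (g : ℕ → ℝ) (r : ℕ → ℕ → ℝ) (j : IExp),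
        j.eval { s with rreg := g, rarr := r } = j.eval s := fun g r j =>
      IExp.eval_congr (s := { s with rreg := g, rarr := r }) (s' := s) rfl rfl j
    funext j
    by_cases hj : j = dst.eval s
    · subst hj
      rw [Function.update_self]
      apply plane_ext <;>
      simp [State.pt, State.rpt, RExp.eval, hk, crossing, sideCell, sideExp, side, crs,
        n1, n2, n4, n5, n6]
    · rw [Function.update_of_ne hj]
      simp [State.pt, hk, hj]
  · simp [RExp.cost, sideCell, sideExp]
    ring

set_option linter.unusedSimpArgs false

theorem runs_pushBack (s : State) : Runs pushBack s fun s' T =>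
    Frame {4} {10, 11, 12, 13} {4, 5} s s' ∧
    ((2 < s.ireg 5 ∧ 0 < s.side (s.ireg 4 - 1) ∧ s'.ireg 4 = s.ireg 4 + 1 ∧
        s'.pt 4 = Function.update (s.pt 4) (s.ireg 4)
          (crossing (s.rpt 3) (s.rreg 5) (s.rpt 8) (s.pt 4 (s.ireg 4 - 1)))) ∨
      ((2 < s.ireg 5 → s.side (s.ireg 4 - 1) ≤ 0) ∧ s'.ireg 4 = s.ireg 4 ∧ s'.pt 4 = s.pt 4)) ∧
    T ≤ 100 := by
  refine Runs.branch ?_ ?_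
  · rintro ⟨hb1, hb2⟩
    simp only [Test.Holds, IExp.eval] at hb1
    simp only [Test.Holds, sideCell_eval, IExp.eval, RExp.eval, Int.cast_zero] at hb2
    refine Runs.seq ((runs_storeCrossing s (by norm_num) _ _).mono ?_)
    rintro s1 T1 ⟨hF, hp, hT⟩
    have e4 : s1.ireg 4 = s.ireg 4 := hF.ireg 4 (by simp)
    refine Runs.iset ⟨?_, Or.inl ⟨hb1, hb2, ?_, ?_⟩, ?_⟩
    · refine (hF.trans (frame_iset s1 4 _)).mono ?_ ?_ ?_ <;> simp
    · simp [IExp.eval, e4]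
    · exact hp
    · simp [IExp.cost, Test.cost, RExp.cost, sideCell, sideExp] at hT ⊢
      omega
  · intro hb
    refine Runs.skip ⟨Frame.refl s, Or.inr ⟨fun h => ?_, rfl, rfl⟩, ?_⟩
    · by_contra! hc
      refine hb ⟨h, ?_⟩
      simp only [Test.Holds, sideCell_eval, IExp.eval, RExp.eval, Int.cast_zero]
      exact hc
    · simp [IExp.cost, Test.cost, RExp.cost, sideCell, sideExp]

theorem runs_pushFront (s : State) : Runs pushFront s fun s' T =>
    Frame {3} {10, 11, 12, 13} {4, 5} s s' ∧
    ((0 < s.side (s.ireg 3) ∧ s'.ireg 3 = s.ireg 3 - 1 ∧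
        s'.pt 4 = Function.update (s.pt 4) (s.ireg 3 - 1)
          (crossing (s.rpt 3) (s.rreg 5) (s.rpt 6) (s.pt 4 (s.ireg 3)))) ∨
      (s.side (s.ireg 3) ≤ 0 ∧ s'.ireg 3 = s.ireg 3 ∧ s'.pt 4 = s.pt 4)) ∧
    T ≤ 100 := by
  refine Runs.branch ?_ ?_
  · intro hb2
    simp only [Test.Holds, sideCell_eval, IExp.eval, RExp.eval, Int.cast_zero] at hb2
    refine Runs.seq ((runs_storeCrossing s (by norm_num) _ _).mono ?_)
    rintro s1 T1 ⟨hF, hp, hT⟩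
    have e4 : s1.ireg 3 = s.ireg 3 := hF.ireg 3 (by simp)
    refine Runs.iset ⟨?_, Or.inl ⟨hb2, ?_, ?_⟩, ?_⟩
    · refine (hF.trans (frame_iset s1 3 _)).mono ?_ ?_ ?_ <;> simp
    · simp [IExp.eval, e4]
    · exact hp
    · simp [IExp.cost, Test.cost, RExp.cost, sideCell, sideExp] at hT ⊢
      omega
  · intro hb
    refine Runs.skip ⟨Frame.refl s, Or.inr ⟨?_, rfl, rfl⟩, ?_⟩
    · by_contra! hc
      refine hb ?_
      simp only [Test.Holds, sideCell_eval, IExp.eval, RExp.eval, Int.cast_zero]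
      exact hc
    · simp [IExp.cost, Test.cost, RExp.cost, sideCell, sideExp]

-- Popping is paid by the credits; the constant `400` covers the remaining work and the credits of
-- the at most two new vertices. The outcomes are an empty queue, a cut of a polygon with at least
-- three vertices, and a cut of a segment.
set_option maxHeartbeats 1000000 in
theorem runs_cutBody {n : ℕ} {W : ℕ → Plane} (hW : ConvexCycle n W) {δ : ℝ} {i : ℕ} (hi : i < n)
    (s : State) (hI : CutInv n W δ i (s.pt 4) (s.ireg 3) (s.ireg 4)) (he : s.rpt 3 = edge W i)
    (hc : s.rreg 5 = shiftConst W δ i) (hlt : s.ireg 3 < s.ireg 4) (hneg : s.side (s.ireg 3) < 0) :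
    Runs cutBody s fun s' T => CutInv n W δ (i + 1) (s'.pt 4) (s'.ireg 3) (s'.ireg 4) ∧
      s'.ireg 3 ≤ s'.ireg 4 ∧
      Frame {3, 4, 5} {6, 7, 8, 9, 10, 11, 12, 13} {4, 5} s s' ∧
      T + 40 * (s'.ireg 4 - s'.ireg 3) ≤ 40 * (s.ireg 4 - s.ireg 3) + 400 := by
  have hside : ∀ k, s.side k = side (edge W i) (shiftConst W δ i) (s.pt 4 k) := fun k => by
    rw [State.side, he, hc]
  set V := s.pt 4 with hV
  set h := s.ireg 3 with hh
  set t := s.ireg 4 with ht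
  refine Runs.seq (Runs.iset ?_)
  set s0 : State := { s with ireg := Function.update s.ireg 5 (IExp.eval s (.sub (.reg 4) (.reg 3))) }
    with hs0
  have F0 : Frame {5} ∅ ∅ s s0 := frame_iset s 5 _
  have e50 : s0.ireg 5 = t - h := by simp [hs0, IExp.eval, hh, ht]
  refine Runs.seq ((runs_loadPoint s0 6 (.reg 3)).mono ?_)
  rintro s1 T1 ⟨hT1, F1, p1⟩
  refine Runs.seq ((runs_loadPoint s1 8 (.reg 3)).mono ?_)
  rintro s2 T2 ⟨hT2, F2, p2⟩
  refine Runs.seq (Runs.iset ?_)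
  set s3 : State := { s2 with ireg := Function.update s2.ireg 3 (IExp.eval s2 (.add (.reg 3) (.const 1))) }
    with hs3
  have F3' : Frame {3} ∅ ∅ s2 s3 := frame_iset s2 3 _
  have F3 : Frame {3, 5} {6, 7, 8, 9} ∅ s s3 := by
    refine (((F0.trans F1).trans F2).trans F3').mono ?_ ?_ ?_
    · intro x hx
      simp only [Set.mem_union, Set.mem_insert_iff, Set.mem_singleton_iff,
        Set.mem_empty_iff_false, or_false, false_or] at hx ⊢
      omega
    · intro x hx
      simp only [Set.mem_union, Set.mem_insert_iff, Set.mem_singleton_iff,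
        Set.mem_empty_iff_false, or_false, false_or] at hx ⊢
      omega
    · exact fun x hx => by simp at hx
  have e32 : s2.ireg 3 = h := by
    rw [F2.ireg 3 (by simp), F1.ireg 3 (by simp), F0.ireg 3 (by simp)]
  have e33 : s3.ireg 3 = h + 1 := by simp [hs3, IExp.eval, e32]
  have e43 : s3.ireg 4 = t := F3.ireg 4 (by simp)
  have e53 : s3.ireg 5 = t - h := by
    rw [F3'.ireg 5 (by simp), F2.ireg 5 (by simp), F1.ireg 5 (by simp), e50]
  have p6 : s3.rpt 6 = V h := by
    rw [F3'.rpt (by simp) (by simp), F2.rpt (by simp) (by simp), p1, IExp.eval,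
      F0.ireg 3 (by simp), F0.pt (by simp) (by simp)]
  have p8 : s3.rpt 8 = V h := by
    rw [F3'.rpt (by simp) (by simp), p2, IExp.eval, F1.ireg 3 (by simp), F0.ireg 3 (by simp),
      F1.pt (by simp) (by simp), F0.pt (by simp) (by simp)]
  have q3 : s3.pt 4 = V := F3.pt (by simp) (by simp)
  refine Runs.seq ((runs_popFront s3 (by omega) (by
    rw [p6, q3, e33, Nat.add_sub_cancel])).mono ?_)
  rintro s4 T4 ⟨F4, g1, g2, g3, g4, g5, hT4⟩
  rw [e33] at g1 g3 hT4
  rw [e43] at g2 g4 hT4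
  have side3 : ∀ k, s3.side k = side (edge W i) (shiftConst W δ i) (V k) := fun k => by
    rw [← hside k, F3.side (by simp) (by simp) (by simp) (by simp) (by simp)]
  have side4 : ∀ k, s4.side k = side (edge W i) (shiftConst W δ i) (V k) := fun k => by
    rw [← side3 k, F4.side (by simp) (by simp) (by simp) (by simp) (by simp)]
  have e44 : s4.ireg 4 = t := by rw [F4.ireg 4 (by simp), e43]
  have e54 : s4.ireg 5 = t - h := by rw [F4.ireg 5 (by simp), e53]
  have q4 : s4.pt 4 = V := by rw [F4.pt (by simp) (by simp), q3]
  have p84 : s4.rpt 8 = V h := by rw [F4.rpt (by simp) (by simp), p8]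
  simp only [side3] at g3 g4
  rw [q3] at g5
  refine Runs.seq ((runs_popBack s4 (b := V h) (by rw [e44, side4]; exact g4) p84).mono ?_)
  rintro s5 T5 ⟨F5, g6, g7, g8, g9, g10, hT5⟩
  rw [e44] at g6 g7 g8 g10 hT5
  simp only [side4] at g8 g9
  rw [q4] at g10
  have F5' : Frame {3, 4, 5} {6, 7, 8, 9} ∅ s s5 := by
    refine ((F3.trans F4).trans F5).mono ?_ ?_ ?_
    · intro x hx
      simp only [Set.mem_union, Set.mem_insert_iff, Set.mem_singleton_iff,
        Set.mem_empty_iff_false, or_false, false_or] at hx ⊢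
      omega
    · intro x hx
      simp only [Set.mem_union, Set.mem_insert_iff, Set.mem_singleton_iff,
        Set.mem_empty_iff_false, or_false, false_or] at hx ⊢
      omega
    · exact fun x hx => by simp at hx
  have e35 : s5.ireg 3 = s4.ireg 3 := F5.ireg 3 (by simp)
  have e55 : s5.ireg 5 = t - h := by rw [F5.ireg 5 (by simp), e54]
  have q5 : s5.pt 4 = V := by rw [F5.pt (by simp) (by simp), q4]
  have p65 : s5.rpt 6 = V (s4.ireg 3 - 1) := by rw [F5.rpt (by simp) (by simp), g5]
  have side5 : ∀ k, s5.side k = side (edge W i) (shiftConst W δ i) (V k) := fun k => by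
    rw [← side4 k, F5.side (by simp) (by simp) (by simp) (by simp) (by simp)]
  have r5 : s5.rpt 3 = edge W i := by rw [F5'.rpt (by simp) (by simp), he]
  have c5 : s5.rreg 5 = shiftConst W δ i := by rw [F5'.rreg 5 (by simp), hc]
  set f := s4.ireg 3 with hf
  set t2 := s5.ireg 4 with ht2
  have hhead : side (edge W i) (shiftConst W δ i) (V h) < 0 := by rw [← hside]; exact hneg
  have hfront_out : ∀ k, h ≤ k → k < f → side (edge W i) (shiftConst W δ i) (V k) < 0 := by
    intro k k1 k2
    rcases k1.eq_or_lt with rfl | k1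
    · exact hhead
    · exact g3 k k1 k2
  refine Runs.branch ?_ ?_
  · intro hb
    simp only [Test.Holds, IExp.eval, e35] at hb
    rw [← ht2] at hb
    refine Runs.seq ((runs_pushBack s5).mono ?_)
    rintro s6 T6 ⟨F6, hpb, hT6⟩
    have e36 : s6.ireg 3 = f := by rw [F6.ireg 3 (by simp), e35]
    have r6 : s6.rpt 3 = edge W i := by rw [F6.rpt (by simp) (by simp), r5]
    have c6 : s6.rreg 5 = shiftConst W δ i := by rw [F6.rreg 5 (by simp), c5]
    have p66 : s6.rpt 6 = V (f - 1) := by rw [F6.rpt (by simp) (by simp), p65]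
    rw [← ht2, e55, side5, r5, c5, q5, g10] at hpb
    have g9' := g9 hb
    have hs6 : s6.pt 4 f = V f := by
      rcases hpb with ⟨-, -, -, h4⟩ | ⟨-, -, h4⟩
      · rw [h4, Function.update_of_ne (by omega)]
      · rw [h4]
    refine (runs_pushFront s6).mono ?_
    rintro s7 T7 ⟨F7, hpf, hT7⟩
    have side6 : s6.side f = side (edge W i) (shiftConst W δ i) (V f) := by
      rw [State.side, r6, c6, hs6]
    rw [e36, side6, r6, c6, p66, hs6] at hpf
    have e47 : s7.ireg 4 = s6.ireg 4 := F7.ireg 4 (by simp)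
    have hfnn := g4 (by omega)
    have hF : Frame {3, 4, 5} {6, 7, 8, 9, 10, 11, 12, 13} {4, 5} s s7 := by
      refine ((F5'.trans F6).trans F7).mono ?_ ?_ ?_
      · intro x hx
        simp only [Set.mem_union, Set.mem_insert_iff, Set.mem_singleton_iff,
          Set.mem_empty_iff_false, or_false, false_or] at hx ⊢
        omega
      · intro x hx
        simp only [Set.mem_union, Set.mem_insert_iff, Set.mem_singleton_iff,
          Set.mem_empty_iff_false, or_false, false_or] at hx ⊢
        omega
      · intro x hx
        simp only [Set.mem_union, Set.mem_insert_iff, Set.mem_singleton_iff,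
          Set.mem_empty_iff_false, or_false, false_or] at hx ⊢
        omega
    refine ⟨?_, ?_, hF, ?_⟩
    · by_cases hm : h + 3 ≤ t
      · refine hI.cut hW hi hm (f := f) (l := t2 - 1) ⟨by omega, by omega, by omega, ?_, hfnn, g9',
          ?_, ?_, ?_⟩
        · intro k k1 k2 k3
          rcases k3 with k3 | k3
          · exact hfront_out k k1 k3
          · exact g8 k (by omega) k2
        · intro k k1 k2
          have h6 : s6.pt 4 k = V k := by
            rcases hpb with ⟨-, -, -, h4⟩ | ⟨-, -, h4⟩
            · rw [h4, Function.update_of_ne (by omega)]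
            · rw [h4]
          rcases hpf with ⟨-, -, h4⟩ | ⟨-, -, h4⟩
          · rw [h4, Function.update_of_ne (by omega), h6]
          · rw [h4, h6]
        · rcases hpf with ⟨h2, h3, h4⟩ | ⟨h2, h3, h4⟩
          · refine Or.inr ⟨by omega, h2, ?_⟩
            rw [h3, h4, Function.update_self]
          · exact Or.inl ⟨h3, le_antisymm h2 hfnn⟩
        · rw [e47]
          rcases hpb with ⟨h1, h2, h3, h4⟩ | ⟨h2, h3, h4⟩
          · refine Or.inr ⟨by omega, h2, ?_⟩
            have h5 : s7.pt 4 (t2 - 1 + 1) = s6.pt 4 (t2 - 1 + 1) := by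
              rcases hpf with ⟨-, -, h5⟩ | ⟨-, -, h5⟩
              · rw [h5, Function.update_of_ne (by omega)]
              · rw [h5]
            rw [h5, h4, show t2 - 1 + 1 = t2 by omega, Function.update_self]
            congr 1
            -- The far end of the last crossed edge is the vertex popped last at the back, or `V h`
            -- if none was.
            by_cases hl : t2 < t
            · rw [if_pos hl, nxt_of_lt (by omega), show t2 - 1 + 1 = t2 by omega]
            · rw [if_neg hl, nxt_last (by omega)]
          · exact Or.inl ⟨by omega, le_antisymm (h2 (by omega)) g9'⟩
      -- With two vertices, the head is gone and the other one is kept.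
      · have hf1 : f = h + 1 := by omega
        have ht3 : t = h + 2 := by omega
        have ht4 : t2 = h + 2 := by omega
        rcases hpb with ⟨h1, h2, h3, h4⟩ | ⟨-, h3, h4⟩
        · omega
        rw [e47, h3, ht4]
        rw [ht3] at hI
        rw [hf1] at hfnn hpf
        refine hI.cut_segment hW hi hhead hfnn ?_ ?_
        · rcases hpf with ⟨-, -, h5⟩ | ⟨-, -, h5⟩
          · rw [h5, Function.update_of_ne (by omega), h4]
          · rw [h5, h4]
        · rcases hpf with ⟨h5, h6, h7⟩ | ⟨h5, h6, h7⟩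
          · refine Or.inr ⟨by omega, h5, ?_⟩
            rw [h7, Nat.add_sub_cancel, Function.update_self]
          · exact Or.inl ⟨h6, le_antisymm h5 hfnn⟩
    · rw [e47]
      rcases hpb with ⟨-, -, h3, -⟩ | ⟨-, h3, -⟩ <;>
      rcases hpf with ⟨-, h6, -⟩ | ⟨-, h6, -⟩ <;> omega
    · have hd : s7.ireg 4 - s7.ireg 3 ≤ t2 - f + 2 := by
        rw [e47]
        rcases hpb with ⟨-, -, h3, -⟩ | ⟨-, h3, -⟩ <;>
        rcases hpf with ⟨-, h6, -⟩ | ⟨-, h6, -⟩ <;> omega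
      simp only [IExp.cost, Test.cost] at hT1 hT2 ⊢
      omega
  · intro hb
    simp only [Test.Holds, IExp.eval, e35] at hb
    rw [← ht2] at hb
    have hft : f = t := by
      by_contra hne
      exact hb (by omega)
    refine Runs.skip ⟨?_, ?_, F5'.mono subset_rfl
      (fun x hx => by
        simp only [Set.mem_insert_iff, Set.mem_singleton_iff] at hx ⊢
        omega) (by simp), ?_⟩
    · exact hI.empty (fun k k1 k2 => hfront_out k k1 (by omega)) (by omega)
    · omega
    · simp only [IExp.cost, Test.cost] at hT1 hT2 ⊢
      omega

/-- Copy the points in cells `h, h + 1, …` of arrays `src`, `src + 1`, as many as the integer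
register `cnt` says, to cells `0, 1, …` of arrays `dst`, `dst + 1`; here `h` is held in register
`3`. -/
def copyPoints (src dst cnt : ℕ) : Program :=
  .seq (.iset 2 (.const 0))
  (.loop (.ilt (.reg 2) (.reg cnt))
    (.seq (.rstore dst (.reg 2) (.load src (.add (.reg 3) (.reg 2))))
    (.seq (.rstore (dst + 1) (.reg 2) (.load (src + 1) (.add (.reg 3) (.reg 2))))
      (.iset 2 (.add (.reg 2) (.const 1))))))

theorem runs_copyPoints (s : State) {src dst cnt : ℕ} (hc : cnt ≠ 2)
    (hsd : src + 1 < dst ∨ dst + 1 < src) : Runs (copyPoints src dst cnt) s fun s' T =>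
      Frame {2} ∅ {dst, dst + 1} s s' ∧
      (∀ k < s.ireg cnt, s'.pt dst k = s.pt src (s.ireg 3 + k)) ∧
      T ≤ 30 * s.ireg cnt + 30 := by
  refine Runs.seq (Runs.iset ?_)
  set s0 : State := { s with ireg := Function.update s.ireg 2 (IExp.eval s (.const 0)) } with hs0
  have F0 : Frame {2} ∅ ∅ s s0 := frame_iset s 2 _
  have e20 : s0.ireg 2 = 0 := by simp [hs0, IExp.eval]
  refine (Runs.loop (fun s' => Frame {2} ∅ {dst, dst + 1} s s' ∧ s'.ireg 2 ≤ s.ireg cnt ∧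
    ∀ k < s'.ireg 2, s'.pt dst k = s.pt src (s.ireg 3 + k))
    (fun s' => 22 * (s.ireg cnt - s'.ireg 2))
    ⟨F0.mono subset_rfl subset_rfl (Set.empty_subset _), by omega, by omega⟩ ?_).mono ?_
  · rintro s1 ⟨hF, h1, h2⟩ hb
    have e3 : s1.ireg 3 = s.ireg 3 := hF.ireg 3 (by simp)
    have ec : s1.ireg cnt = s.ireg cnt := hF.ireg cnt (by simpa using hc)
    have a1 : s1.rarr src = s.rarr src := hF.rarr src (by simp; omega)
    have a2 : s1.rarr (src + 1) = s.rarr (src + 1) := hF.rarr (src + 1) (by simp; omega)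
    simp only [Test.Holds, IExp.eval] at hb
    have n1 : src + 1 ≠ dst := by omega
    refine Runs.seq (Runs.rstore (Runs.seq (Runs.rstore (Runs.iset ⟨⟨⟨?_, ?_, ?_⟩, ?_, ?_⟩, ?_⟩))))
    · intro x hx
      simp only [Set.mem_singleton_iff] at hx
      simp only [Function.update_of_ne hx]
      exact hF.ireg x (by simpa using hx)
    · intro x hx
      exact hF.rreg x (by simp)
    · intro a ha
      have ha' := ha
      simp only [Set.mem_insert_iff, Set.mem_singleton_iff, not_or] at ha'
      simp only [Function.update_of_ne ha'.1, Function.update_of_ne ha'.2]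
      exact hF.rarr a ha
    · simp [IExp.eval]; omega
    · intro k hk
      simp only [IExp.eval, Function.update_self] at hk
      by_cases hkl : k = s1.ireg 2
      · subst hkl
        simp [State.pt, IExp.eval, RExp.eval, n1, a1, a2, e3]
      · have := h2 k (by omega)
        simp only [State.pt] at this ⊢
        rw [← this]
        simp [IExp.eval, hkl]
    · simp [IExp.eval, IExp.cost, RExp.cost, Test.cost]
      omega
  · rintro s' T ⟨⟨hF, h1, h2⟩, hb, hT⟩
    have ec : s'.ireg cnt = s.ireg cnt := hF.ireg cnt (by simpa using hc)
    simp only [Test.Holds, IExp.eval] at hb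
    refine ⟨hF, fun k hk => h2 k (by omega), ?_⟩
    simp only [IExp.cost, Test.cost] at hT ⊢
    omega

/-! ### The input layout and the loop over all cuts -/

/-- The part of the memory that holds the input, with the first two vertices repeated after the
last one, and the distance `r - ε` in real register `2`. -/
structure HoldsInput (n : ℕ) (W : ℕ → Plane) (r ε : ℝ) (s : State) : Prop where
  size : s.ireg 0 = n
  radius : s.rreg 0 = r
  eps : s.rreg 1 = ε
  diff : s.rreg 2 = r - ε
  vertex : ∀ k < n + 2, s.pt 0 k = W k

theorem HoldsInput.frame {n : ℕ} {W : ℕ → Plane} {r ε : ℝ} {s s' : State} {I R A : Set ℕ}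
    (h : HoldsInput n W r ε s) (hF : Frame I R A s s') (hI : 0 ∉ I) (h0 : 0 ∉ R) (h1 : 1 ∉ R)
    (h2 : 2 ∉ R) (hA : 0 ∉ A) (hA' : 1 ∉ A) : HoldsInput n W r ε s' where
  size := by rw [hF.ireg 0 hI, h.size]
  radius := by rw [hF.rreg 0 h0, h.radius]
  eps := by rw [hF.rreg 1 h1, h.eps]
  diff := by rw [hF.rreg 2 h2, h.diff]
  vertex k hk := by rw [hF.pt hA hA', h.vertex k hk]

/-- Load the vector from the point in cell `k` to the point in the next cell of arrays `0`, `1`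
into registers `3`, `4`. -/
def loadEdge (k : IExp) : Program :=
  .seq (.rset 3 (.sub (.load 0 (.add k (.const 1))) (.load 0 k)))
    (.rset 4 (.sub (.load 1 (.add k (.const 1))) (.load 1 k)))

theorem runs_loadEdge (s : State) (k : IExp) : Runs (loadEdge k) s fun s' T =>
    Frame ∅ {3, 4} ∅ s s' ∧ s'.rpt 3 = s.pt 0 (k.eval s + 1) - s.pt 0 (k.eval s) ∧
    T = 4 * k.cost + 12 := by
  have hk' : ∀ (g : ℕ → ℝ) (j : IExp), j.eval { s with rreg := g } = j.eval s :=
    fun g j => IExp.eval_congr (s := { s with rreg := g }) (s' := s) rfl rfl j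
  refine Runs.seq (Runs.rset (Runs.rset ⟨⟨fun _ _ => rfl, fun y hy => ?_, fun _ _ => rfl⟩, ?_, ?_⟩))
  · simp only [Set.mem_insert_iff, Set.mem_singleton_iff, not_or] at hy
    simp [hy.1, hy.2]
  · apply plane_ext <;> simp [State.rpt, State.pt, RExp.eval, IExp.eval, hk']
  · simp [RExp.cost, IExp.cost]
    ring

/-- Load the constant of the shifted line of the current edge into register `5`. -/
def loadConst (k : IExp) : Program :=
  .rset 5 (.add (.sub (.mul (.reg 3) (.load 1 k)) (.mul (.reg 4) (.load 0 k)))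
    (.mul (.reg 2) (.sqrt (.add (.mul (.reg 3) (.reg 3)) (.mul (.reg 4) (.reg 4))))))

theorem runs_loadConst (s : State) (k : IExp) : Runs (loadConst k) s fun s' T =>
    Frame ∅ {5} ∅ s s' ∧
    s'.rreg 5 = crs (s.rpt 3) (s.pt 0 (k.eval s)) + s.rreg 2 * ‖s.rpt 3‖ ∧
    T = 2 * k.cost + 19 := by
  refine Runs.rset ⟨⟨fun _ _ => rfl, fun y hy => ?_, fun _ _ => rfl⟩, ?_, ?_⟩
  · simp only [Set.mem_singleton_iff] at hy
    simp [hy]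
  · simp [RExp.eval, crs, norm_plane, State.rpt, State.pt]
  · simp [RExp.cost]
    ring

/-- Cut along the shifted edge whose number is in integer register `2`. -/
def cutStep : Program :=
  .seq (loadEdge (.reg 2))
  (.seq (loadConst (.reg 2))
  (.seq (.branch (.and (.ilt (.reg 3) (.reg 4)) (.rlt (sideCell (.reg 3)) (.const 0)))
    cutBody .skip)
    (.iset 2 (.add (.reg 2) (.const 1)))))

theorem runs_cutStep {n : ℕ} {W : ℕ → Plane} (hW : ConvexCycle n W) {r ε : ℝ} (h : ε < r)
    (s : State) (hs : HoldsInput n W r ε s) (hi : s.ireg 2 < n) (hle : s.ireg 3 ≤ s.ireg 4)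
    (hI : CutInv n W (r - ε) (s.ireg 2) (s.pt 4) (s.ireg 3) (s.ireg 4)) :
    Runs cutStep s fun s' T => HoldsInput n W r ε s' ∧ s'.ireg 2 = s.ireg 2 + 1 ∧
      s'.ireg 3 ≤ s'.ireg 4 ∧ CutInv n W (r - ε) (s'.ireg 2) (s'.pt 4) (s'.ireg 3) (s'.ireg 4) ∧
      T + 40 * (s'.ireg 4 - s'.ireg 3) ≤ 40 * (s.ireg 4 - s.ireg 3) + 500 := by
  refine Runs.seq ((runs_loadEdge s (.reg 2)).mono ?_)
  rintro s1 T1 ⟨F1, p1, hT1⟩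
  refine Runs.seq ((runs_loadConst s1 (.reg 2)).mono ?_)
  rintro s2 T2 ⟨F2, p2, hT2⟩
  have F : Frame ∅ {3, 4, 5} ∅ s s2 := by
    refine (F1.trans F2).mono ?_ ?_ ?_ <;> (intro x; simp; try omega)
  have hs2 : HoldsInput n W r ε s2 := hs.frame F (by simp) (by simp) (by simp) (by simp)
    (by simp) (by simp)
  have e2 : s2.ireg 2 = s.ireg 2 := F.ireg 2 (by simp)
  have e3 : s2.ireg 3 = s.ireg 3 := F.ireg 3 (by simp)
  have e4 : s2.ireg 4 = s.ireg 4 := F.ireg 4 (by simp)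
  have q4 : s2.pt 4 = s.pt 4 := F.pt (by simp) (by simp)
  simp only [IExp.eval] at p1 p2
  rw [hs.vertex _ (by omega), hs.vertex _ (by omega)] at p1
  have he1 : s1.rpt 3 = edge W (s.ireg 2) := p1
  have he : s2.rpt 3 = edge W (s.ireg 2) := by rw [F2.rpt (by simp) (by simp), he1]
  have hc : s2.rreg 5 = shiftConst W (r - ε) (s.ireg 2) := by
    rw [p2, he1, F1.rreg 2 (by simp), hs.diff, F1.ireg 2 (by simp), F1.pt (by simp) (by simp),
      hs.vertex _ (by omega), shiftConst]
  refine Runs.seq (Runs.branch ?_ ?_)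
  · rintro ⟨hb1, hb2⟩
    simp only [Test.Holds, IExp.eval] at hb1
    simp only [Test.Holds, sideCell_eval, IExp.eval, RExp.eval, Int.cast_zero] at hb2
    refine (runs_cutBody hW (i := s.ireg 2) hi s2 (by rw [q4, e3, e4]; exact hI) he hc hb1
      hb2).mono ?_
    rintro s3 T3 ⟨hI3, hle3, F3, hT3⟩
    have F4 := frame_iset s3 2 (IExp.eval s3 (.add (.reg 2) (.const 1)))
    have e23 : s3.ireg 2 = s.ireg 2 := by rw [F3.ireg 2 (by simp), e2]
    refine Runs.iset ⟨?_, ?_, ?_, ?_, ?_⟩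
    · exact (hs2.frame F3 (by simp) (by simp) (by simp) (by simp) (by simp) (by simp)).frame F4
        (by simp) (by simp) (by simp) (by simp) (by simp) (by simp)
    · simp [IExp.eval, e23]
    · simpa using hle3
    · rw [F4.pt (by simp) (by simp), F4.ireg 3 (by simp), F4.ireg 4 (by simp)]
      simp only [IExp.eval, Function.update_self, e23]
      exact hI3
    · rw [F4.ireg 3 (by simp), F4.ireg 4 (by simp)]
      simp [IExp.cost, RExp.cost, Test.cost, sideCell, sideExp] at hT1 hT2 hT3 ⊢
      omega
  · intro hb
    have F4 := frame_iset s2 2 (IExp.eval s2 (.add (.reg 2) (.const 1)))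
    refine Runs.skip (Runs.iset ⟨?_, ?_, ?_, ?_, ?_⟩)
    · exact hs2.frame F4 (by simp) (by simp) (by simp) (by simp) (by simp) (by simp)
    · simp [IExp.eval, e2]
    · simp [e3, e4, hle]
    · rw [F4.pt (by simp) (by simp), F4.ireg 3 (by simp), F4.ireg 4 (by simp), q4, e3, e4]
      simp only [IExp.eval, Function.update_self, e2]
      by_cases hlt : s.ireg 3 < s.ireg 4
      · refine hI.keep hW (by linarith) hi hlt ?_
        by_contra! hneg
        refine hb ⟨?_, ?_⟩
        · simp only [Test.Holds, IExp.eval, e3, e4]; exact hlt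
        · simp only [Test.Holds, sideCell_eval, IExp.eval, RExp.eval, Int.cast_zero]
          rw [he, hc, q4, e3]; exact hneg
      · exact hI.empty (fun k k1 k2 => by omega) (by omega)
    · rw [F4.ireg 3 (by simp), F4.ireg 4 (by simp), e3, e4]
      simp [IExp.cost, RExp.cost, Test.cost, sideCell, sideExp] at hT1 hT2 ⊢
      omega

def cutLoop : Program := .loop (.ilt (.reg 2) (.reg 0)) cutStep

/-- The potential is `40` per stored vertex and `510` per remaining edge. Its unspent part also
yields the crude size bound `15 * n`, which later bounds the cost of copying the result. -/
theorem runs_cutLoop {n : ℕ} {W : ℕ → Plane} (hW : ConvexCycle n W) {r ε : ℝ} (h : ε < r)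
    (s : State) (hs : HoldsInput n W r ε s) (h2 : s.ireg 2 = 0) (h3 : s.ireg 3 = 0)
    (h4 : s.ireg 4 = n) (hI : CutInv n W (r - ε) 0 (s.pt 4) 0 n) :
    Runs cutLoop s fun s' T => HoldsInput n W r ε s' ∧ s'.ireg 3 ≤ s'.ireg 4 ∧
      s'.ireg 4 - s'.ireg 3 ≤ 15 * n ∧
      CutInv n W (r - ε) n (s'.pt 4) (s'.ireg 3) (s'.ireg 4) ∧ T ≤ 550 * n + 10 := by
  refine (Runs.loop (fun s' => HoldsInput n W r ε s' ∧ s'.ireg 2 ≤ n ∧ s'.ireg 3 ≤ s'.ireg 4 ∧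
    CutInv n W (r - ε) (s'.ireg 2) (s'.pt 4) (s'.ireg 3) (s'.ireg 4))
    (fun s' => 40 * (s'.ireg 4 - s'.ireg 3) + 510 * (n - s'.ireg 2))
    ⟨hs, by omega, by omega, by rw [h2, h3, h4]; exact hI⟩ ?_).mono ?_
  · rintro s1 ⟨g1, g2, g3, g4⟩ hb
    simp only [Test.Holds, IExp.eval, g1.size] at hb
    refine (runs_cutStep hW h s1 g1 hb g3 g4).mono ?_
    rintro s2 T ⟨k1, k2, k3, k4, k5⟩
    refine ⟨⟨k1, by omega, k3, k4⟩, ?_⟩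
    simp only [IExp.cost, Test.cost]
    omega
  · rintro s1 T ⟨⟨g1, g2, g3, g4⟩, hb, hT⟩
    simp only [Test.Holds, IExp.eval, g1.size] at hb
    have : s1.ireg 2 = n := by omega
    simp only [IExp.cost, Test.cost] at hT
    refine ⟨g1, g3, ?_, by rw [← this] at g4 ⊢; exact g4, ?_⟩
    · omega
    · omega

/-! ### The pointer walk and the distance tests -/

/-- Advance the pointer in integer register `6`, which runs cyclically through the points in arrays
`2`, `3`, if the next point lies to the right of the current edge direction. -/
def advancePointer : Program :=
  .branch (.rlt
      (.sub
        (.mul (.reg 3) (.sub (.load 3 (.add (.reg 6) (.const 1))) (.load 3 (.reg 6))))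
        (.mul (.reg 4) (.sub (.load 2 (.add (.reg 6) (.const 1))) (.load 2 (.reg 6)))))
      (.const 0))
    (.seq (.iset 6 (.add (.reg 6) (.const 1)))
      (.branch (.ieq (.reg 6) (.reg 1)) (.iset 6 (.const 0)) .skip))
    .skip

theorem runs_advancePointer (s : State) : Runs advancePointer s fun s' T =>
    Frame {6} ∅ ∅ s s' ∧
    (crs (s.rpt 3) (s.pt 2 (s.ireg 6 + 1) - s.pt 2 (s.ireg 6)) < 0 →
      s'.ireg 6 = if s.ireg 6 + 1 = s.ireg 1 then 0 else s.ireg 6 + 1) ∧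
    (¬ crs (s.rpt 3) (s.pt 2 (s.ireg 6 + 1) - s.pt 2 (s.ireg 6)) < 0 → s'.ireg 6 = s.ireg 6) ∧
    T ≤ 40 := by
  have hcond : ∀ x : Plane, crs (s.rpt 3) x = s.rreg 3 * x 1 - s.rreg 4 * x 0 := fun x => by
    simp [crs, State.rpt]
  rw [hcond]
  refine Runs.branch (fun hb => Runs.seq (Runs.iset (Runs.branch (fun hb' => Runs.iset ?_)
    (fun hb' => Runs.skip ?_)))) (fun hb => Runs.skip ?_)
  · simp only [Test.Holds, RExp.eval, IExp.eval, Int.cast_zero] at hb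
    simp [Test.Holds, IExp.eval] at hb'
    refine ⟨⟨fun x hx => ?_, fun _ _ => rfl, fun _ _ => rfl⟩, fun _ => ?_, fun h => absurd ?_ h, ?_⟩
    · simp only [Set.mem_singleton_iff] at hx
      simp [hx]
    · simp [IExp.eval, hb']
    · simpa [State.pt] using hb
    · simp [Test.cost, IExp.cost, RExp.cost]
  · simp only [Test.Holds, RExp.eval, IExp.eval, Int.cast_zero] at hb
    simp [Test.Holds, IExp.eval] at hb'
    refine ⟨⟨fun x hx => ?_, fun _ _ => rfl, fun _ _ => rfl⟩, fun _ => ?_, fun h => absurd ?_ h, ?_⟩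
    · simp only [Set.mem_singleton_iff] at hx
      simp [hx]
    · simp [IExp.eval, hb']
    · simpa [State.pt] using hb
    · simp [Test.cost, IExp.cost, RExp.cost]
  · simp only [Test.Holds, RExp.eval, IExp.eval, Int.cast_zero] at hb
    refine ⟨Frame.refl s, fun h => absurd ?_ hb, fun _ => rfl, ?_⟩
    · simpa [State.pt] using h
    · simp [Test.cost, IExp.cost, RExp.cost]

/-- Set integer register `7` to zero if the point at the pointer is farther than `r + ε` from the
vertex in cell `k` of arrays `0`, `1`. -/
def checkDist (k : IExp) : Program :=
  .seq (.rset 5 (.sub (.load 2 (.reg 6)) (.load 0 k)))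
  (.seq (.rset 6 (.sub (.load 3 (.reg 6)) (.load 1 k)))
  (.branch (.rlt (.add (.reg 0) (.reg 1))
      (.sqrt (.add (.mul (.reg 5) (.reg 5)) (.mul (.reg 6) (.reg 6)))))
    (.iset 7 (.const 0)) .skip))

theorem runs_checkDist (s : State) (k : IExp) : Runs (checkDist k) s fun s' T =>
    Frame {7} {5, 6} ∅ s s' ∧
    (‖s.pt 2 (s.ireg 6) - s.pt 0 (k.eval s)‖ ≤ s.rreg 0 + s.rreg 1 → s'.ireg 7 = s.ireg 7) ∧
    (¬ ‖s.pt 2 (s.ireg 6) - s.pt 0 (k.eval s)‖ ≤ s.rreg 0 + s.rreg 1 → s'.ireg 7 = 0) ∧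
    T ≤ 2 * k.cost + 40 := by
  have hk' : ∀ (g : ℕ → ℝ) (j : IExp), j.eval { s with rreg := g } = j.eval s :=
    fun g j => IExp.eval_congr (s := { s with rreg := g }) (s' := s) rfl rfl j
  rw [norm_plane]
  refine Runs.seq (Runs.rset (Runs.seq (Runs.rset (Runs.branch (fun hb => Runs.iset ?_)
    (fun hb => Runs.skip ?_)))))
  · simp [Test.Holds, RExp.eval, IExp.eval, hk'] at hb
    refine ⟨⟨fun x hx => ?_, fun x hx => ?_, fun _ _ => rfl⟩, fun h => absurd ?_ hb.not_ge,
      fun _ => ?_, ?_⟩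
    · simp only [Set.mem_singleton_iff] at hx
      simp [hx]
    · simp only [Set.mem_insert_iff, Set.mem_singleton_iff, not_or] at hx
      simp [hx.1, hx.2]
    · simpa [State.pt] using h
    · simp [IExp.eval]
    · simp [Test.cost, IExp.cost, RExp.cost]; omega
  · simp [Test.Holds, RExp.eval, IExp.eval, hk'] at hb
    refine ⟨⟨fun x hx => rfl, fun x hx => ?_, fun _ _ => rfl⟩, fun h => rfl,
      fun h => absurd ?_ h, ?_⟩
    · simp only [Set.mem_insert_iff, Set.mem_singleton_iff, not_or] at hx
      simp [hx.1, hx.2]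
    · simpa [State.pt] using hb
    · simp [Test.cost, IExp.cost, RExp.cost]; omega

/-- Check the vertex after the one whose number is in integer register `2`. -/
def checkStep : Program :=
  .seq (loadEdge (.add (.reg 2) (.const 1)))
  (.seq advancePointer
  (.seq (checkDist (.add (.reg 2) (.const 1)))
    (.iset 2 (.add (.reg 2) (.const 1)))))

def checkLoop : Program := .loop (.ilt (.reg 2) (.reg 0)) checkStep

/-- Cells `0, …, m` of arrays `2`, `3` hold the points `V h, …, V (t - 1), V h`, where `m` is held
in integer register `1`. -/
structure HoldsCycle (V : ℕ → Plane) (h t : ℕ) (s : State) : Prop where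
  size : h + s.ireg 1 = t
  vertex : ∀ k < s.ireg 1, s.pt 2 k = V (h + k)
  last : s.pt 2 (s.ireg 1) = V h

theorem HoldsCycle.frame {V : ℕ → Plane} {h t : ℕ} {s s' : State} {I R A : Set ℕ}
    (hs : HoldsCycle V h t s) (hF : Frame I R A s s') (hI : 1 ∉ I) (hA : 2 ∉ A) (hA' : 3 ∉ A) :
    HoldsCycle V h t s' where
  size := by rw [hF.ireg 1 hI, hs.size]
  vertex k hk := by
    rw [hF.ireg 1 hI] at hk
    rw [hF.pt hA hA', hs.vertex k hk]
  last := by rw [hF.ireg 1 hI, hF.pt hA hA', hs.last]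

/-- The pointer enters at a minimiser for edge `i` and is moved to a minimiser for edges `i` and `i
+ 1`. By `meets_iff` this point decides the vertex between them, and it is a valid start for the
next step. -/
theorem runs_checkStep {n : ℕ} {W V : ℕ → Plane} (hW : ConvexCycle n W) {r ε : ℝ} (hεr : ε < r)
    {h t : ℕ} (hI : CutInv n W (r - ε) n V h t) (s : State) (hs : HoldsInput n W r ε s)
    (hc : HoldsCycle V h t s) (hi : s.ireg 2 < n) (hp : s.ireg 6 < s.ireg 1)
    (hm : ∀ k, h ≤ k → k < t → 0 ≤ crs (edge W (s.ireg 2)) (V k - V (h + s.ireg 6))) :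
    Runs checkStep s fun s' T => Frame {2, 6, 7} {3, 4, 5, 6} ∅ s s' ∧
      s'.ireg 2 = s.ireg 2 + 1 ∧ s'.ireg 6 < s.ireg 1 ∧
      (∀ k, h ≤ k → k < t → 0 ≤ crs (edge W (s'.ireg 2)) (V k - V (h + s'.ireg 6))) ∧
      ((Metric.closedBall (W (s.ireg 2 + 1)) (r + ε) ∩ cutRegion n W (r - ε) n).Nonempty →
        s'.ireg 7 = s.ireg 7) ∧
      (¬ (Metric.closedBall (W (s.ireg 2 + 1)) (r + ε) ∩ cutRegion n W (r - ε) n).Nonempty →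
        s'.ireg 7 = 0) ∧ T ≤ 150 := by
  refine Runs.seq ((runs_loadEdge s _).mono ?_)
  rintro s1 T1 ⟨F1, p1, hT1⟩
  simp only [IExp.eval] at p1
  -- Edge `i + 1` ends in cell `i + 2 ≤ n + 1`; this is why two vertices are repeated.
  rw [hs.vertex _ (by omega), hs.vertex _ (by omega)] at p1
  have p1 : s1.rpt 3 = edge W (s.ireg 2 + 1) := p1
  have hc1 : HoldsCycle V h t s1 := hc.frame F1 (by simp) (by simp) (by simp)
  refine Runs.seq ((runs_advancePointer s1).mono ?_)
  rintro s2 T2 ⟨F2, a1, a2, hT2⟩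
  have e6 : s1.ireg 6 = s.ireg 6 := F1.ireg 6 (by simp)
  have e1 : s1.ireg 1 = s.ireg 1 := F1.ireg 1 (by simp)
  have hsize := hc.size
  have hq0 : s1.pt 2 (s.ireg 6) = V (h + s.ireg 6) := hc1.vertex _ (by omega)
  have hq1 : s1.pt 2 (s.ireg 6 + 1) = V (nxt h t (h + s.ireg 6)) := by
    by_cases hl : s.ireg 6 + 1 = s.ireg 1
    · rw [nxt_last (by omega), ← hc1.last, e1, hl]
    · rw [nxt_of_lt (by omega), hc1.vertex _ (by omega)]; rfl
  rw [p1, e6, hq0, hq1, e1] at a1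
  rw [p1, e6, hq0, hq1] at a2
  have hadv : s2.ireg 6 < s.ireg 1 ∧ ∀ k, h ≤ k → k < t →
      0 ≤ crs (edge W (s.ireg 2)) (V k - V (h + s2.ireg 6)) ∧
      0 ≤ crs (edge W (s.ireg 2 + 1)) (V k - V (h + s2.ireg 6)) := by
    by_cases hneg : crs (edge W (s.ireg 2 + 1)) (V (nxt h t (h + s.ireg 6)) - V (h + s.ireg 6)) < 0
    · have h6 := a1 hneg
      have : h + s2.ireg 6 = nxt h t (h + s.ireg 6) := by
        rw [h6]
        by_cases hl : s.ireg 6 + 1 = s.ireg 1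
        · rw [if_pos hl, nxt_last (by omega), add_zero]
        · rw [if_neg hl, nxt_of_lt (by omega)]; omega
      rw [this]
      refine ⟨?_, hI.advance hW hi (by omega) (by omega) hm hneg⟩
      rw [h6]; split_ifs <;> omega
    · rw [a2 hneg]
      exact ⟨hp, hI.stay hW (by omega) (by omega) hm hneg⟩
  obtain ⟨hlt, hmin⟩ := hadv
  refine Runs.seq ((runs_checkDist s2 _).mono ?_)
  rintro s3 T3 ⟨F3, b1, b2, hT3⟩
  have F12 := F1.trans F2
  have hs2 : HoldsInput n W r ε s2 := hs.frame F12 (by simp) (by simp) (by simp) (by simp)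
    (by simp) (by simp)
  have hc2 : HoldsCycle V h t s2 := hc.frame F12 (by simp) (by simp) (by simp)
  have e22 : s2.ireg 2 = s.ireg 2 := F12.ireg 2 (by simp)
  have e21 : s2.ireg 1 = s.ireg 1 := F12.ireg 1 (by simp)
  have e27 : s2.ireg 7 = s.ireg 7 := F12.ireg 7 (by simp)
  simp only [IExp.eval] at b1 b2
  rw [hs2.radius, hs2.eps, hc2.vertex _ (by omega), e22, hs2.vertex _ (by omega)] at b1 b2
  have hmem : V (h + s2.ireg 6) ∈ cutRegion n W (r - ε) n := by
    rw [← hI.hull]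
    exact subset_convexHull ℝ _ (Set.mem_image_of_mem V ⟨by omega, by omega⟩)
  have hreg : ∀ e : Plane, (∀ k, h ≤ k → k < t → 0 ≤ crs e (V k - V (h + s2.ireg 6))) →
      ∀ x ∈ cutRegion n W (r - ε) n, 0 ≤ crs e (x - V (h + s2.ireg 6)) := by
    intro e he x hx
    rw [← hI.hull] at hx
    refine convexHull_min ?_ (convex_left_halfplane e (V (h + s2.ireg 6)) 0) hx
    rintro _ ⟨k, hk, rfl⟩
    exact he k hk.1 hk.2
  have hmeet := meets_iff hW (sub_pos.2 hεr) hi hmem (hreg _ fun k k1 k2 => (hmin k k1 k2).1)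
    (hreg _ fun k k1 k2 => (hmin k k1 k2).2) (r + ε)
  have F4 := frame_iset s3 2 (IExp.eval s3 (.add (.reg 2) (.const 1)))
  have e32 : s3.ireg 2 = s.ireg 2 := by rw [F3.ireg 2 (by simp), e22]
  have e36 : s3.ireg 6 = s2.ireg 6 := F3.ireg 6 (by simp)
  refine Runs.iset ⟨?_, ?_, ?_, ?_, ?_, ?_, ?_⟩
  · refine ((F12.trans F3).trans F4).mono ?_ ?_ ?_ <;> intro x hx <;>
    simp only [Set.mem_union, Set.mem_insert_iff, Set.mem_singleton_iff,
      Set.mem_empty_iff_false, or_false, false_or] at hx ⊢ <;> omega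
  · simp [IExp.eval, e32]
  · simp [e36, hlt]
  · simp only [IExp.eval, Function.update_self, e32]
    rw [Function.update_of_ne (by omega), e36]
    exact fun k k1 k2 => (hmin k k1 k2).2
  · intro hne
    rw [F4.ireg 7 (by simp), b1 (hmeet.1 hne), e27]
  · intro hne
    rw [F4.ireg 7 (by simp), b2 (fun hd => hne (hmeet.2 hd))]
  · simp only [IExp.cost] at hT1 hT3 ⊢
    omega

theorem runs_checkLoop {n : ℕ} {W V : ℕ → Plane} (hW : ConvexCycle n W) {r ε : ℝ} (hεr : ε < r)
    {h t : ℕ} (hI : CutInv n W (r - ε) n V h t) (s : State) (hs : HoldsInput n W r ε s)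
    (hc : HoldsCycle V h t s) (h2 : s.ireg 2 = 0) (h6 : s.ireg 6 = 0) (h7 : s.ireg 7 = 1)
    (h1 : 0 < s.ireg 1) :
    Runs checkLoop s fun s' T => Frame {2, 6, 7} {3, 4, 5, 6} ∅ s s' ∧
      ((∀ j < n, (Metric.closedBall (W (j + 1)) (r + ε) ∩ cutRegion n W (r - ε) n).Nonempty) →
        s'.ireg 7 = 1) ∧
      ((¬ ∀ j < n, (Metric.closedBall (W (j + 1)) (r + ε) ∩ cutRegion n W (r - ε) n).Nonempty) →
        s'.ireg 7 = 0) ∧ T ≤ 160 * n + 10 := by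
  set M : ℕ → Prop := fun j =>
    (Metric.closedBall (W (j + 1)) (r + ε) ∩ cutRegion n W (r - ε) n).Nonempty with hM
  have hn := hW.three_le
  refine (Runs.loop (fun s' => Frame {2, 6, 7} {3, 4, 5, 6} ∅ s s' ∧ s'.ireg 2 ≤ n ∧
    s'.ireg 6 < s.ireg 1 ∧
    (∀ k, h ≤ k → k < t → 0 ≤ crs (edge W (s'.ireg 2)) (V k - V (h + s'.ireg 6))) ∧
    ((∀ j < s'.ireg 2, M j) → s'.ireg 7 = 1) ∧ ((¬ ∀ j < s'.ireg 2, M j) → s'.ireg 7 = 0))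
    (fun s' => 160 * (n - s'.ireg 2)) ⟨Frame.refl s, by omega, by omega, ?_, fun _ => h7, ?_⟩
    ?_).mono ?_
  · intro k k1 k2
    -- After all `n` cuts the head minimises direction `n`, which is direction `0`, so the pointer
    -- can start at cell `0`.
    have h0 := hI.head k k1 k2
    rw [← zero_add n, hW.edge_periodic] at h0
    rw [h2, h6]
    exact h0
  · intro hno
    exact absurd (fun j hj => by omega) hno
  · rintro s1 ⟨g1, g2, g3, g4, g5, g6⟩ hb
    have hs1 : HoldsInput n W r ε s1 := hs.frame g1 (by simp) (by simp) (by simp) (by simp)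
      (by simp) (by simp)
    have hc1 : HoldsCycle V h t s1 := hc.frame g1 (by simp) (by simp) (by simp)
    have e1 : s1.ireg 1 = s.ireg 1 := g1.ireg 1 (by simp)
    simp only [Test.Holds, IExp.eval, hs1.size] at hb
    refine (runs_checkStep hW hεr hI s1 hs1 hc1 hb (by omega) g4).mono ?_
    rintro s2 T ⟨k1, k2, k3, k4, k5, k6, k7⟩
    refine ⟨⟨(g1.trans k1).mono (by simp) (by simp) (by simp), by omega, by omega, k4, ?_, ?_⟩, ?_⟩
    · intro hall
      rw [k2] at hall
      rw [k5 (hall (s1.ireg 2) (by omega)), g5 fun j hj => hall j (by omega)]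
    · intro hno
      rw [k2] at hno
      by_cases hlast : M (s1.ireg 2)
      · rw [k5 hlast]
        refine g6 fun hall => hno fun j hj => ?_
        rcases (show j < s1.ireg 2 ∨ j = s1.ireg 2 by omega) with hj | rfl
        · exact hall j hj
        · exact hlast
      · exact k6 hlast
    · simp only [IExp.cost, Test.cost]
      omega
  · rintro s1 T ⟨⟨g1, g2, g3, g4, g5, g6⟩, hb, hT⟩
    have hs1 : HoldsInput n W r ε s1 := hs.frame g1 (by simp) (by simp) (by simp) (by simp)
      (by simp) (by simp)
    simp only [Test.Holds, IExp.eval, hs1.size] at hb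
    have : s1.ireg 2 = n := by omega
    rw [this] at g5 g6
    simp only [IExp.cost, Test.cost] at hT
    exact ⟨g1, g5, g6, by omega⟩

/-- Compute `r - ε` and repeat the first two vertices after the last one. -/
def prepare : Program :=
  .seq (.rset 2 (.sub (.reg 0) (.reg 1)))
  (.seq (.rstore 0 (.reg 0) (.load 0 (.const 0)))
  (.seq (.rstore 1 (.reg 0) (.load 1 (.const 0)))
  (.seq (.rstore 0 (.add (.reg 0) (.const 1)) (.load 0 (.const 1)))
    (.rstore 1 (.add (.reg 0) (.const 1)) (.load 1 (.const 1))))))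

theorem runs_prepare {n : ℕ} (hn : 3 ≤ n) (h0 : 0 < n) (q : Fin n → Plane) (r ε : ℝ) :
    Runs prepare (inputState q r ε) fun s' T =>
      Frame ∅ {2} {0, 1} (inputState q r ε) s' ∧ HoldsInput n (wrap h0 q) r ε s' ∧ T ≤ 40 := by
  have n1 : 0 ≠ n := by omega
  have n2 : 1 ≠ n := by omega
  refine Runs.seq (Runs.rset (Runs.seq (Runs.rstore (Runs.seq (Runs.rstore (Runs.seq (Runs.rstore
    (Runs.rstore ⟨⟨fun _ _ => rfl, fun x hx => ?_, fun a ha => ?_⟩, ⟨?_, ?_, ?_, ?_, ?_⟩,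
      ?_⟩))))))))
  · simp only [Set.mem_singleton_iff] at hx
    simp [hx]
  · simp only [Set.mem_insert_iff, Set.mem_singleton_iff, not_or] at ha
    simp [ha.1, ha.2]
  · simp [inputState]
  · simp [inputState]
  · simp [inputState]
  · simp [inputState, RExp.eval]
  · intro k hk
    rcases (show k < n ∨ k = n ∨ k = n + 1 by omega) with hk | rfl | rfl
    · have k1 : k ≠ n := by omega
      have k2 : k ≠ n + 1 := by omega
      apply plane_ext <;>
      simp [State.pt, IExp.eval, RExp.eval, inputState, wrap, Nat.mod_eq_of_lt hk, hk, k1, k2]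
    · apply plane_ext <;>
      simp [State.pt, IExp.eval, RExp.eval, inputState, wrap, h0]
    · have h1 : 1 < n := by omega
      apply plane_ext <;>
      simp [State.pt, IExp.eval, RExp.eval, inputState, wrap, h1, n2,
        Nat.mod_eq_of_lt h1]
  · simp [RExp.cost, IExp.cost]

/-- Check all vertices against the polygon in arrays `2`, `3`; the answer goes to integer
register `7`. -/
def checkAll : Program :=
  .branch (.ilt (.const 0) (.reg 1))
    (.seq (.rstore 2 (.reg 1) (.load 2 (.const 0)))
    (.seq (.rstore 3 (.reg 1) (.load 3 (.const 0)))
    (.seq (.iset 6 (.const 0))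
    (.seq (.iset 2 (.const 0))
    (.seq (.iset 7 (.const 1)) checkLoop)))))
    (.iset 7 (.const 0))

theorem runs_checkAll {n : ℕ} {W V : ℕ → Plane} (hW : ConvexCycle n W) {r ε : ℝ} (hεr : ε < r)
    {h t : ℕ} (hI : CutInv n W (r - ε) n V h t) (s : State) (hs : HoldsInput n W r ε s)
    (hm : h + s.ireg 1 = t) (hv : ∀ k < s.ireg 1, s.pt 2 k = V (h + k)) :
    Runs checkAll s fun s' T => s'.ireg 1 = s.ireg 1 ∧
      (∀ k < s.ireg 1, s'.pt 2 k = V (h + k)) ∧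
      ((∀ j < n, (Metric.closedBall (W (j + 1)) (r + ε) ∩ cutRegion n W (r - ε) n).Nonempty) →
        s'.ireg 7 = 1) ∧
      ((¬ ∀ j < n, (Metric.closedBall (W (j + 1)) (r + ε) ∩ cutRegion n W (r - ε) n).Nonempty) →
        s'.ireg 7 = 0) ∧ T ≤ 160 * n + 50 := by
  refine Runs.branch (fun hb => ?_) (fun hb => ?_)
  · simp only [Test.Holds, IExp.eval] at hb
    refine Runs.seq (Runs.rstore (Runs.seq (Runs.rstore (Runs.seq (Runs.iset (Runs.seq (Runs.iset
      (Runs.seq (Runs.iset ?_)))))))))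
    generalize hs' : (State.mk _ _ _ _) = s'
    have hF : Frame {2, 6, 7} ∅ {2, 3} s s' := by
      rw [← hs']
      refine ⟨fun x hx => ?_, fun _ _ => rfl, fun a ha => ?_⟩
      · simp only [Set.mem_insert_iff, Set.mem_singleton_iff, not_or] at hx
        simp [hx.1, hx.2.1, hx.2.2]
      · simp only [Set.mem_insert_iff, Set.mem_singleton_iff, not_or] at ha
        simp [ha.1, ha.2]
    have e1 : s'.ireg 1 = s.ireg 1 := hF.ireg 1 (by simp)
    have hpt : ∀ k, s'.pt 2 k = if k = s.ireg 1 then s.pt 2 0 else s.pt 2 k := by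
      intro k
      rw [← hs']
      split_ifs with hk
      · apply plane_ext <;> simp [State.pt, IExp.eval, RExp.eval, hk]
      · apply plane_ext <;> simp [State.pt, IExp.eval, RExp.eval, hk]
    have hc : HoldsCycle V h t s' := by
      refine ⟨by rw [e1, hm], fun k hk => ?_, ?_⟩
      · rw [hpt, if_neg (by omega), hv k (by omega)]
      · rw [hpt, if_pos e1, hv 0 hb, add_zero]
    have hin : HoldsInput n W r ε s' := hs.frame hF (by simp) (by simp) (by simp) (by simp)
      (by simp) (by simp)
    refine (runs_checkLoop hW hεr hI s' hin hc ?_ ?_ ?_ (by omega)).mono ?_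
    · rw [← hs']; simp [IExp.eval]
    · rw [← hs']; simp [IExp.eval]
    · rw [← hs']; simp [IExp.eval]
    · rintro s2 T ⟨F2, g1, g2, hT⟩
      have hc2 := hc.frame F2 (by simp) (by simp) (by simp)
      have e2 : s2.ireg 1 = s.ireg 1 := by rw [F2.ireg 1 (by simp), e1]
      refine ⟨e2, fun k hk => hc2.vertex k (by omega), g1, g2, ?_⟩
      simp [Test.cost, IExp.cost, RExp.cost]
      omega
  · simp only [Test.Holds, IExp.eval] at hb
    -- No vertices means an empty core, which no disk meets.
    have hempty : cutRegion n W (r - ε) n = ∅ := by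
      rw [← hI.hull, Set.Ico_eq_empty (by omega), Set.image_empty, convexHull_empty]
    refine Runs.iset ⟨by simp, fun k hk => by omega, fun hall => ?_, fun _ => by simp [IExp.eval], ?_⟩
    · have := hall 0 (by have := hW.three_le; omega)
      rw [hempty, Set.inter_empty] at this
      exact absurd this Set.not_nonempty_empty
    · simp [Test.cost, IExp.cost]

/-- The linear-time implementation of `ConvexDecide`. -/
def convexDecideProgram : Program :=
  .branch (.rlt (.reg 1) (.reg 0))
    (.seq prepare
    (.seq (copyPoints 0 4 0)
    (.seq (.iset 4 (.reg 0))
    (.seq (.iset 2 (.const 0))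
    (.seq cutLoop
    (.seq (.iset 1 (.sub (.reg 4) (.reg 3)))
    (.seq (copyPoints 4 2 1)
    (.seq checkAll (.iset 0 (.reg 7))))))))))
    (.iset 0 (.const 1))

theorem holdsPolygon_of_cutInv {n : ℕ} {W V : ℕ → Plane} {δ : ℝ} {h t : ℕ}
    (hI : CutInv n W δ n V h t) {s : State} (hm : h + s.ireg 1 = t)
    (hv : ∀ k < s.ireg 1, s.pt 2 k = V (h + k)) : HoldsPolygon s (cutRegion n W δ n) := by
  refine ⟨fun i => V (h + i), hI.conv.isCCWConvex hm, ?_, fun i => ?_⟩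
  · rw [StrictConvexOn.polygon_eq hm, hI.hull]
  · simp only [← hv i i.2]
    simp [State.pt]

/-- The loop tests the vertices in the order `1, …, n`, with `W n = W 0`, since it handles the
vertex at the end of each edge. -/
theorem convexDecide_iff {n : ℕ} (hn : 0 < n) {q : Fin n → Plane}
    (hW : ConvexCycle n (wrap hn q)) {r ε : ℝ} (hε : 0 < ε) (h : ε < r) :
    ConvexDecide q r ε ↔ ∀ j < n, (Metric.closedBall (wrap hn q (j + 1)) (r + ε) ∩
      cutRegion n (wrap hn q) (r - ε) n).Nonempty := by
  unfold ConvexDecide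
  rw [polygon_eq_wrap hn q, core_eq_cutRegion hW hε h]
  constructor
  · exact fun hall j _ => hall ⟨(j + 1) % n, Nat.mod_lt _ hn⟩
  · intro hall i
    have hi : wrap hn q i = q i := by simp [wrap, Nat.mod_eq_of_lt i.2]
    rw [← hi]
    by_cases h0 : (i : ℕ) = 0
    · have := hall (n - 1) (by omega)
      rwa [show n - 1 + 1 = 0 + n by omega, hW.periodic, ← h0] at this
    · have := hall (i - 1) (by omega)
      rwa [show (i : ℕ) - 1 + 1 = i by omega] at this

theorem runs_convexDecideProgram {n : ℕ} (hn : 3 ≤ n) {q : Fin n → Plane} (hq : IsCCWConvex q)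
    {r ε : ℝ} (hr : 0 < r) (hε : 0 < ε) :
    Runs convexDecideProgram (inputState q r ε) fun s' T => T ≤ 2000 * n ∧
      AnswerIs s' (ConvexDecide q r ε) ∧
      (ε < r → HoldsPolygon s' (core (polygon q) r ε)) := by
  have h0 : 0 < n := by omega
  have hW := convexCycle_wrap hn hq h0
  refine Runs.branch (fun hb => ?_) (fun hb => ?_)
  · simp [Test.Holds, RExp.eval, inputState] at hb
    refine Runs.seq ((runs_prepare hn h0 q r ε).mono ?_)
    rintro s1 T1 ⟨F1, hs1, hT1⟩
    refine Runs.seq ((runs_copyPoints s1 (by norm_num) (by norm_num)).mono ?_)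
    rintro s2 T2 ⟨F2, hp2, hT2⟩
    have hs2 : HoldsInput n (wrap h0 q) r ε s2 := hs1.frame F2 (by simp) (by simp) (by simp)
      (by simp) (by simp) (by simp)
    have e13 : s1.ireg 3 = 0 := by rw [F1.ireg 3 (by simp)]; simp [inputState]
    refine Runs.seq (Runs.iset (Runs.seq (Runs.iset ?_)))
    generalize hs3' : (State.mk _ _ _ _) = s3
    have F3 : Frame {2, 4} ∅ ∅ s2 s3 := by
      rw [← hs3']
      refine ⟨fun x hx => ?_, fun _ _ => rfl, fun _ _ => rfl⟩
      simp only [Set.mem_insert_iff, Set.mem_singleton_iff, not_or] at hx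
      simp [hx.1, hx.2]
    have hs3 : HoldsInput n (wrap h0 q) r ε s3 := hs2.frame F3 (by simp) (by simp) (by simp)
      (by simp) (by simp) (by simp)
    have hinit : CutInv n (wrap h0 q) (r - ε) 0 (s3.pt 4) 0 n := by
      refine CutInv.init hW fun k hk => ?_
      rw [F3.pt (by simp) (by simp), hp2 k (by rw [hs1.size]; exact hk), e13, zero_add,
        hs1.vertex k (by omega)]
    refine Runs.seq ((runs_cutLoop hW hb s3 hs3 (by rw [← hs3']; simp [IExp.eval]) ?_
      (by rw [← hs3']; simp [IExp.eval, hs2.size]) hinit).mono ?_)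
    · rw [F3.ireg 3 (by simp), F2.ireg 3 (by simp), e13]
    rintro s4 T4 ⟨hs4, hle, hlen, hI, hT4⟩
    refine Runs.seq (Runs.iset ?_)
    have F5 := frame_iset s4 1 (IExp.eval s4 (.sub (.reg 4) (.reg 3)))
    have e51 : (Function.update s4.ireg 1 (IExp.eval s4 (.sub (.reg 4) (.reg 3)))) 1 =
      s4.ireg 4 - s4.ireg 3 := by simp [IExp.eval]
    revert F5 e51
    generalize hs5' : (State.mk _ _ _ _) = s5
    intro F5 e51
    have e51 : s5.ireg 1 = s4.ireg 4 - s4.ireg 3 := by rw [← hs5']; exact e51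
    refine Runs.seq ((runs_copyPoints s5 (by norm_num) (by norm_num)).mono ?_)
    rintro s6 T6 ⟨F6, hp6, hT6⟩
    have F56 := F5.trans F6
    have hs6 : HoldsInput n (wrap h0 q) r ε s6 := hs4.frame F56 (by simp) (by simp) (by simp)
      (by simp) (by simp) (by simp)
    have e61 : s6.ireg 1 = s4.ireg 4 - s4.ireg 3 := by rw [F6.ireg 1 (by simp), e51]
    have hm6 : s4.ireg 3 + s6.ireg 1 = s4.ireg 4 := by omega
    have hv6 : ∀ k < s6.ireg 1, s6.pt 2 k = s4.pt 4 (s4.ireg 3 + k) := by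
      intro k hk
      rw [hp6 k (by omega), F5.pt (by simp) (by simp), F5.ireg 3 (by simp)]
    refine Runs.seq ((runs_checkAll hW hb hI s6 hs6 hm6 hv6).mono ?_)
    rintro s7 T7 ⟨g1, g2, g3, g4, hT7⟩
    rw [← convexDecide_iff h0 hW hε hb] at g3 g4
    have F8 := frame_iset s7 0 (IExp.eval s7 (.reg 7))
    refine Runs.iset ⟨?_, ⟨fun h => ?_, fun h => ?_⟩, fun _ => ?_⟩
    · rw [hs1.size] at hT2
      simp only [IExp.cost, Test.cost, RExp.cost]
      -- The dominant terms are `30 n` and `550 n` for the first copy and the cuts, `30 * 15 n` for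
      -- copying the result and `160 n` for the tests; `n ≥ 3` absorbs the additive constants into
      -- `2000 n`.
      omega
    · simp [IExp.eval, g3 h]
    · simp [IExp.eval, g4 h]
    · rw [polygon_eq_wrap h0 q, core_eq_cutRegion hW hε hb]
      refine holdsPolygon_of_cutInv hI (h := s4.ireg 3) (t := s4.ireg 4) ?_ fun k hk => ?_
      · rw [F8.ireg 1 (by simp), g1, hm6]
      · rw [F8.ireg 1 (by simp), g1] at hk
        rw [F8.pt (by simp) (by simp), g2 k hk]
  · simp [Test.Holds, RExp.eval, inputState] at hb
    have hyes : ConvexDecide q r ε := convexDecide_of_le q hr hb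
    refine Runs.iset ⟨?_, ⟨fun _ => by simp [IExp.eval], fun h => absurd hyes h⟩,
      fun h => absurd h hb.not_gt⟩
    simp only [IExp.cost, Test.cost, RExp.cost]
    omega

end OffsetDecon

theorem mainTheorem10 :
    (∀ (n : ℕ) (q : Fin n → OffsetDecon.Plane), 3 ≤ n → OffsetDecon.IsCCWConvex q →
      ∀ r ε : ℝ, 0 < r → 0 < ε →
        (OffsetDecon.ConvexDecide q r ε ↔ OffsetDecon.Decide (OffsetDecon.polygon q) r ε)) ∧
    (∃ (prog : OffsetDecon.Program) (C : ℕ),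
      ∀ (n : ℕ) (q : Fin n → OffsetDecon.Plane), 3 ≤ n → OffsetDecon.IsCCWConvex q →
        ∀ r ε : ℝ, 0 < r → 0 < ε →
          ∃ (s : OffsetDecon.State) (t : ℕ),
            OffsetDecon.Exec prog (OffsetDecon.inputState q r ε) s t ∧
            t ≤ C * n ∧
            OffsetDecon.AnswerIs s (OffsetDecon.ConvexDecide q r ε) ∧
            (ε < r →
              OffsetDecon.HoldsPolygon s (OffsetDecon.core (OffsetDecon.polygon q) r ε))) :=
  ⟨fun _ q _ _ r ε _ _ => OffsetDecon.convexDecide_iff_decide q r ε,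
    OffsetDecon.convexDecideProgram, 2000, fun _ _ hn hq _ _ hr hε =>
      OffsetDecon.runs_convexDecideProgram hn hq hr hε⟩
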